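/- **Setting.** Let $0\le\mathcal O<P$ and $1\le k$ be integers. For each sample size $n>P$ let $Y=X\theta+u$, where $X=X_n$ is a non-random $n\times P$ matrix of rank $P$ and $u\sim N(0,\sigma^2I_n)$, $\sigma>0$; $P_{n,\theta,\sigma}$ denotes the resulting probability. Assume that $X'X/n\to Q$ as $n\to\infty$ with $Q$ non-singular. Let $A$ be a fixed $k\times P$ matrix of rank $k$. For a matrix $D$ with $P$ columns, $D[p]$ and $D[\neg p]$ are the matrices of its first $p$ and last $P-p$ columns, and likewise $x[p]$, $x[\neg p]$ for $x\in\mathbb R^P$; $Q[p:p]$ is the upper left $p\times p$ block of $Q$ and $Q[p:\neg p]$ the upper right $p\times(P-p)$ block. Let $\tilde\theta(p)\in\mathbb R^P$ have first $p$ components $(X[p]'X[p])^{-1}X[p]'Y$ and all others $0$. Put $\hat\sigma^2=(n-P)^{-1}\|Y-X\tilde\theta(P)\|^2$, $\xi_{n,p}^2=[(X[p]'X[p]/n)^{-1}]_{p,p}$, $T_0=T_0^*=0$, $T_p=\sqrt n\,\tilde\theta_p(p)/(\hat\sigma\xi_{n,p})$ and $T_p^*=\sqrt n\,\tilde\theta_p(p)/(\sigma\xi_{n,p})$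 for $0<p\le P$. With critical values $c_p\in(0,\infty)$ for $\mathcal O<p\le P$ and $c_{\mathcal O}=0$, let $\hat p=\max\{0\le p\le P:|T_p|\ge c_p\}$, $\hat p^*=\max\{0\le p\le P:|T^*_p|\ge c_p\}$, $\tilde\theta=\tilde\theta(\hat p)$, $\tilde\theta^*=\tilde\theta(\hat p^*)$. Define, for $t\in\mathbb R^k$ (with $\le$ componentwise), $$G_{n,\theta,\sigma}(t)=P_{n,\theta,\sigma}(\sqrt nA(\tilde\theta-\theta)\le t),\qquad G^*_{n,\theta,\sigma}(t)=P_{n,\theta,\sigma}(\sqrt nA(\tilde\theta^*-\theta)\le t),$$ $\pi_{n,\theta,\sigma}(p)=P_{n,\theta,\sigma}(\hat p=p)$ and $\pi^*_{n,\theta,\sigma}(p)=P_{n,\theta,\sigma}(\hat p^*=p)$. Let $p_0(\theta)=\min\{0\le p\le P:\theta_{p+1}=\dots=\theta_P=0\}$. **Limit quantities.** For $0<p\le P$ let $\Phi_{\infty,p}$ be the cdf of the centered Gaussian law on $\mathbb R^k$ with covariance matrix $\sigma^2V_p$, $V_p=A[p]Q[p:p]^{-1}A[p]'$, and let $\Phi_{\infty,0}$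 be the cdf of point mass at $0$. Put $\xi_{\infty,p}^2=(Q[p:p]^{-1})_{p,p}$, $C_\infty^{(p)}=A[p]Q[p:p]^{-1}e_p$, $b_{\infty,p}=C_\infty^{(p)\prime}V_p^-$, $\zeta_{\infty,p}^2=\xi_{\infty,p}^2-b_{\infty,p}C_\infty^{(p)}$ (with $\xi_{\infty,p},\zeta_{\infty,p}\ge0$), where $V_p^-$ is an arbitrary generalized inverse ($V_pV_p^-V_p=V_p$). Let $\Delta_s(a,b)=P(|M-a|<b)$ for $M\sim N(0,s^2)$, $s\ge0$ ($M=0$ if $s=0$). For $\psi\in(\mathbb R\cup\{\pm\infty\})^P$ let $p_*$ be the largest $p$ with $\mathcal O<p\le P$ and $|\psi_p|=\infty$, and $p_*=\mathcal O$ if there is none; for $p_*\le p\le P$ let $$\delta^{(p)}=\begin{pmatrix}Q[p:p]^{-1}Q[p:\neg p]\\-I_{P-p}\end{pmatrix}\psi[\neg p]$$ ($\delta^{(P)}=0$, $\delta^{(0)}=-\psi$). **Statement.** (a) *Local alternatives.* Fix $\theta,\gamma\in\mathbb R^P$, put $\theta^{(n)}=\theta+\gamma/\sqrt n$, and let $\sigma^{(n)}>0$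 converge to a finite $\sigma>0$. Then $\sqrt n\,\theta^{(n)}$ converges in $(\mathbb R\cup\{\pm\infty\})^P$ to a limit $\psi$ for which $$p_*=\max\{p_0(\theta),\mathcal O\}\quad\text{and}\quad\psi[\neg p_*]=\gamma[\neg p_*];$$ for $p_*\le p\le P$, the scaled bias $\sqrt n(E_{n,\theta^{(n)},\sigma^{(n)}}\tilde\theta(p)-\theta^{(n)})$ converges to $\delta^{(p)}$; both $G^*_{n,\theta^{(n)},\sigma^{(n)}}$ and $G_{n,\theta^{(n)},\sigma^{(n)}}$ converge in total variation to the cdf $$\Phi_{\infty,p_*}(t-A\delta^{(p_*)})\prod_{q=p_*+1}^P\Delta_{\sigma\xi_{\infty,q}}(\delta_q^{(q)}+\psi_q,c_q\sigma\xi_{\infty,q})$$ $$+\sum_{p=p_*+1}^P\int_{z\le t-A\delta^{(p)}}\Bigl(1-\Delta_{\sigma\zeta_{\infty,p}}(\delta_p^{(p)}+\psi_p+b_{\infty,p}z,\,c_p\sigma\xi_{\infty,p})\Bigr)\Phi_{\infty,p}(dz)\prod_{q=p+1}^P\Delta_{\sigma\xi_{\infty,q}}(\delta_q^{(q)}+\psi_q,c_q\sigma\xi_{\infty,q});$$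 and both $\pi_{n,\theta^{(n)},\sigma^{(n)}}(p)$ and $\pi^*_{n,\theta^{(n)},\sigma^{(n)}}(p)$ converge to $$\Bigl(1-\Delta_{\sigma\xi_{\infty,p}}(\delta_p^{(p)}+\psi_p,c_p\sigma\xi_{\infty,p})\Bigr)\prod_{q=p+1}^P\Delta_{\sigma\xi_{\infty,q}}(\delta_q^{(q)}+\psi_q,c_q\sigma\xi_{\infty,q})\quad\text{if }p_*<p\le P,$$ to $\prod_{q=p_*+1}^P\Delta_{\sigma\xi_{\infty,q}}(\delta_q^{(q)}+\psi_q,c_q\sigma\xi_{\infty,q})$ if $p=p_*$, and to $0$ if $\mathcal O\le p<p_*$. (b) *Fixed parameter.* Fix $\theta\in\mathbb R^P$ and $\sigma>0$ and let $p_*=\max\{p_0(\theta),\mathcal O\}$. Then $G^*_{n,\theta,\sigma}$ and $G_{n,\theta,\sigma}$ converge in total variation to the cdf $$\Phi_{\infty,p_*}(t)\prod_{q=p_*+1}^P\Delta_{\sigma\xi_{\infty,q}}(0,c_q\sigma\xi_{\infty,q})+\sum_{p=p_*+1}^P\int_{z\le t}\bigl(1-\Delta_{\sigma\zeta_{\infty,p}}(b_{\infty,p}z,c_p\sigma\xi_{\infty,p})\bigr)\Phi_{\infty,p}(dz)\prod_{q=p+1}^P\Delta_{\sigma\xi_{\infty,q}}(0,c_q\sigma\xi_{\infty,q}),$$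 and $\pi_{n,\theta,\sigma}(p)$ and $\pi^*_{n,\theta,\sigma}(p)$ converge to $\bigl(1-\Delta_{\sigma\xi_{\infty,p}}(0,c_p\sigma\xi_{\infty,p})\bigr)\prod_{q=p+1}^P\Delta_{\sigma\xi_{\infty,q}}(0,c_q\sigma\xi_{\infty,q})$ if $p_*<p\le P$, to $\prod_{q=p_*+1}^P\Delta_{\sigma\xi_{\infty,q}}(0,c_q\sigma\xi_{\infty,q})$ if $p=p_*$, and to $0$ if $\mathcal O\le p<p_*$. -/

import Mathlib

open MeasureTheory ProbabilityTheory Filter Topology Matrix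

namespace PostModelSelection

noncomputable section

/-! ### Matrix notation

Regressors are numbered `j : Fin P` (zero-based), so the `p`-th regressor, `1 ≤ p ≤ P`, is the index
`j` with `(j : ℕ) + 1 = p`. Model orders `p` are natural numbers. -/

/-- `D[p]`: the first `p` columns of `D`. -/
def firstCols {m : Type*} {P : ℕ} (D : Matrix m (Fin P) ℝ) (p : ℕ) :
    Matrix m {j : Fin P // (j : ℕ) < p} ℝ :=
  D.submatrix id Subtype.val

/-- `Q[p : p]`: the upper left `p × p` block of `Q`. -/
def blockFF {P : ℕ} (Q : Matrix (Fin P) (Fin P) ℝ) (p : ℕ) :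
    Matrix {j : Fin P // (j : ℕ) < p} {j : Fin P // (j : ℕ) < p} ℝ :=
  Q.submatrix Subtype.val Subtype.val

/-- `Q[p : ¬p]`: the upper right `p × (P - p)` block of `Q`. -/
def blockFL {P : ℕ} (Q : Matrix (Fin P) (Fin P) ℝ) (p : ℕ) :
    Matrix {j : Fin P // (j : ℕ) < p} {j : Fin P // p ≤ (j : ℕ)} ℝ :=
  Q.submatrix Subtype.val Subtype.val

/-- `x[¬p]`: the last `P - p` components of the vector `x`. -/
def lastEntries {P : ℕ} (x : Fin P → ℝ) (p : ℕ) : {j : Fin P // p ≤ (j : ℕ)} → ℝ :=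
  fun j => x j

/-- The regressor `j`, i.e. the last one in the model of order `j + 1`, as an index of that model. -/
def lastIdx {P : ℕ} (j : Fin P) : {i : Fin P // (i : ℕ) < (j : ℕ) + 1} :=
  ⟨j, Nat.lt_succ_self _⟩

/-- `B` is a generalized inverse of `V`. -/
def IsGenInverse {k : ℕ} (V B : Matrix (Fin k) (Fin k) ℝ) : Prop :=
  V * B * V = V

/-! ### The model, the nested candidate models and the estimators -/

/-- `P_{n,θ,σ}`: the distribution of `Y = X θ + u` with `u ~ N(0, σ² Iₙ)`. -/
def sampleMeasure {n P : ℕ} (X : Matrix (Fin n) (Fin P) ℝ) (θ : Fin P → ℝ) (σ : ℝ) :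
    Measure (Fin n → ℝ) :=
  (Measure.pi fun _ : Fin n => gaussianReal 0 (σ ^ 2).toNNReal).map fun u => X *ᵥ θ + u

/-- The model `M_p = {θ : θ_{p+1} = ⋯ = θ_P = 0}`. -/
def model (P p : ℕ) : Set (Fin P → ℝ) :=
  {θ | ∀ j : Fin P, p ≤ (j : ℕ) → θ j = 0}

/-- The order `p₀(θ)` of `θ`: the smallest `p ≤ P` with `θ ∈ M_p`. -/
def order {P : ℕ} (θ : Fin P → ℝ) : ℕ :=
  sInf {p : ℕ | p ≤ P ∧ θ ∈ model P p}

/-- The restricted least-squares estimator `θ̃(p)`. -/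
def restrictedLS {n P : ℕ} (X : Matrix (Fin n) (Fin P) ℝ) (p : ℕ) (Y : Fin n → ℝ) : Fin P → ℝ :=
  fun i => if h : (i : ℕ) < p then
      (((firstCols X p)ᵀ * firstCols X p)⁻¹ *ᵥ ((firstCols X p)ᵀ *ᵥ Y)) ⟨i, h⟩
    else 0

/-- The usual estimator `σ̂` of `σ`, from the overall model. -/
def sigmaHat {n P : ℕ} (X : Matrix (Fin n) (Fin P) ℝ) (Y : Fin n → ℝ) : ℝ :=
  √(((n : ℝ) - P)⁻¹ *
    ((Y - X *ᵥ restrictedLS X P Y) ⬝ᵥ (Y - X *ᵥ restrictedLS X P Y)))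

/-- For a `P × P` matrix `S`, the square root of the last diagonal entry of `S[p : p]⁻¹`, where
`p = j + 1`. It is `ξ_{n,p}` for `S = X'X/n`, and `ξ_{∞,p}` for `S = Q`. -/
def xi {P : ℕ} (S : Matrix (Fin P) (Fin P) ℝ) (j : Fin P) : ℝ :=
  √((blockFF S ((j : ℕ) + 1))⁻¹ (lastIdx j) (lastIdx j))

/-- The test statistic for the hypothesis on the order `p`, with `s` in place of the standard
deviation of the errors: `0` if `p = 0`, and `√n θ̃_p(p) / (s ξ_{n,p})` if `0 < p ≤ P`. -/
def testStat {n P : ℕ} (X : Matrix (Fin n) (Fin P) ℝ) (s : ℝ) (Y : Fin n → ℝ) : ℕ → ℝ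
  | 0 => 0
  | j + 1 => if h : j < P then
      √(n : ℝ) * restrictedLS X (j + 1) Y ⟨j, h⟩ / (s * xi ((n : ℝ)⁻¹ • (Xᵀ * X)) ⟨j, h⟩)
    else 0

/-- The general-to-specific selector `max {p : |T_p| ≥ c_p, 0 ≤ p ≤ P}`, with `s` in place of the
standard deviation of the errors. -/
def selector {n P : ℕ} (X : Matrix (Fin n) (Fin P) ℝ) (c : ℕ → ℝ) (s : ℝ) (Y : Fin n → ℝ) : ℕ :=
  ((Finset.range (P + 1)).filter fun p => c p ≤ |testStat X s Y p|).sup id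

/-- The selected order `p̂` (error variance estimated). -/
def pHat {n P : ℕ} (X : Matrix (Fin n) (Fin P) ℝ) (c : ℕ → ℝ) (Y : Fin n → ℝ) : ℕ :=
  selector X c (sigmaHat X Y) Y

/-- The selected order `p̂*` (error variance known). -/
def pHatStar {n P : ℕ} (X : Matrix (Fin n) (Fin P) ℝ) (c : ℕ → ℝ) (σ : ℝ) (Y : Fin n → ℝ) : ℕ :=
  selector X c σ Y

/-- The distribution under `P_{n,θ,σ}` of `√n A (θ̃ - θ)`, with `θ̃ = θ̃(p̂)` the post-model-selection
estimator; its cdf is `G_{n,θ,σ}`. -/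
def lawG {n P k : ℕ} (X : Matrix (Fin n) (Fin P) ℝ) (c : ℕ → ℝ) (A : Matrix (Fin k) (Fin P) ℝ)
    (θ : Fin P → ℝ) (σ : ℝ) : Measure (Fin k → ℝ) :=
  (sampleMeasure X θ σ).map fun Y => √(n : ℝ) • (A *ᵥ (restrictedLS X (pHat X c Y) Y - θ))

/-- The distribution under `P_{n,θ,σ}` of `√n A (θ̃* - θ)`, with `θ̃* = θ̃(p̂*)` the idealized
post-model-selection estimator; its cdf is `G*_{n,θ,σ}`. -/
def lawGStar {n P k : ℕ} (X : Matrix (Fin n) (Fin P) ℝ) (c : ℕ → ℝ) (A : Matrix (Fin k) (Fin P) ℝ)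
    (θ : Fin P → ℝ) (σ : ℝ) : Measure (Fin k → ℝ) :=
  (sampleMeasure X θ σ).map fun Y => √(n : ℝ) • (A *ᵥ (restrictedLS X (pHatStar X c σ Y) Y - θ))

/-- The model selection probability `π_{n,θ,σ}(p)`. -/
def selProb {n P : ℕ} (X : Matrix (Fin n) (Fin P) ℝ) (c : ℕ → ℝ) (θ : Fin P → ℝ) (σ : ℝ)
    (p : ℕ) : ℝ :=
  (sampleMeasure X θ σ).real {Y | pHat X c Y = p}

/-- The idealized model selection probability `π*_{n,θ,σ}(p)`. -/
def selProbStar {n P : ℕ} (X : Matrix (Fin n) (Fin P) ℝ) (c : ℕ → ℝ) (θ : Fin P → ℝ) (σ : ℝ)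
    (p : ℕ) : ℝ :=
  (sampleMeasure X θ σ).real {Y | pHatStar X c σ Y = p}

/-- The bias of `θ̃(p)`, scaled by `√n`. -/
def scaledBias {n P : ℕ} (X : Matrix (Fin n) (Fin P) ℝ) (θ : Fin P → ℝ) (σ : ℝ) (p : ℕ) :
    Fin P → ℝ :=
  √(n : ℝ) • ((∫ Y, restrictedLS X p Y ∂(sampleMeasure X θ σ)) - θ)

/-! ### Convergence in total variation -/

/-- Total variation distance (supremum over measurable sets). -/
def tvDist {α : Type*} [MeasurableSpace α] (μ ν : Measure α) : ℝ :=
  ⨆ s : {s : Set α // MeasurableSet s}, |μ.real s - ν.real s|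

/-- `F` is the cdf of a probability measure on `ℝ^k`, and `μ n` converges to that measure in total
variation. -/
def TendstoTV {k : ℕ} (μ : ℕ → Measure (Fin k → ℝ)) (F : (Fin k → ℝ) → ℝ) : Prop :=
  ∃ ν : Measure (Fin k → ℝ), IsProbabilityMeasure ν ∧ (∀ t, ν.real (Set.Iic t) = F t) ∧
    Tendsto (fun n => tvDist (μ n) ν) atTop (𝓝 0)

/-! ### The limit quantities -/

/-- `Δ_s(a, b) = P(|M - a| < b)` for `M ~ N(0, s²)`. -/
def Del (s a b : ℝ) : ℝ :=
  (gaussianReal 0 (s ^ 2).toNNReal).real {x | |x - a| < b}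

/-- `A[p] Q[p : p]⁻¹ A[p]'`, which is the zero matrix for `p = 0`. -/
def covMat {P k : ℕ} (Q : Matrix (Fin P) (Fin P) ℝ) (A : Matrix (Fin k) (Fin P) ℝ) (p : ℕ) :
    Matrix (Fin k) (Fin k) ℝ :=
  firstCols A p * (blockFF Q p)⁻¹ * (firstCols A p)ᵀ

/-- The distribution on `ℝ^k` with cdf `Φ_{∞,p}`: centered Gaussian with covariance matrix
`σ² A[p] Q[p : p]⁻¹ A[p]'`; point mass at zero for `p = 0`. -/
def Phi {P k : ℕ} (Q : Matrix (Fin P) (Fin P) ℝ) (A : Matrix (Fin k) (Fin P) ℝ) (σ : ℝ) (p : ℕ) :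
    Measure (Fin k → ℝ) :=
  (multivariateGaussian 0 (σ ^ 2 • covMat Q A p)).map WithLp.ofLp

/-- `C_∞^{(p)} = A[p] Q[p : p]⁻¹ e_p`, where `p = j + 1`. -/
def Cvec {P k : ℕ} (Q : Matrix (Fin P) (Fin P) ℝ) (A : Matrix (Fin k) (Fin P) ℝ) (j : Fin P) :
    Fin k → ℝ :=
  firstCols A ((j : ℕ) + 1) *ᵥ ((blockFF Q ((j : ℕ) + 1))⁻¹ *ᵥ Pi.single (lastIdx j) 1)

/-- `b_{∞,p} = C_∞^{(p)}' B`, with `B` a generalized inverse of `A[p] Q[p : p]⁻¹ A[p]'` and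
`p = j + 1`. -/
def bvec {P k : ℕ} (Q : Matrix (Fin P) (Fin P) ℝ) (A : Matrix (Fin k) (Fin P) ℝ)
    (B : Matrix (Fin k) (Fin k) ℝ) (j : Fin P) : Fin k → ℝ :=
  Cvec Q A j ᵥ* B

/-- `ζ_{∞,p}`, the square root of `ξ_{∞,p}² - b_{∞,p} C_∞^{(p)}`, where `p = j + 1`. -/
def zeta {P k : ℕ} (Q : Matrix (Fin P) (Fin P) ℝ) (A : Matrix (Fin k) (Fin P) ℝ)
    (B : Matrix (Fin k) (Fin k) ℝ) (j : Fin P) : ℝ :=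
  √(xi Q j ^ 2 - bvec Q A B j ⬝ᵥ Cvec Q A j)

/-- For the limit `ψ` of `√n θ⁽ⁿ⁾`, the index `p_*`: the largest `p` with `O < p ≤ P` and
`|ψ_p| = ∞`, and `O` if there is none. -/
def pStar {P : ℕ} (O : ℕ) (ψ : Fin P → EReal) : ℕ :=
  max O ((Finset.univ.filter fun j : Fin P => O ≤ (j : ℕ) ∧ (ψ j = ⊤ ∨ ψ j = ⊥)).sup
    fun j => (j : ℕ) + 1)

/-- `δ^{(p)}`: first `p` components `Q[p : p]⁻¹ Q[p : ¬p] ψ[¬p]`, last ones `-ψ[¬p]`. Only the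
components of `ψ` of index larger than `p` matter. -/
def delta {P : ℕ} (Q : Matrix (Fin P) (Fin P) ℝ) (ψ : Fin P → ℝ) (p : ℕ) : Fin P → ℝ :=
  fun i => if h : (i : ℕ) < p then
      ((blockFF Q p)⁻¹ *ᵥ (blockFL Q p *ᵥ lastEntries ψ p)) ⟨i, h⟩
    else - ψ i

/-- `Δ_{σ ξ_{∞,q}}(δ_q^{(q)} + ψ_q, c_q σ ξ_{∞,q})`, where `q = j + 1`. -/
def accept {P : ℕ} (Q : Matrix (Fin P) (Fin P) ℝ) (c : ℕ → ℝ) (σ : ℝ) (ψ : Fin P → ℝ)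
    (j : Fin P) : ℝ :=
  Del (σ * xi Q j) (delta Q ψ ((j : ℕ) + 1) j + ψ j) (c ((j : ℕ) + 1) * σ * xi Q j)

/-- The limit cdf of `√n A (θ̃ - θ⁽ⁿ⁾)`. It depends on `ψ` only through the components of index larger
than `ps` (that is `p_*`); `B j` is a generalized inverse of `A[p] Q[p : p]⁻¹ A[p]'` for
`p = j + 1`. The sum is over `ps < p ≤ P`, the products over `ps < q ≤ P` and `p < q ≤ P`. -/
def limitCdf {P k : ℕ} (Q : Matrix (Fin P) (Fin P) ℝ) (A : Matrix (Fin k) (Fin P) ℝ)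
    (B : Fin P → Matrix (Fin k) (Fin k) ℝ) (c : ℕ → ℝ) (σ : ℝ) (ψ : Fin P → ℝ) (ps : ℕ)
    (t : Fin k → ℝ) : ℝ :=
  (Phi Q A σ ps).real (Set.Iic (t - A *ᵥ delta Q ψ ps)) *
      ∏ q ∈ Finset.univ.filter (fun q : Fin P => ps ≤ (q : ℕ)), accept Q c σ ψ q +
    ∑ p ∈ Finset.univ.filter (fun p : Fin P => ps ≤ (p : ℕ)),
      (∫ z in Set.Iic (t - A *ᵥ delta Q ψ ((p : ℕ) + 1)),
        (1 - Del (σ * zeta Q A (B p) p)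
          (delta Q ψ ((p : ℕ) + 1) p + ψ p + bvec Q A (B p) p ⬝ᵥ z)
          (c ((p : ℕ) + 1) * σ * xi Q p)) ∂(Phi Q A σ ((p : ℕ) + 1))) *
      ∏ q ∈ Finset.Ioi p, accept Q c σ ψ q

/-- The sequence `π`, evaluated at the orders `p`, has the limits that belong to `ψ` and to `ps`
(that is `p_*`). -/
def TendstoSel {P : ℕ} (π : ℕ → ℕ → ℝ) (O : ℕ) (Q : Matrix (Fin P) (Fin P) ℝ) (c : ℕ → ℝ) (σ : ℝ)
    (ψ : Fin P → ℝ) (ps : ℕ) : Prop :=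
  (∀ p : Fin P, ps ≤ (p : ℕ) → Tendsto (fun n => π n ((p : ℕ) + 1)) atTop
      (𝓝 ((1 - accept Q c σ ψ p) * ∏ q ∈ Finset.Ioi p, accept Q c σ ψ q))) ∧
    Tendsto (fun n => π n ps) atTop
      (𝓝 (∏ q ∈ Finset.univ.filter (fun q : Fin P => ps ≤ (q : ℕ)), accept Q c σ ψ q)) ∧
    ∀ p : ℕ, O ≤ p → p < ps → Tendsto (fun n => π n p) atTop (𝓝 0)

/-! ### The limits for a fixed parameter -/

/-- `Δ_{σ ξ_{∞,q}}(0, c_q σ ξ_{∞,q})`, where `q = j + 1`. -/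
def acceptFixed {P : ℕ} (Q : Matrix (Fin P) (Fin P) ℝ) (c : ℕ → ℝ) (σ : ℝ) (j : Fin P) : ℝ :=
  Del (σ * xi Q j) 0 (c ((j : ℕ) + 1) * σ * xi Q j)

/-- The limit cdf of `√n A (θ̃ - θ)` for a fixed parameter. -/
def limitCdfFixed {P k : ℕ} (Q : Matrix (Fin P) (Fin P) ℝ) (A : Matrix (Fin k) (Fin P) ℝ)
    (B : Fin P → Matrix (Fin k) (Fin k) ℝ) (c : ℕ → ℝ) (σ : ℝ) (ps : ℕ) (t : Fin k → ℝ) : ℝ :=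
  (Phi Q A σ ps).real (Set.Iic t) *
      ∏ q ∈ Finset.univ.filter (fun q : Fin P => ps ≤ (q : ℕ)), acceptFixed Q c σ q +
    ∑ p ∈ Finset.univ.filter (fun p : Fin P => ps ≤ (p : ℕ)),
      (∫ z in Set.Iic t,
        (1 - Del (σ * zeta Q A (B p) p) (bvec Q A (B p) p ⬝ᵥ z)
          (c ((p : ℕ) + 1) * σ * xi Q p)) ∂(Phi Q A σ ((p : ℕ) + 1))) *
      ∏ q ∈ Finset.Ioi p, acceptFixed Q c σ q

/-- The sequence `π`, evaluated at the orders `p`, has the limits that belong to a fixed parameter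
for which `p_*` is `ps`. -/
def TendstoSelFixed {P : ℕ} (π : ℕ → ℕ → ℝ) (O : ℕ) (Q : Matrix (Fin P) (Fin P) ℝ) (c : ℕ → ℝ)
    (σ : ℝ) (ps : ℕ) : Prop :=
  (∀ p : Fin P, ps ≤ (p : ℕ) → Tendsto (fun n => π n ((p : ℕ) + 1)) atTop
      (𝓝 ((1 - acceptFixed Q c σ p) * ∏ q ∈ Finset.Ioi p, acceptFixed Q c σ q))) ∧
    Tendsto (fun n => π n ps) atTop
      (𝓝 (∏ q ∈ Finset.univ.filter (fun q : Fin P => ps ≤ (q : ℕ)), acceptFixed Q c σ q)) ∧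
    ∀ p : ℕ, O ≤ p → p < ps → Tendsto (fun n => π n p) atTop (𝓝 0)

/-- The local alternative `θ + γ/√n`. -/
def localAlt {P : ℕ} (θ γ : Fin P → ℝ) (n : ℕ) : Fin P → ℝ :=
  θ + (√(n : ℝ))⁻¹ • γ

end

end PostModelSelection

open PostModelSelection

/-! With the error variance known, the event that order `p` is selected says that the test at `p`
rejects and that all tests at larger orders accept. The estimator `θ̃(p)` is uncorrelated with the
last coefficients of all larger models, and these are uncorrelated with each other. By joint
normality they are independent, so the probability that `p` is selected and `√n A (θ̃(p) - θ)` lies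
in `B` factorises (`measureReal_dev_accept`): one factor concerns the model of order `p` alone, the
others are acceptance probabilities.

For `p` at least the order of `θ`, the law of `√n (θ̃(p) - θ⁽ⁿ⁾)[p]` is normal with explicit mean
and covariance. Both converge, and the limit covariance is non-singular, so the densities converge
and Scheffé's lemma gives convergence in total variation (`tendsto_tvDist_dev`). The rejection
thresholds converge too, and the limit law does not charge the boundary of the rejection region
(`exists_tendsto_zero_of_tvDist_threshold`). All errors are uniform over measurable sets, hence
survive pulling back along `d ↦ A *ᵥ extendNeg γ p d`. No density on `ℝ^k` is needed, and `A[p]` may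
be rank deficient.

Orders below `p_*` disappear because the test at `p_*` rejects with probability tending to one:
either its critical value is zero or its noncentrality diverges (`tendsto_missProb`). The cdf of the
limit measure takes its stated form by regressing the last coordinate of the limiting normal vector
on its image under `A[p]`. The residual is independent of that image and has variance `σ²ζ²`,
whichever generalized inverse is used (`genInverse_regression`, `map_prod_regression`).

When the variance is estimated, `σ̂/σ` is close to one with a bound free of the parameters. The two
selectors then differ only if some idealized statistic falls near its critical value. This is
unlikely uniformly in the mean, since a unit-variance normal density is bounded
(`measureReal_pHat_ne_le`). The fixed-parameter case is `γ = 0`. -/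

namespace PostModelSelection

/-! ### Gaussian laws on `ι → ℝ` described by mean and covariance -/

/-- `μ` is the Gaussian law with mean `m` and covariance matrix `S`. -/
structure IsNormal {ι : Type*} [Fintype ι] (μ : Measure (ι → ℝ)) (m : ι → ℝ)
    (S : Matrix ι ι ℝ) : Prop where
  gaussian : IsGaussian μ
  mean : ∀ i, ∫ x, x i ∂μ = m i
  cov : ∀ i j, cov[fun x => x i, fun x => x j; μ] = S i j

namespace IsNormal

variable {ι κ : Type*} [Fintype ι] [Fintype κ] {μ ν : Measure (ι → ℝ)} {m : ι → ℝ}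
  {S : Matrix ι ι ℝ}

lemma isProbabilityMeasure (h : IsNormal μ m S) : IsProbabilityMeasure μ :=
  have := h.gaussian
  inferInstance

lemma memLp_eval (h : IsNormal μ m S) (i : ι) : MemLp (fun x => x i) 2 μ := by
  have := h.gaussian
  exact IsGaussian.memLp_dual μ (ContinuousLinearMap.proj (R := ℝ) (φ := fun _ : ι => ℝ) i) 2
    (by norm_num)

lemma integrable_eval (h : IsNormal μ m S) (i : ι) : Integrable (fun x => x i) μ :=
  have := h.isProbabilityMeasure
  (h.memLp_eval i).integrable (by norm_num)

lemma memLp_dotProduct (h : IsNormal μ m S) (a : ι → ℝ) : MemLp (fun x => a ⬝ᵥ x) 2 μ := by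
  simp only [dotProduct]
  exact memLp_finsetSum _ fun i _ => (h.memLp_eval i).const_mul (a i)

lemma mean_dotProduct (h : IsNormal μ m S) (a : ι → ℝ) : ∫ x, a ⬝ᵥ x ∂μ = a ⬝ᵥ m := by
  simp only [dotProduct]
  rw [integral_finsetSum _ fun i _ => (h.integrable_eval i).const_mul (a i)]
  simp [integral_const_mul, h.mean]

lemma cov_dotProduct (h : IsNormal μ m S) (a b : ι → ℝ) :
    cov[fun x => a ⬝ᵥ x, fun x => b ⬝ᵥ x; μ] = a ⬝ᵥ S *ᵥ b := by
  have := h.isProbabilityMeasure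
  simp only [dotProduct, mulVec]
  rw [covariance_fun_sum_fun_sum (fun i => (h.memLp_eval i).const_mul (a i))
    (fun i => (h.memLp_eval i).const_mul (b i))]
  simp only [covariance_const_mul_left, covariance_const_mul_right, h.cov, Finset.mul_sum]
  exact Finset.sum_congr rfl fun i _ => Finset.sum_congr rfl fun j _ => by ring

/-- The characteristic function of a Gaussian law at a functional depends only on the mean and
variance of that functional, and every functional here is a dot product with a fixed vector. -/
lemma ext (h : IsNormal μ m S) (h' : IsNormal ν m S) : μ = ν := by
  classical
  have := h.gaussian
  have := h'.gaussian
  apply Measure.ext_of_charFunDual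
  ext L
  have hL : (L : (ι → ℝ) → ℝ) = fun x => (fun i => L (Pi.single i 1)) ⬝ᵥ x := by
    funext x
    conv_lhs => rw [← Finset.univ_sum_single x]
    rw [map_sum, dotProduct]
    refine Finset.sum_congr rfl fun i _ => ?_
    rw [show (Pi.single i (x i) : ι → ℝ) = x i • Pi.single i 1 by
      rw [← Pi.single_smul]; simp, map_smul, smul_eq_mul, mul_comm]
  rw [IsGaussian.charFunDual_eq, IsGaussian.charFunDual_eq]
  rw [← covariance_self (by fun_prop), ← covariance_self (by fun_prop),
    integral_complex_ofReal, integral_complex_ofReal, hL, h.cov_dotProduct, h'.cov_dotProduct,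
    h.mean_dotProduct, h'.mean_dotProduct]

lemma map_affine (h : IsNormal μ m S) (M : Matrix κ ι ℝ) (a : κ → ℝ) :
    IsNormal (μ.map fun x => M *ᵥ x + a) (M *ᵥ m + a) (M * S * Mᵀ) := by
  have := h.gaussian
  have hm : Measurable fun x : ι → ℝ => M *ᵥ x + a := by fun_prop
  refine ⟨?_, fun i => ?_, fun i j => ?_⟩
  · have : (fun x : ι → ℝ => M *ᵥ x + a) =
        (fun y => y + a) ∘ (LinearMap.toContinuousLinearMap (Matrix.mulVecLin M)) := by
      ext; simp
    rw [this, ← Measure.map_map (by fun_prop) (by fun_prop)]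
    infer_instance
  · rw [integral_map hm.aemeasurable (measurable_pi_apply _).aestronglyMeasurable]
    have h1 := h.mean_dotProduct (M i)
    simp only [Pi.add_apply, mulVec]
    rw [integral_add (((h.memLp_dotProduct (M i)).integrable (by norm_num))) (integrable_const _),
      h1]
    simp
  · rw [covariance_map (measurable_pi_apply _).aestronglyMeasurable
      (measurable_pi_apply _).aestronglyMeasurable hm.aemeasurable]
    simp only [Function.comp_def, Pi.add_apply, mulVec]
    rw [covariance_add_const_left ((h.memLp_dotProduct (M i)).integrable (by norm_num)),
      covariance_add_const_right ((h.memLp_dotProduct (M j)).integrable (by norm_num)),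
      h.cov_dotProduct]
    simp only [dotProduct, mulVec, Matrix.mul_apply, transpose_apply, Finset.mul_sum,
      Finset.sum_mul]
    rw [Finset.sum_comm]
    exact Finset.sum_congr rfl fun i _ => Finset.sum_congr rfl fun j _ => by ring

lemma map_mulVec (h : IsNormal μ m S) (M : Matrix κ ι ℝ) :
    IsNormal (μ.map fun x => M *ᵥ x) (M *ᵥ m) (M * S * Mᵀ) := by
  simpa using h.map_affine M 0

lemma map_dotProduct (h : IsNormal μ m S) (a : ι → ℝ) :
    μ.map (fun x => a ⬝ᵥ x) = gaussianReal (a ⬝ᵥ m) (a ⬝ᵥ S *ᵥ a).toNNReal := by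
  have := h.gaussian
  let L : StrongDual ℝ (ι → ℝ) := LinearMap.toContinuousLinearMap
    { toFun := fun x => a ⬝ᵥ x
      map_add' := fun x y => dotProduct_add a x y
      map_smul' := fun c x => by simp }
  have hL : (L : (ι → ℝ) → ℝ) = fun x => a ⬝ᵥ x := rfl
  have h1 := IsGaussian.map_eq_gaussianReal (μ := μ) L
  rw [← covariance_self (by fun_prop), hL, h.cov_dotProduct, h.mean_dotProduct] at h1
  exact h1

lemma pi_gaussianReal [DecidableEq ι] (v : NNReal) :
    IsNormal (Measure.pi fun _ : ι => gaussianReal 0 v) 0 ((v : ℝ) • (1 : Matrix ι ι ℝ)) := by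
  have hmap : ∀ i : ι, (Measure.pi fun _ : ι => gaussianReal 0 v).map (fun x => x i) =
      gaussianReal 0 v := fun i => by
    simpa using Measure.pi_map_eval (μ := fun _ : ι => gaussianReal 0 v) i
  have hind : iIndepFun (fun (i : ι) (x : ι → ℝ) => x i)
      (Measure.pi fun _ : ι => gaussianReal 0 v) :=
    iIndepFun_pi (X := fun _ x => x) fun _ => aemeasurable_id
  have hg : ∀ i : ι, HasGaussianLaw (fun x : ι → ℝ => x i)
      (Measure.pi fun _ : ι => gaussianReal 0 v) := fun i => ⟨by rw [hmap]; infer_instance⟩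
  refine ⟨?_, fun i => ?_, fun i j => ?_⟩
  · have := (hind.hasGaussianLaw hg).isGaussian_map
    simpa using this
  · have := integral_map (μ := Measure.pi fun _ : ι => gaussianReal 0 v)
      (φ := fun x : ι → ℝ => x i) (f := fun y : ℝ => y)
      (measurable_pi_apply _).aemeasurable (by fun_prop)
    rw [← this, hmap, integral_id_gaussianReal]; rfl
  · by_cases hij : i = j
    · subst hij
      rw [covariance_self (measurable_pi_apply _).aemeasurable]
      have := variance_map (μ := Measure.pi fun _ : ι => gaussianReal 0 v)
        (Y := fun x : ι → ℝ => x i) (X := fun y : ℝ => y) (by fun_prop)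
        (measurable_pi_apply _).aemeasurable
      rw [hmap, variance_fun_id_gaussianReal] at this
      simpa [Function.comp_def] using this.symm
    · rw [(hind.indepFun hij).covariance_eq_zero (hg i).memLp_two (hg j).memLp_two]
      simp [hij]

/-- Semidefiniteness suffices, which matters for `Phi`: its covariance is singular when `A[p]` lacks
full row rank. -/
lemma multivariateGaussian_map [DecidableEq ι] (hS : S.PosSemidef) :
    IsNormal ((multivariateGaussian (WithLp.toLp 2 m) S).map WithLp.ofLp) m S := by
  refine ⟨?_, fun i => ?_, fun i j => ?_⟩
  · have := isGaussian_map_equiv (μ := multivariateGaussian (WithLp.toLp 2 m) S)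
      (PiLp.continuousLinearEquiv 2 ℝ fun _ : ι => ℝ)
    exact this
  · rw [integral_map (f := fun x : ι → ℝ => x i) (by fun_prop)
      (measurable_pi_apply _).aestronglyMeasurable]
    have := (measurePreserving_eval_multivariateGaussian (μ := WithLp.toLp 2 m) hS (i := i))
    have h1 := integral_map (μ := multivariateGaussian (WithLp.toLp 2 m) S)
      (φ := fun x : EuclideanSpace ℝ ι => x i) (f := fun y : ℝ => y) (by fun_prop) (by fun_prop)
    rw [this.map_eq, integral_id_gaussianReal] at h1
    exact h1.symm
  · rw [covariance_map (measurable_pi_apply _).aestronglyMeasurable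
      (measurable_pi_apply _).aestronglyMeasurable (by fun_prop)]
    exact covariance_eval_multivariateGaussian hS i j

end IsNormal

end PostModelSelection

namespace PostModelSelection

/-! ### Total variation distance -/

section TotalVariation

variable {α β : Type*} [MeasurableSpace α] [MeasurableSpace β]

/-- Finiteness of the measures bounds the family, so the real supremum defining `tvDist` is a
genuine one rather than the default value. -/
lemma abs_sub_le_tvDist (μ ν : Measure α) [IsFiniteMeasure μ] [IsFiniteMeasure ν] {s : Set α}
    (hs : MeasurableSet s) : |μ.real s - ν.real s| ≤ tvDist μ ν := by
  refine le_ciSup (f := fun s : {s : Set α // MeasurableSet s} => |μ.real s - ν.real s|)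
    ⟨μ.real Set.univ + ν.real Set.univ, ?_⟩ ⟨s, hs⟩
  rintro _ ⟨t, rfl⟩
  have h1 : μ.real t ≤ μ.real Set.univ := measureReal_mono (Set.subset_univ _)
  have h2 : ν.real t ≤ ν.real Set.univ := measureReal_mono (Set.subset_univ _)
  have h3 : 0 ≤ μ.real t := measureReal_nonneg
  have h4 : 0 ≤ ν.real t := measureReal_nonneg
  exact abs_le.2 ⟨by linarith, by linarith⟩

lemma tvDist_le {μ ν : Measure α} {ε : ℝ}
    (h : ∀ s, MeasurableSet s → |μ.real s - ν.real s| ≤ ε) : tvDist μ ν ≤ ε :=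
  haveI : Nonempty {s : Set α // MeasurableSet s} := ⟨⟨∅, MeasurableSet.empty⟩⟩
  ciSup_le fun s => h s s.2

lemma tvDist_nonneg (μ ν : Measure α) : 0 ≤ tvDist μ ν :=
  Real.iSup_nonneg fun _ => abs_nonneg _

/-- Scheffé's lemma. -/
lemma tendsto_tvDist_withDensity (ρ : Measure α) {f : ℕ → α → ℝ} {g : α → ℝ}
    (hf : ∀ n, Measurable (f n)) (hg : Measurable g) (hfg : ∀ x, Tendsto (fun n => f n x) atTop (𝓝 (g x)))
    {μ : ℕ → Measure α} {ν : Measure α}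
    (hμ : ∀ᶠ n in atTop, IsProbabilityMeasure (μ n) ∧
      μ n = ρ.withDensity fun x => ENNReal.ofReal (f n x))
    [IsProbabilityMeasure ν] (hν : ν = ρ.withDensity fun x => ENNReal.ofReal (g x)) :
    Tendsto (fun n => tvDist (μ n) ν) atTop (𝓝 0) := by
  have hgint : ∫⁻ x, ENNReal.ofReal (g x) ∂ρ = 1 := by
    have := measure_univ (μ := ν)
    rwa [hν, withDensity_apply _ MeasurableSet.univ, Measure.restrict_univ] at this
  -- The truncated difference `(g - f n)⁺` is dominated by `g`, so dominated convergence applies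
  -- although the `f n` have no common integrable bound.
  have hd : Tendsto (fun n => ∫⁻ x, (ENNReal.ofReal (g x) - ENNReal.ofReal (f n x)) ∂ρ) atTop
      (𝓝 (∫⁻ _, 0 ∂ρ)) := by
    refine tendsto_lintegral_of_dominated_convergence (fun x => ENNReal.ofReal (g x))
      (fun n => hg.ennreal_ofReal.sub (hf n).ennreal_ofReal)
      (fun n => Eventually.of_forall fun x => tsub_le_self) (by simp [hgint])
      (Eventually.of_forall fun x => ?_)
    have h1 := (ENNReal.continuous_ofReal.tendsto _).comp (hfg x)
    have h2 := ENNReal.Tendsto.sub (a := ENNReal.ofReal (g x)) tendsto_const_nhds h1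
      (Or.inl ENNReal.ofReal_ne_top)
    simpa using h2
  rw [lintegral_zero] at hd
  have hd' := (ENNReal.tendsto_toReal ENNReal.zero_ne_top).comp hd
  refine squeeze_zero' (Eventually.of_forall fun n => tvDist_nonneg _ _) ?_ hd'
  filter_upwards [hμ] with n ⟨hn, hμn⟩
  set e := ∫⁻ x, (ENNReal.ofReal (g x) - ENNReal.ofReal (f n x)) ∂ρ with he
  have hfin : e ≠ ⊤ := by
    refine ne_top_of_le_ne_top ENNReal.one_ne_top (hgint ▸ ?_)
    exact lintegral_mono fun x => tsub_le_self
  have key : ∀ s, MeasurableSet s → ν.real s ≤ (μ n).real s + e.toReal := by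
    intro s hs
    have : ν s ≤ μ n s + e := by
      rw [hν, hμn, withDensity_apply _ hs, withDensity_apply _ hs]
      calc ∫⁻ x in s, ENNReal.ofReal (g x) ∂ρ
          ≤ ∫⁻ x in s, (ENNReal.ofReal (f n x) +
            (ENNReal.ofReal (g x) - ENNReal.ofReal (f n x))) ∂ρ :=
            lintegral_mono fun x => le_add_tsub
        _ = _ + _ := lintegral_add_left (hf n).ennreal_ofReal _
        _ ≤ _ := by gcongr; exact setLIntegral_le_lintegral _ _
    rw [measureReal_def, measureReal_def, ← ENNReal.toReal_add (measure_ne_top _ _) hfin]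
    exact ENNReal.toReal_mono (ENNReal.add_ne_top.2 ⟨measure_ne_top _ _, hfin⟩) this
  refine tvDist_le fun s hs => abs_le.2 ⟨?_, ?_⟩
  · have := key s hs
    simp only [Function.comp]
    linarith
  -- Both measures have mass one, so the one-sided bound on complements gives the reverse
  -- inequality.
  · have := key sᶜ hs.compl
    rw [probReal_compl_eq_one_sub hs, probReal_compl_eq_one_sub hs] at this
    simp only [Function.comp]
    linarith

/-- Convergence in total variation and a converging threshold: the error is uniform in `s`. -/
lemma exists_tendsto_zero_of_tvDist_threshold {μ : ℕ → Measure α} {ν : Measure α}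
    (hμ : ∀ᶠ n in atTop, IsProbabilityMeasure (μ n)) [IsProbabilityMeasure ν]
    (h : Tendsto (fun n => tvDist (μ n) ν) atTop (𝓝 0)) {f : α → ℝ} (hf : Measurable f)
    {τ : ℕ → ℝ} {t : ℝ} (hτ : Tendsto τ atTop (𝓝 t)) (hν : ν {x | f x = t} = 0) :
    ∃ ε : ℕ → ℝ, Tendsto ε atTop (𝓝 0) ∧ ∀ᶠ n in atTop, ∀ s, MeasurableSet s →
      |(μ n).real (s ∩ {x | τ n ≤ f x}) - ν.real (s ∩ {x | t ≤ f x})| ≤ ε n := by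
  -- The two threshold events differ only where `f` lies between `τ n` and `t`. The sets measured by
  -- `r` contain that difference and shrink to the null set `{f = t}`.
  set r : ℕ → ℝ := fun n => ν.real {x | |f x - t| ≤ |τ n - t|} with hr
  have hmeas : ∀ a : ℝ, MeasurableSet {x | |f x - t| ≤ a} := fun a =>
    measurableSet_le (hf.sub_const t).abs measurable_const
  have hr0 : Tendsto r atTop (𝓝 0) := by
    have h1 : Tendsto (fun n => ν {x | |f x - t| ≤ |τ n - t|}) atTop
        (𝓝 (ν {x | f x = t})) := by
      refine tendsto_measure_of_tendsto_indicator_of_isFiniteMeasure atTop ν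
        (fun n => hmeas _) (fun x => ?_)
      by_cases hx : f x = t
      · simp [hx]
      · have h2 : Tendsto (fun n => |τ n - t|) atTop (𝓝 0) := by
          have := (hτ.sub_const t).abs
          simpa using this
        have h3 : 0 < |f x - t| := abs_pos.2 (sub_ne_zero.2 hx)
        filter_upwards [h2.eventually (gt_mem_nhds h3)] with n hn
        simp [hx, hn]
    rw [hν] at h1
    exact (ENNReal.tendsto_toReal ENNReal.zero_ne_top).comp h1
  refine ⟨fun n => tvDist (μ n) ν + r n, by simpa using h.add hr0, ?_⟩
  filter_upwards [hμ] with n hn s hs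
  have hA : MeasurableSet (s ∩ {x | τ n ≤ f x}) := hs.inter (measurableSet_le measurable_const hf)
  have hB : MeasurableSet (s ∩ {x | t ≤ f x}) := hs.inter (measurableSet_le measurable_const hf)
  have h1 := abs_sub_le_tvDist (μ n) ν hA
  have h2 : |ν.real (s ∩ {x | τ n ≤ f x}) - ν.real (s ∩ {x | t ≤ f x})| ≤ r n := by
    have hsub1 : s ∩ {x | τ n ≤ f x} ⊆ (s ∩ {x | t ≤ f x}) ∪ {x | |f x - t| ≤ |τ n - t|} := by
      rintro x ⟨hx, hx'⟩
      by_cases htx : t ≤ f x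
      · exact Or.inl ⟨hx, htx⟩
      · right
        simp only [Set.mem_ofPred_eq, not_le] at hx' htx ⊢
        rw [abs_of_neg (by linarith), abs_of_neg (by linarith)]
        linarith
    have hsub2 : s ∩ {x | t ≤ f x} ⊆ (s ∩ {x | τ n ≤ f x}) ∪ {x | |f x - t| ≤ |τ n - t|} := by
      rintro x ⟨hx, hx'⟩
      by_cases htx : τ n ≤ f x
      · exact Or.inl ⟨hx, htx⟩
      · right
        simp only [Set.mem_ofPred_eq, not_le] at hx' htx ⊢
        rw [abs_of_nonneg (by linarith), abs_of_nonneg (by linarith)]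
        linarith
    have e1 := (measureReal_mono (μ := ν) hsub1).trans (measureReal_union_le _ _)
    have e2 := (measureReal_mono (μ := ν) hsub2).trans (measureReal_union_le _ _)
    exact abs_le.2 ⟨by linarith, by linarith⟩
  calc _ ≤ _ + _ := abs_sub_le _ (ν.real (s ∩ {x | τ n ≤ f x})) _
    _ ≤ _ := add_le_add h1 h2

/-- The `ν`-mass of the sets vanishes by dominated convergence of indicators, and total variation
carries this over to `μ n` even though the sets move with `n`. -/
lemma tendsto_measureReal_zero_of_tvDist {μ : ℕ → Measure α} {ν : Measure α}
    (hμ : ∀ᶠ n in atTop, IsProbabilityMeasure (μ n)) [IsProbabilityMeasure ν]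
    (h : Tendsto (fun n => tvDist (μ n) ν) atTop (𝓝 0)) {s : ℕ → Set α}
    (hs : ∀ n, MeasurableSet (s n)) (hlim : ∀ x, ∀ᶠ n in atTop, x ∉ s n) :
    Tendsto (fun n => (μ n).real (s n)) atTop (𝓝 0) := by
  have h1 : Tendsto (fun n => ν (s n)) atTop (𝓝 (ν ∅)) :=
    tendsto_measure_of_tendsto_indicator_of_isFiniteMeasure atTop ν hs
      fun x => (hlim x).mono fun n hn => by simp [hn]
  rw [measure_empty] at h1
  have h2 : Tendsto (fun n => ν.real (s n)) atTop (𝓝 0) := by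
    exact (ENNReal.tendsto_toReal ENNReal.zero_ne_top).comp h1
  refine squeeze_zero' (Eventually.of_forall fun n => measureReal_nonneg) ?_
    (by simpa using h.add h2)
  filter_upwards [hμ] with n hn
  have := (abs_le.1 (abs_sub_le_tvDist (μ n) ν (hs n))).2
  linarith

end TotalVariation

/-! ### Densities of Gaussian laws -/

section Density

variable {ι : Type*} [Fintype ι]

lemma pi_gaussianReal_eq_withDensity :
    (Measure.pi fun _ : ι => gaussianReal 0 1) =
      volume.withDensity fun x : ι → ℝ => ENNReal.ofReal (∏ i, gaussianPDFReal 0 1 (x i)) := by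
  refine Measure.pi_eq fun s hs => ?_
  rw [withDensity_apply _ (MeasurableSet.univ_pi hs), volume_pi, Measure.restrict_pi_pi]
  have hint : ∀ i, Integrable (gaussianPDFReal 0 1) ((volume : Measure ℝ).restrict (s i)) :=
    fun i => (integrable_gaussianPDFReal 0 1).restrict
  rw [← ofReal_integral_eq_lintegral_ofReal (Integrable.fintype_prod hint)
    (Eventually.of_forall fun x => Finset.prod_nonneg fun i _ => gaussianPDFReal_nonneg _ _ _),
    integral_fintype_prod_eq_prod (f := fun (_ : ι) (y : ℝ) => gaussianPDFReal 0 1 y),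
    ENNReal.ofReal_prod_of_nonneg
      (fun i _ => integral_nonneg fun y => gaussianPDFReal_nonneg _ _ _)]
  exact Finset.prod_congr rfl fun i _ => (gaussianReal_apply_eq_integral 0 one_ne_zero (s i)).symm

variable [DecidableEq ι]

lemma map_affine_withDensity {f : (ι → ℝ) → ENNReal} (hf : Measurable f) {M : Matrix ι ι ℝ}
    (hM : M.det ≠ 0) (a : ι → ℝ) :
    ((volume.withDensity f).map fun x => M *ᵥ x + a) =
      volume.withDensity fun y => ENNReal.ofReal |M.det⁻¹| * f (M⁻¹ *ᵥ (y - a)) := by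
  ext s hs
  have hm : Measurable fun x : ι → ℝ => M *ᵥ x + a := by fun_prop
  have hg : Measurable fun y : ι → ℝ => f (M⁻¹ *ᵥ (y - a)) := hf.comp (by fun_prop)
  rw [Measure.map_apply hm hs, withDensity_apply _ (hm hs), withDensity_apply _ hs,
    lintegral_const_mul _ hg]
  set g : (ι → ℝ) → ENNReal := s.indicator fun y => f (M⁻¹ *ᵥ (y - a)) with hgdef
  have hgm : Measurable g := hg.indicator hs
  have h1 : ∀ x, ((fun x : ι → ℝ => M *ᵥ x + a) ⁻¹' s).indicator f x =
      (fun y => g (y + a)) (toLin' M x) := by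
    intro x
    simp only [Set.indicator, hgdef, toLin'_apply, add_sub_cancel_right,
      mulVec_mulVec, Matrix.nonsing_inv_mul _ (isUnit_iff_ne_zero.2 hM), one_mulVec]
    rfl
  rw [← lintegral_indicator (hm hs), ← lintegral_indicator hs, lintegral_congr h1,
    ← lintegral_map (f := fun y => g (y + a)) (g := toLin' M)
      (hgm.comp (measurable_add_const a)) (LinearMap.continuous_on_pi _).measurable,
    Real.map_matrix_volume_pi_eq_smul_volume_pi hM, lintegral_smul_measure,
    lintegral_add_right_eq_self g a, smul_eq_mul]

/-- The density of the Gaussian law with mean `m` and covariance matrix `S`. -/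
noncomputable def normalDensity (m : ι → ℝ) (S : Matrix ι ι ℝ) (y : ι → ℝ) : ℝ :=
  (√(2 * Real.pi))⁻¹ ^ Fintype.card ι * (√S.det)⁻¹ *
    Real.exp (-((y - m) ⬝ᵥ S⁻¹ *ᵥ (y - m)) / 2)

lemma measurable_normalDensity (m : ι → ℝ) (S : Matrix ι ι ℝ) :
    Measurable (normalDensity m S) := by
  unfold normalDensity
  refine Measurable.const_mul (Real.measurable_exp.comp (Measurable.div_const ?_ 2)) _
  refine Continuous.measurable ?_
  fun_prop

-- Factor `S = B Bᵀ`. By uniqueness the law is the image of the standard normal law under `x ↦ B x +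
-- m`, and the density follows by change of variables.
open scoped MatrixOrder in
lemma IsNormal.eq_withDensity {μ : Measure (ι → ℝ)} {m : ι → ℝ} {S : Matrix ι ι ℝ}
    (h : IsNormal μ m S) (hS : S.PosDef) :
    μ = volume.withDensity fun y => ENNReal.ofReal (normalDensity m S y) := by
  obtain ⟨B, hB⟩ : ∃ B : Matrix ι ι ℝ, S = B * Bᵀ := by
    obtain ⟨B, hB⟩ := (CStarAlgebra.nonneg_iff_eq_mul_star_self (a := S)).1 hS.posSemidef.nonneg
    exact ⟨B, by rw [hB, star_eq_conjTranspose, conjTranspose_eq_transpose_of_trivial]⟩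
  have hdet : S.det = B.det ^ 2 := by rw [hB, det_mul, det_transpose, sq]
  have hBdet : B.det ≠ 0 := fun h0 => by
    have := hS.det_pos
    rw [hdet, h0] at this
    simp at this
  have hpi := (IsNormal.pi_gaussianReal (ι := ι) 1).map_affine B m
  rw [mulVec_zero, zero_add] at hpi
  rw [NNReal.coe_one, one_smul, Matrix.mul_one, ← hB] at hpi
  rw [h.ext hpi, pi_gaussianReal_eq_withDensity, map_affine_withDensity ?_ hBdet]
  · congr 1
    funext y
    rw [← ENNReal.ofReal_mul (abs_nonneg _)]
    congr 1
    have hq : (y - m) ⬝ᵥ S⁻¹ *ᵥ (y - m) = (B⁻¹ *ᵥ (y - m)) ⬝ᵥ (B⁻¹ *ᵥ (y - m)) := by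
      rw [hB, Matrix.mul_inv_rev, ← mulVec_mulVec, ← transpose_nonsing_inv, dotProduct_mulVec,
        vecMul_transpose]
    rw [normalDensity, hq, hdet, Real.sqrt_sq_eq_abs, abs_inv]
    simp only [gaussianPDFReal, NNReal.coe_one, mul_one, sub_zero, Finset.prod_mul_distrib,
      Finset.prod_const, Finset.card_univ, ← Real.exp_sum]
    rw [show ∑ i, -(B⁻¹ *ᵥ (y - m)) i ^ 2 / 2 =
      -((B⁻¹ *ᵥ (y - m)) ⬝ᵥ (B⁻¹ *ᵥ (y - m))) / 2 by
        rw [← Finset.sum_div, Finset.sum_neg_distrib]; simp [dotProduct, sq]]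
    ring
  · exact (Finset.measurable_prod _ fun i _ =>
      (measurable_gaussianPDFReal 0 1).comp (measurable_pi_apply i)).ennreal_ofReal

lemma tendsto_matrix_inv {S : ℕ → Matrix ι ι ℝ} {T : Matrix ι ι ℝ}
    (h : Tendsto S atTop (𝓝 T)) (hT : T.det ≠ 0) :
    Tendsto (fun n => (S n)⁻¹) atTop (𝓝 T⁻¹) := by
  refine (continuousAt_matrix_inv T ?_).tendsto.comp h
  rw [Ring.inverse_eq_inv']
  exact continuousAt_inv₀ hT

/-- Determinant and inverse are continuous at the positive definite limit, so the densities converge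
pointwise and Scheffé's lemma applies. The non-singularity required here is why convergence is
proved for coefficient vectors before `A` is applied. -/
lemma IsNormal.tendsto_tvDist {μ : ℕ → Measure (ι → ℝ)} {m : ℕ → ι → ℝ} {S : ℕ → Matrix ι ι ℝ}
    {ν : Measure (ι → ℝ)} {m' : ι → ℝ} {T : Matrix ι ι ℝ}
    (hμ : ∀ᶠ n in atTop, IsNormal (μ n) (m n) (S n) ∧ (S n).PosDef) (hν : IsNormal ν m' T)
    (hT : T.PosDef) (hm : Tendsto m atTop (𝓝 m')) (hS : Tendsto S atTop (𝓝 T)) :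
    Tendsto (fun n => tvDist (μ n) ν) atTop (𝓝 0) := by
  have := hν.isProbabilityMeasure
  refine tendsto_tvDist_withDensity volume (fun n => measurable_normalDensity (m n) (S n))
    (measurable_normalDensity m' T) (fun y => ?_)
    (hμ.mono fun n hn => ⟨hn.1.isProbabilityMeasure, hn.1.eq_withDensity hn.2⟩)
    (hν.eq_withDensity hT)
  have hdet : Tendsto (fun n => (S n).det) atTop (𝓝 T.det) :=
    ((continuous_id.matrix_det).tendsto T).comp hS
  have hinv := tendsto_matrix_inv hS hT.det_pos.ne'
  have hy : Tendsto (fun n => y - m n) atTop (𝓝 (y - m')) := tendsto_const_nhds.sub hm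
  have hc : Continuous fun p : (ι → ℝ) × Matrix ι ι ℝ => p.1 ⬝ᵥ p.2 *ᵥ p.1 := by fun_prop
  have hq := (hc.tendsto (y - m', T⁻¹)).comp (hy.prodMk_nhds hinv)
  have hs : Tendsto (fun n => (√(S n).det)⁻¹) atTop (𝓝 (√T.det)⁻¹) :=
    ((Real.continuous_sqrt.tendsto _).comp hdet).inv₀ (Real.sqrt_pos.2 hT.det_pos).ne'
  unfold normalDensity
  exact (hs.const_mul _).mul ((Real.continuous_exp.tendsto _).comp ((hq.neg).div_const 2))

end Density

end PostModelSelection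

namespace PostModelSelection

/-! ### Restricted least squares for a fixed design -/

section Block

variable {P : ℕ}

lemma blockFF_posDef {S : Matrix (Fin P) (Fin P) ℝ} (hS : S.PosDef) (p : ℕ) :
    (blockFF S p).PosDef :=
  hS.submatrix Subtype.val_injective

lemma xi_pos {S : Matrix (Fin P) (Fin P) ℝ} (hS : S.PosDef) (j : Fin P) : 0 < xi S j :=
  Real.sqrt_pos.2 (blockFF_posDef hS _).inv.diag_pos

lemma xi_sq {S : Matrix (Fin P) (Fin P) ℝ} (hS : S.PosDef) (j : Fin P) :
    xi S j ^ 2 = (blockFF S ((j : ℕ) + 1))⁻¹ (lastIdx j) (lastIdx j) :=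
  Real.sq_sqrt (blockFF_posDef hS _).inv.diag_pos.le

lemma continuous_blockFF (p : ℕ) :
    Continuous fun S : Matrix (Fin P) (Fin P) ℝ => blockFF S p :=
  continuous_id.matrix_submatrix _ _

lemma continuous_blockFL (p : ℕ) :
    Continuous fun S : Matrix (Fin P) (Fin P) ℝ => blockFL S p :=
  continuous_id.matrix_submatrix _ _

lemma tendsto_blockFF_inv {S : ℕ → Matrix (Fin P) (Fin P) ℝ} {Q : Matrix (Fin P) (Fin P) ℝ}
    (h : Tendsto S atTop (𝓝 Q)) (hQ : Q.PosDef) (p : ℕ) :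
    Tendsto (fun n => (blockFF (S n) p)⁻¹) atTop (𝓝 (blockFF Q p)⁻¹) :=
  tendsto_matrix_inv (((continuous_blockFF p).tendsto Q).comp h) (blockFF_posDef hQ p).det_pos.ne'

lemma tendsto_xi {S : ℕ → Matrix (Fin P) (Fin P) ℝ} {Q : Matrix (Fin P) (Fin P) ℝ}
    (h : Tendsto S atTop (𝓝 Q)) (hQ : Q.PosDef) (j : Fin P) :
    Tendsto (fun n => xi (S n) j) atTop (𝓝 (xi Q j)) :=
  (Real.continuous_sqrt.tendsto _).comp (((continuous_apply_apply (lastIdx j) (lastIdx j)).tendsto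
    _).comp (tendsto_blockFF_inv h hQ ((j : ℕ) + 1)))

lemma tendsto_delta {S : ℕ → Matrix (Fin P) (Fin P) ℝ} {Q : Matrix (Fin P) (Fin P) ℝ}
    (h : Tendsto S atTop (𝓝 Q)) (hQ : Q.PosDef) (ψ : Fin P → ℝ) (p : ℕ) :
    Tendsto (fun n => delta (S n) ψ p) atTop (𝓝 (delta Q ψ p)) := by
  refine tendsto_pi_nhds.2 fun i => ?_
  unfold delta
  split_ifs with hi
  · have hc : Continuous fun M : Matrix {j : Fin P // (j : ℕ) < p} {j : Fin P // (j : ℕ) < p} ℝ ×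
        Matrix {j : Fin P // (j : ℕ) < p} {j : Fin P // p ≤ (j : ℕ)} ℝ =>
        (M.1 *ᵥ (M.2 *ᵥ lastEntries ψ p)) ⟨i, hi⟩ := by fun_prop
    exact (hc.tendsto _).comp ((tendsto_blockFF_inv h hQ p).prodMk_nhds
      (((continuous_blockFL p).tendsto Q).comp h))
  · exact tendsto_const_nhds

/-- Only the components of `ψ` of index larger than `p` matter for `δ^{(p)}`. -/
lemma delta_congr (S : Matrix (Fin P) (Fin P) ℝ) {ψ φ : Fin P → ℝ} {p : ℕ}
    (h : ∀ i : Fin P, p ≤ (i : ℕ) → ψ i = φ i) : delta S ψ p = delta S φ p := by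
  funext i
  unfold delta
  have h1 : lastEntries ψ p = lastEntries φ p := funext fun j => h j j.2
  split_ifs with hi
  · rw [h1]
  · rw [h i (not_lt.1 hi)]

lemma sum_eq_sum_lt_add_sum_le (p : ℕ) (f : Fin P → ℝ) :
    ∑ j, f j = ∑ j : {j : Fin P // (j : ℕ) < p}, f j + ∑ j : {j : Fin P // p ≤ (j : ℕ)}, f j := by
  rw [← Fintype.sum_subtype_add_sum_subtype (fun j : Fin P => (j : ℕ) < p) f]
  congr 1
  exact Fintype.sum_equiv (Equiv.subtypeEquivRight fun j => not_lt) _ _ fun _ => rfl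

end Block

/-! ### Bias, covariance and independence of the nested least-squares estimators. -/

section Design

variable {n P : ℕ}

/-- `X'X / n`. -/
noncomputable def gram (X : Matrix (Fin n) (Fin P) ℝ) : Matrix (Fin P) (Fin P) ℝ :=
  (n : ℝ)⁻¹ • (Xᵀ * X)

lemma gram_posDef {X : Matrix (Fin n) (Fin P) ℝ} (hX : X.rank = P) (hn : 0 < n) :
    (gram X).PosDef := by
  have hinj : Function.Injective X.mulVec := by
    rw [mulVec_injective_iff, linearIndependent_iff_card_eq_finrank_span, Set.finrank,
      ← rank_eq_finrank_span_cols, hX, Fintype.card_fin]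
  have h1 : (Xᴴ * X).PosDef := PosDef.conjTranspose_mul_self X hinj
  rw [conjTranspose_eq_transpose_of_trivial] at h1
  exact h1.smul (by positivity)

/-- The matrix of the map `Y ↦ θ̃(p)[p]`. -/
noncomputable def lsMat (X : Matrix (Fin n) (Fin P) ℝ) (p : ℕ) :
    Matrix {j : Fin P // (j : ℕ) < p} (Fin n) ℝ :=
  ((firstCols X p)ᵀ * firstCols X p)⁻¹ * (firstCols X p)ᵀ

lemma restrictedLS_apply (X : Matrix (Fin n) (Fin P) ℝ) (p : ℕ) (Y : Fin n → ℝ) (i : Fin P) :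
    restrictedLS X p Y i = if h : (i : ℕ) < p then (lsMat X p *ᵥ Y) ⟨i, h⟩ else 0 := by
  simp only [restrictedLS, lsMat, mulVec_mulVec]

lemma gram_firstCols (X : Matrix (Fin n) (Fin P) ℝ) (hn : 0 < n) (p : ℕ) :
    (firstCols X p)ᵀ * firstCols X p = (n : ℝ) • blockFF (gram X) p := by
  have hn' : (n : ℝ) ≠ 0 := by positivity
  ext i j
  simp [firstCols, blockFF, gram, Matrix.mul_apply, hn']

lemma gram_firstCols_inv {X : Matrix (Fin n) (Fin P) ℝ} (hS : (gram X).PosDef) (hn : 0 < n)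
    (p : ℕ) : ((firstCols X p)ᵀ * firstCols X p)⁻¹ = (n : ℝ)⁻¹ • (blockFF (gram X) p)⁻¹ := by
  have hn' : (n : ℝ) ≠ 0 := by positivity
  have hu := (blockFF_posDef hS p).isUnit
  rw [gram_firstCols X hn]
  refine Matrix.inv_eq_right_inv ?_
  rw [smul_mul_smul_comm, mul_inv_cancel₀ hn', one_smul,
    Matrix.mul_nonsing_inv _ ((isUnit_iff_isUnit_det _).1 hu)]

/-- Up to the factor `σ²` this is the covariance matrix of `θ̃(p)[p]`; one inverse Gram factor
cancels against the Gram matrix in the middle. -/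
lemma lsMat_mul_transpose {X : Matrix (Fin n) (Fin P) ℝ} (hS : (gram X).PosDef) (hn : 0 < n)
    (p : ℕ) : lsMat X p * (lsMat X p)ᵀ = (n : ℝ)⁻¹ • (blockFF (gram X) p)⁻¹ := by
  have hn' : (n : ℝ) ≠ 0 := by positivity
  have hu := (isUnit_iff_isUnit_det _).1 (blockFF_posDef hS p).isUnit
  rw [lsMat, transpose_mul, transpose_transpose, transpose_nonsing_inv, transpose_mul,
    transpose_transpose, Matrix.mul_assoc, ← Matrix.mul_assoc (firstCols X p)ᵀ,
    gram_firstCols_inv hS hn, gram_firstCols X hn]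
  simp only [Matrix.smul_mul, Matrix.mul_smul, smul_smul]
  rw [Matrix.mul_nonsing_inv _ hu, Matrix.mul_one, inv_mul_cancel₀ hn', one_mul]

/-- The coefficients of the larger models are uncorrelated with the smaller ones. -/
lemma lsMat_mul_transpose_lastIdx {X : Matrix (Fin n) (Fin P) ℝ} (hS : (gram X).PosDef)
    (hn : 0 < n) {p : ℕ} {q : Fin P} (hpq : p ≤ (q : ℕ)) (i : {j : Fin P // (j : ℕ) < p}) :
    (lsMat X p * (lsMat X ((q : ℕ) + 1))ᵀ) i (lastIdx q) = 0 := by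
  have hn' : (n : ℝ) ≠ 0 := by positivity
  have hu : IsUnit ((firstCols X ((q : ℕ) + 1))ᵀ * firstCols X ((q : ℕ) + 1)).det := by
    rw [gram_firstCols X hn]
    exact (isUnit_iff_isUnit_det _).1
      (((blockFF_posDef hS ((q : ℕ) + 1)).smul (by positivity : (0 : ℝ) < n)).isUnit)
  -- The columns of `X[p]` are among those of the larger model, so this product selects rows of an
  -- identity matrix. The selected indices are below `p ≤ q`, so none is `lastIdx q`.
  have hcol : (firstCols X p)ᵀ * (lsMat X ((q : ℕ) + 1))ᵀ =
      (1 : Matrix {j : Fin P // (j : ℕ) < (q : ℕ) + 1} {j : Fin P // (j : ℕ) < (q : ℕ) + 1}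
        ℝ).submatrix (fun j : {j : Fin P // (j : ℕ) < p} => ⟨j, by have := j.2; omega⟩) id := by
    rw [← Matrix.mul_nonsing_inv _ hu, lsMat, transpose_mul, transpose_transpose,
      transpose_nonsing_inv, transpose_mul, transpose_transpose, ← Matrix.mul_assoc]
    rfl
  rw [lsMat, Matrix.mul_assoc, hcol, Matrix.mul_apply]
  refine Finset.sum_eq_zero fun j _ => ?_
  rw [submatrix_apply, one_apply_ne, mul_zero]
  intro h
  have h1 := j.2
  have h2 := congrArg (fun a : {j : Fin P // (j : ℕ) < (q : ℕ) + 1} => ((a : Fin P) : ℕ)) h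
  simp only [lastIdx, id] at h2
  omega

/-- Omitted-variable bias: splitting `X θ` into included and omitted regressors, the first part is
reproduced exactly and the second is regressed on `X[p]`. -/
lemma lsMat_mulVec_mulVec {X : Matrix (Fin n) (Fin P) ℝ} (hS : (gram X).PosDef) (hn : 0 < n)
    (θ : Fin P → ℝ) (p : ℕ) (i : {j : Fin P // (j : ℕ) < p}) :
    (lsMat X p *ᵥ (X *ᵥ θ)) i = θ i + delta (gram X) θ p i := by
  have hn' : (n : ℝ) ≠ 0 := by positivity
  have hu := (isUnit_iff_isUnit_det _).1 (blockFF_posDef hS p).isUnit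
  have h1 : (firstCols X p)ᵀ *ᵥ (X *ᵥ θ) = (n : ℝ) •
      (blockFF (gram X) p *ᵥ (fun j => θ j) + blockFL (gram X) p *ᵥ lastEntries θ p) := by
    funext j
    rw [mulVec_mulVec, mulVec, dotProduct, sum_eq_sum_lt_add_sum_le p]
    simp only [firstCols, Matrix.mul_apply, transpose_apply, submatrix_apply, id, Pi.smul_apply,
      Pi.add_apply, mulVec, dotProduct, blockFF, blockFL, gram, Matrix.smul_apply, smul_eq_mul,
      lastEntries, mul_add, Finset.mul_sum]
    congr 1 <;> refine Finset.sum_congr rfl fun k _ => ?_ <;> rw [← mul_assoc] <;> congr 1 <;>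
      rw [Finset.sum_congr rfl fun x _ => (mul_inv_cancel_left₀ hn' (X x j * X x k)).symm,
        Finset.mul_sum]
  have h2 : delta (gram X) θ p i =
      ((blockFF (gram X) p)⁻¹ *ᵥ (blockFL (gram X) p *ᵥ lastEntries θ p)) i := by
    unfold delta
    rw [dif_pos i.2]
  rw [h2, lsMat, ← mulVec_mulVec, h1, gram_firstCols_inv hS hn, smul_mulVec, mulVec_smul,
    smul_smul, inv_mul_cancel₀ hn', one_smul, mulVec_add, mulVec_mulVec,
    Matrix.nonsing_inv_mul _ hu, one_mulVec]
  rfl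

lemma sampleMeasure_isNormal (X : Matrix (Fin n) (Fin P) ℝ) (θ : Fin P → ℝ) (σ : ℝ) :
    IsNormal (sampleMeasure X θ σ) (X *ᵥ θ) (σ ^ 2 • (1 : Matrix (Fin n) (Fin n) ℝ)) := by
  have h := (IsNormal.pi_gaussianReal (ι := Fin n) (σ ^ 2).toNNReal).map_affine 1 (X *ᵥ θ)
  simp only [one_mulVec, zero_add, Real.coe_toNNReal _ (sq_nonneg σ), transpose_one,
    Matrix.mul_one, Matrix.one_mul] at h
  have e : (fun u : Fin n → ℝ => X *ᵥ θ + u) = fun u => u + X *ᵥ θ := funext fun u => add_comm _ _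
  rw [sampleMeasure, e]
  exact h

instance (X : Matrix (Fin n) (Fin P) ℝ) (θ : Fin P → ℝ) (σ : ℝ) :
    IsProbabilityMeasure (sampleMeasure X θ σ) :=
  (sampleMeasure_isNormal X θ σ).isProbabilityMeasure

/-- `√n (θ̃(p) - θ)[p]`. -/
noncomputable def dev (X : Matrix (Fin n) (Fin P) ℝ) (θ : Fin P → ℝ) (p : ℕ) (Y : Fin n → ℝ) :
    {j : Fin P // (j : ℕ) < p} → ℝ :=
  fun i => √(n : ℝ) * ((lsMat X p *ᵥ Y) i - θ i)

lemma measurable_dev (X : Matrix (Fin n) (Fin P) ℝ) (θ : Fin P → ℝ) (p : ℕ) :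
    Measurable (dev X θ p) := by
  unfold dev
  refine measurable_pi_lambda _ fun i => Continuous.measurable ?_
  fun_prop

/-- The deviation is affine in `Y`. The factor `√n` enters the bias through linearity of `delta` in
its parameter, and its square cancels the `n⁻¹` in the covariance. -/
lemma dev_isNormal {X : Matrix (Fin n) (Fin P) ℝ} (hS : (gram X).PosDef) (hn : 0 < n)
    (θ : Fin P → ℝ) (σ : ℝ) (p : ℕ) :
    IsNormal ((sampleMeasure X θ σ).map (dev X θ p))
      (fun i => delta (gram X) (√(n : ℝ) • θ) p i) (σ ^ 2 • (blockFF (gram X) p)⁻¹) := by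
  have hn' : (n : ℝ) ≠ 0 := by positivity
  have h := (sampleMeasure_isNormal X θ σ).map_affine (√(n : ℝ) • lsMat X p)
    (fun i => -(√(n : ℝ) * θ i))
  convert! h using 1
  · congr 1
    funext Y i
    simp only [dev, smul_mulVec, Pi.add_apply, Pi.smul_apply, smul_eq_mul]
    ring
  · funext i
    simp only [smul_mulVec, Pi.add_apply, Pi.smul_apply, smul_eq_mul, lsMat_mulVec_mulVec hS hn]
    have : delta (gram X) (√(n : ℝ) • θ) p i = √(n : ℝ) * delta (gram X) θ p i := by
      have h1 : lastEntries (√(n : ℝ) • θ) p = √(n : ℝ) • lastEntries θ p := rfl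
      simp only [delta, i.2, dif_pos, h1, mulVec_smul, Pi.smul_apply, smul_eq_mul]
    rw [this]; ring
  · rw [transpose_smul]
    simp only [Matrix.mul_smul, Matrix.smul_mul, Matrix.mul_one, lsMat_mul_transpose hS hn,
      smul_smul]
    congr 1
    have h2 := Real.mul_self_sqrt (Nat.cast_nonneg (α := ℝ) n)
    field_simp
    linear_combination (-σ ^ 2) * h2

/-- The last coefficient of the model of order `q + 1`. -/
noncomputable def lastCoef (X : Matrix (Fin n) (Fin P) ℝ) (q : Fin P) (Y : Fin n → ℝ) : ℝ :=
  lsMat X ((q : ℕ) + 1) (lastIdx q) ⬝ᵥ Y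

lemma restrictedLS_eq_lastCoef (X : Matrix (Fin n) (Fin P) ℝ) (q : Fin P) (Y : Fin n → ℝ) :
    restrictedLS X ((q : ℕ) + 1) Y q = lastCoef X q Y := by
  rw [restrictedLS_apply, dif_pos (Nat.lt_succ_self _)]
  rfl

lemma measurable_lastCoef (X : Matrix (Fin n) (Fin P) ℝ) (q : Fin P) :
    Measurable (lastCoef X q) := by
  unfold lastCoef
  exact Continuous.measurable (by fun_prop)

lemma dotProduct_lsMat_lastIdx {X : Matrix (Fin n) (Fin P) ℝ} (hS : (gram X).PosDef)
    (hn : 0 < n) {p : ℕ} {q : Fin P} (hpq : p ≤ (q : ℕ)) (i : {j : Fin P // (j : ℕ) < p}) :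
    lsMat X p i ⬝ᵥ lsMat X ((q : ℕ) + 1) (lastIdx q) = 0 :=
  lsMat_mul_transpose_lastIdx hS hn hpq i

/-- `θ̃(p)` and the last coefficients of the larger models are independent. -/
lemma measureReal_inter_lastCoef {X : Matrix (Fin n) (Fin P) ℝ} (hS : (gram X).PosDef)
    (hn : 0 < n) (θ : Fin P → ℝ) (σ : ℝ) (p : ℕ) {B : Set ({j : Fin P // (j : ℕ) < p} → ℝ)}
    (hB : MeasurableSet B) {C : Fin P → Set ℝ} (hC : ∀ q, MeasurableSet (C q)) :
    (sampleMeasure X θ σ).real ({Y | lsMat X p *ᵥ Y ∈ B} ∩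
        {Y | ∀ q : Fin P, p ≤ (q : ℕ) → lastCoef X q Y ∈ C q}) =
      (sampleMeasure X θ σ).real {Y | lsMat X p *ᵥ Y ∈ B} *
        ∏ q ∈ Finset.univ.filter (fun q : Fin P => p ≤ (q : ℕ)),
          (sampleMeasure X θ σ).real {Y | lastCoef X q Y ∈ C q} := by
  set μ := sampleMeasure X θ σ with hμ
  have hN := sampleMeasure_isNormal X θ σ
  have hgauss := hN.gaussian
  let W : {q : Fin P // p ≤ (q : ℕ)} → (Fin n → ℝ) → ℝ := fun q => lastCoef X q
  have hcov0 : ∀ (a b : Fin n → ℝ), a ⬝ᵥ b = 0 → cov[fun Y => a ⬝ᵥ Y, fun Y => b ⬝ᵥ Y; μ] = 0 := by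
    intro a b hab
    rw [hN.cov_dotProduct, smul_mulVec, one_mulVec, dotProduct_smul, hab, smul_zero]
  have hid : HasGaussianLaw (fun Y : Fin n → ℝ => Y) μ := ⟨by
    rw [show (fun Y : Fin n → ℝ => Y) = id from rfl, Measure.map_id]; exact hgauss⟩
  let Wm : Matrix {q : Fin P // p ≤ (q : ℕ)} (Fin n) ℝ :=
    Matrix.of fun q => lsMat X ((q : Fin P) + 1) (lastIdx (q : Fin P))
  have hjoint : HasGaussianLaw (fun Y => (fun i => (lsMat X p *ᵥ Y) i, fun q => W q Y)) μ :=
    hid.map ((LinearMap.toContinuousLinearMap (mulVecLin (lsMat X p))).prod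
      (LinearMap.toContinuousLinearMap (mulVecLin Wm)))
  -- Joint normality turns zero covariance into independence, here of the block from the whole
  -- vector of last coefficients. Below, the same is done among these coefficients, where the
  -- smaller of the two models takes the role of the block.
  have hind : IndepFun (fun Y i => (lsMat X p *ᵥ Y) i) (fun Y q => W q Y) μ :=
    HasGaussianLaw.indepFun_of_covariance_eval (X := fun i Y => (lsMat X p *ᵥ Y) i) (Y := W)
      hjoint fun i q => hcov0 _ _ (dotProduct_lsMat_lastIdx hS hn q.2 i)
  have hW : HasGaussianLaw (fun Y q => W q Y) μ := hjoint.snd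
  have hiind : iIndepFun W μ := by
    refine hW.iIndepFun_of_covariance_eq_zero fun q r hqr => ?_
    have hne : ((q : Fin P) : ℕ) ≠ ((r : Fin P) : ℕ) := fun h =>
      hqr (Subtype.ext (Fin.ext h))
    rcases lt_or_gt_of_ne hne with h | h
    · exact hcov0 _ _ (dotProduct_lsMat_lastIdx hS hn h _)
    · refine hcov0 _ _ ?_
      rw [dotProduct_comm]
      exact dotProduct_lsMat_lastIdx hS hn h _
  have hset : {Y | ∀ q : Fin P, p ≤ (q : ℕ) → lastCoef X q Y ∈ C q} =
      (fun Y q => W q Y) ⁻¹' (Set.univ.pi fun q : {q : Fin P // p ≤ (q : ℕ)} => C q) := by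
    ext Y
    simp only [Set.mem_ofPred_eq, Set.mem_preimage, Set.mem_univ_pi, Subtype.forall]
    rfl
  have hset2 : (fun Y q => W q Y) ⁻¹'
        (Set.univ.pi fun q : {q : Fin P // p ≤ (q : ℕ)} => C q) =
      ⋂ q ∈ (Finset.univ : Finset {q : Fin P // p ≤ (q : ℕ)}), W q ⁻¹' C q := by
    ext Y
    simp
  have h1 := hind.measure_inter_preimage_eq_mul B
    (Set.univ.pi fun q : {q : Fin P // p ≤ (q : ℕ)} => C q) hB
    (MeasurableSet.univ_pi fun q => hC q)
  have h2 := hiind.measure_inter_preimage_eq_mul Finset.univ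
    (sets := fun q : {q : Fin P // p ≤ (q : ℕ)} => C q) fun q _ => hC q
  rw [hset]
  simp only [measureReal_def]
  rw [show {Y | lsMat X p *ᵥ Y ∈ B} = (fun Y i => (lsMat X p *ᵥ Y) i) ⁻¹' B from rfl, h1,
    ENNReal.toReal_mul, hset2, h2, ENNReal.toReal_prod]
  congr 1
  rw [← Finset.prod_subtype_eq_prod_filter, Finset.subtype_univ]
  rfl

end Design

end PostModelSelection

namespace PostModelSelection

/-! ### The general-to-specific selector -/

section Selector

variable {n P k : ℕ} {X : Matrix (Fin n) (Fin P) ℝ} {c : ℕ → ℝ} {O : ℕ}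

/-- Because `c O = 0`, the order `O` always passes its test. The filtered set is therefore non-empty
and its supremum is attained, not the default `0` of an empty supremum. -/
lemma selector_mem (hO : O ≤ P) (hcO : c O = 0) (s : ℝ) (Y : Fin n → ℝ) :
    selector X c s Y ≤ P ∧ c (selector X c s Y) ≤ |testStat X s Y (selector X c s Y)| := by
  have hne : ((Finset.range (P + 1)).filter fun p => c p ≤ |testStat X s Y p|).Nonempty :=
    ⟨O, by simp [hcO]; omega⟩
  obtain ⟨p, hp, hpe⟩ := Finset.exists_mem_eq_sup _ hne id
  have : selector X c s Y = p := hpe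
  rw [this]
  simp only [Finset.mem_filter, Finset.mem_range] at hp
  exact ⟨by omega, hp.2⟩

lemma le_selector {p : ℕ} (hp : p ≤ P) {s : ℝ} {Y : Fin n → ℝ} (h : c p ≤ |testStat X s Y p|) :
    p ≤ selector X c s Y :=
  Finset.le_sup (f := id) (by simp only [Finset.mem_filter, Finset.mem_range]; exact ⟨by omega, h⟩)

lemma le_selector_of_eq_zero (hO : O ≤ P) (hcO : c O = 0) (s : ℝ) (Y : Fin n → ℝ) :
    O ≤ selector X c s Y :=
  le_selector hO (by simp [hcO])

/-- This form of the selection event involves no test below `p`, which is what makes the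
factorisation by independence possible. -/
lemma selector_eq_iff (hO : O ≤ P) (hcO : c O = 0) {s : ℝ} {Y : Fin n → ℝ} {p : ℕ} (hp : p ≤ P) :
    selector X c s Y = p ↔ c p ≤ |testStat X s Y p| ∧
      ∀ q : Fin P, p ≤ (q : ℕ) → |testStat X s Y ((q : ℕ) + 1)| < c ((q : ℕ) + 1) := by
  constructor
  · rintro rfl
    refine ⟨(selector_mem hO hcO s Y).2, fun q hq => ?_⟩
    by_contra h
    have := le_selector (p := (q : ℕ) + 1) (by have := q.2; omega) (not_lt.1 h)
    omega
  · rintro ⟨h1, h2⟩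
    refine le_antisymm ?_ (le_selector hp h1)
    by_contra h
    obtain ⟨h3, h4⟩ := selector_mem hO hcO s Y (X := X)
    obtain ⟨q, hq⟩ : ∃ q, selector X c s Y = q + 1 := ⟨selector X c s Y - 1, by omega⟩
    rw [hq] at h h3 h4
    exact absurd (h2 ⟨q, by omega⟩ (by simp only; omega)) (not_lt.2 h4)

lemma measurable_restrictedLS (X : Matrix (Fin n) (Fin P) ℝ) (p : ℕ) :
    Measurable (restrictedLS X p) := by
  refine measurable_pi_lambda _ fun i => ?_
  simp only [restrictedLS_apply]
  split_ifs
  · exact Continuous.measurable (by fun_prop)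
  · exact measurable_const

lemma measurable_sigmaHat (X : Matrix (Fin n) (Fin P) ℝ) : Measurable (sigmaHat X) := by
  have h : Measurable fun Y : Fin n → ℝ => Y - X *ᵥ restrictedLS X P Y :=
    measurable_id.sub ((show Continuous fun v : Fin P → ℝ => X *ᵥ v by fun_prop).measurable.comp
      (measurable_restrictedLS X P))
  have h2 : Continuous fun v : Fin n → ℝ => v ⬝ᵥ v := by fun_prop
  exact ((h2.measurable.comp h).const_mul _).sqrt

lemma measurable_testStat {s : (Fin n → ℝ) → ℝ} (hs : Measurable s) (p : ℕ) :
    Measurable fun Y => testStat X (s Y) Y p := by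
  cases p with
  | zero => exact measurable_const
  | succ j =>
    simp only [testStat]
    split_ifs with h
    · exact (((measurable_pi_apply _).comp (measurable_restrictedLS X (j + 1))).const_mul _).div
        (hs.mul_const _)
    · exact measurable_const

lemma measurable_selector {s : (Fin n → ℝ) → ℝ} (hs : Measurable s) :
    Measurable fun Y => selector X c (s Y) Y := by
  -- Replacing the random filter by terms equal to `0`, the bottom of `ℕ`, gives a supremum of
  -- measurable functions over a fixed finite set.
  have : (fun Y => selector X c (s Y) Y) = (Finset.range (P + 1)).sup fun p Y =>
      if c p ≤ |testStat X (s Y) Y p| then p else 0 := by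
    funext Y
    rw [selector, Finset.sup_apply]
    refine le_antisymm (Finset.sup_le fun p hp => ?_) (Finset.sup_le fun p hp => ?_)
    · rw [Finset.mem_filter] at hp
      refine le_trans ?_ (Finset.le_sup (f := fun p => if c p ≤ |testStat X (s Y) Y p| then p else 0)
        hp.1)
      simp [hp.2]
    · split_ifs with h
      · exact Finset.le_sup (f := id) (Finset.mem_filter.2 ⟨hp, h⟩)
      · exact Nat.zero_le _
  rw [this]
  refine Finset.sup_induction measurable_const (fun f hf g hg => hf.sup hg) fun p _ => ?_
  exact Measurable.ite (measurableSet_le measurable_const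
    (measurable_testStat hs p).abs) measurable_const measurable_const

/-- `√n A (θ̃(p) - θ)`. -/
noncomputable def scaledErr (X : Matrix (Fin n) (Fin P) ℝ) (A : Matrix (Fin k) (Fin P) ℝ)
    (θ : Fin P → ℝ) (p : ℕ) (Y : Fin n → ℝ) : Fin k → ℝ :=
  √(n : ℝ) • (A *ᵥ (restrictedLS X p Y - θ))

lemma measurable_scaledErr (X : Matrix (Fin n) (Fin P) ℝ) (A : Matrix (Fin k) (Fin P) ℝ)
    (θ : Fin P → ℝ) (p : ℕ) : Measurable (scaledErr X A θ p) :=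
  (show Continuous fun v : Fin P → ℝ => √(n : ℝ) • (A *ᵥ (v - θ)) by fun_prop).measurable.comp
    (measurable_restrictedLS X p)

lemma measurable_apply_nat {α β : Type*} [MeasurableSpace α] [MeasurableSpace β] {g : ℕ → α → β}
    (hg : ∀ p, Measurable (g p)) {f : α → ℕ} (hf : Measurable f) :
    Measurable fun x => g (f x) x := by
  have h : Measurable fun q : ℕ × α => g q.1 q.2 := measurable_from_prod_countable_right hg
  exact h.comp (hf.prodMk measurable_id)

lemma measurable_scaledErr_comp (X : Matrix (Fin n) (Fin P) ℝ) (A : Matrix (Fin k) (Fin P) ℝ)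
    (θ : Fin P → ℝ) {f : (Fin n → ℝ) → ℕ} (hf : Measurable f) :
    Measurable fun Y => scaledErr X A θ (f Y) Y :=
  measurable_apply_nat (measurable_scaledErr X A θ) hf

lemma measurable_pHat : Measurable (pHat X c) := measurable_selector (measurable_sigmaHat X)

lemma measurable_pHatStar (σ : ℝ) : Measurable (pHatStar X c σ) :=
  measurable_selector measurable_const

lemma lawGStar_real (A : Matrix (Fin k) (Fin P) ℝ) (θ : Fin P → ℝ) (σ : ℝ)
    {B : Set (Fin k → ℝ)} (hB : MeasurableSet B) :
    (lawGStar X c A θ σ).real B =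
      (sampleMeasure X θ σ).real {Y | scaledErr X A θ (pHatStar X c σ Y) Y ∈ B} :=
  map_measureReal_apply (measurable_scaledErr_comp X A θ (measurable_pHatStar σ)) hB

lemma lawG_real (A : Matrix (Fin k) (Fin P) ℝ) (θ : Fin P → ℝ) (σ : ℝ)
    {B : Set (Fin k → ℝ)} (hB : MeasurableSet B) :
    (lawG X c A θ σ).real B =
      (sampleMeasure X θ σ).real {Y | scaledErr X A θ (pHat X c Y) Y ∈ B} :=
  map_measureReal_apply (measurable_scaledErr_comp X A θ measurable_pHat) hB

instance (A : Matrix (Fin k) (Fin P) ℝ) (θ : Fin P → ℝ) (σ : ℝ) :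
    IsProbabilityMeasure (lawGStar X c A θ σ) :=
  Measure.isProbabilityMeasure_map
    (measurable_scaledErr_comp X A θ (measurable_pHatStar σ)).aemeasurable

/-- The decomposition of `G*` by the selected order. -/
lemma lawGStar_real_eq_sum (hO : O ≤ P) (hcO : c O = 0) (A : Matrix (Fin k) (Fin P) ℝ)
    (θ : Fin P → ℝ) (σ : ℝ) {B : Set (Fin k → ℝ)} (hB : MeasurableSet B) :
    (lawGStar X c A θ σ).real B = ∑ p ∈ Finset.range (P + 1),
      (sampleMeasure X θ σ).real {Y | scaledErr X A θ p Y ∈ B ∧ pHatStar X c σ Y = p} := by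
  rw [lawGStar_real A θ σ hB, ← measureReal_biUnion_finset]
  · congr 1
    ext Y
    simp only [Set.mem_ofPred_eq, Set.mem_iUnion, Finset.mem_range]
    constructor
    · intro h
      exact ⟨_, Nat.lt_succ_of_le (selector_mem hO hcO σ Y).1, h, rfl⟩
    · rintro ⟨p, -, h, rfl⟩
      exact h
  · intro p _ q _ hpq
    refine Set.disjoint_left.2 fun Y h1 h2 => hpq ?_
    exact h1.2.symm.trans h2.2
  · intro p _
    exact (measurable_scaledErr X A θ p hB).inter (measurable_pHatStar σ (measurableSet_singleton p))

/-- Clearing the denominator moves the scale `s` into the threshold, so the tests with estimated and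
with known variance compare one statistic with two cut-offs. -/
lemma le_abs_testStat_iff (hS : (gram X).PosDef) {s : ℝ} (hs : 0 < s) (a : ℝ) (Y : Fin n → ℝ)
    (j : Fin P) : a ≤ |testStat X s Y ((j : ℕ) + 1)| ↔
      a * s * xi (gram X) j ≤ |√(n : ℝ) * lastCoef X j Y| := by
  have hx := xi_pos hS j
  have h : testStat X s Y ((j : ℕ) + 1) =
      √(n : ℝ) * lastCoef X j Y / (s * xi (gram X) j) := by
    simp only [testStat, j.2, dif_pos, ← restrictedLS_eq_lastCoef]
    rfl
  rw [h, abs_div, abs_of_pos (mul_pos hs hx), le_div_iff₀ (mul_pos hs hx), mul_assoc]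

/-- The probability that the idealized test for the last coefficient `q` accepts. -/
noncomputable def acceptProb (X : Matrix (Fin n) (Fin P) ℝ) (c : ℕ → ℝ) (θ : Fin P → ℝ) (σ : ℝ)
    (q : Fin P) : ℝ :=
  (sampleMeasure X θ σ).real
    {Y | |√(n : ℝ) * lastCoef X q Y| < c ((q : ℕ) + 1) * σ * xi (gram X) q}

lemma measureReal_inter_accept (hS : (gram X).PosDef) (hn : 0 < n) (θ : Fin P → ℝ) {σ : ℝ}
    (hσ : 0 < σ) (p : ℕ) {B : Set ({j : Fin P // (j : ℕ) < p} → ℝ)} (hB : MeasurableSet B) :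
    (sampleMeasure X θ σ).real {Y | lsMat X p *ᵥ Y ∈ B ∧ ∀ q : Fin P, p ≤ (q : ℕ) →
        |testStat X σ Y ((q : ℕ) + 1)| < c ((q : ℕ) + 1)} =
      (sampleMeasure X θ σ).real {Y | lsMat X p *ᵥ Y ∈ B} *
        ∏ q ∈ Finset.univ.filter (fun q : Fin P => p ≤ (q : ℕ)), acceptProb X c θ σ q := by
  have h := measureReal_inter_lastCoef hS hn θ σ p hB
    (C := fun q => {x | |√(n : ℝ) * x| < c ((q : ℕ) + 1) * σ * xi (gram X) q})
    fun q => measurableSet_lt (measurable_id.const_mul _).abs measurable_const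
  unfold acceptProb
  refine Eq.trans ?_ h
  congr 1
  ext Y
  simp only [Set.mem_inter_iff, Set.mem_ofPred_eq, ← not_le, le_abs_testStat_iff hS hσ]

/-- The vector whose first `p` components are `d` and whose last ones are `-φ[¬p]`. -/
def extendNeg (φ : Fin P → ℝ) (p : ℕ) (d : {j : Fin P // (j : ℕ) < p} → ℝ) : Fin P → ℝ :=
  fun i => if h : (i : ℕ) < p then d ⟨i, h⟩ else -φ i

lemma continuous_extendNeg (φ : Fin P → ℝ) (p : ℕ) : Continuous (extendNeg φ p) := by
  refine continuous_pi fun i => ?_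
  unfold extendNeg
  split_ifs
  · fun_prop
  · exact continuous_const

lemma extendNeg_congr {φ ψ : Fin P → ℝ} {p : ℕ} (h : ∀ i : Fin P, p ≤ (i : ℕ) → φ i = ψ i) :
    extendNeg φ p = extendNeg ψ p := by
  funext d i
  unfold extendNeg
  split_ifs with hi
  · rfl
  · rw [h i (not_lt.1 hi)]

lemma smul_restrictedLS_sub (θ : Fin P → ℝ) (p : ℕ) (Y : Fin n → ℝ) :
    √(n : ℝ) • (restrictedLS X p Y - θ) = extendNeg (√(n : ℝ) • θ) p (dev X θ p Y) := by
  funext i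
  simp only [Pi.smul_apply, Pi.sub_apply, restrictedLS_apply, extendNeg, dev, smul_eq_mul]
  split_ifs <;> ring

lemma scaledErr_eq (A : Matrix (Fin k) (Fin P) ℝ) (θ : Fin P → ℝ) (p : ℕ) (Y : Fin n → ℝ) :
    scaledErr X A θ p Y = A *ᵥ extendNeg (√(n : ℝ) • θ) p (dev X θ p Y) := by
  rw [scaledErr, ← mulVec_smul, smul_restrictedLS_sub]

lemma sqrt_mul_lastCoef (θ : Fin P → ℝ) (j : Fin P) (Y : Fin n → ℝ) :
    √(n : ℝ) * lastCoef X j Y =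
      dev X θ ((j : ℕ) + 1) Y (lastIdx j) + √(n : ℝ) * θ j := by
  simp only [dev, lastCoef, mulVec, lastIdx]
  ring

/-- The joint probability of an event for `θ̃(p)` and of acceptance in all larger models. -/
lemma measureReal_dev_accept (hS : (gram X).PosDef) (hn : 0 < n) (θ : Fin P → ℝ) {σ : ℝ}
    (hσ : 0 < σ) (p : ℕ) {B : Set ({j : Fin P // (j : ℕ) < p} → ℝ)} (hB : MeasurableSet B) :
    (sampleMeasure X θ σ).real {Y | dev X θ p Y ∈ B ∧ ∀ q : Fin P, p ≤ (q : ℕ) →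
        |testStat X σ Y ((q : ℕ) + 1)| < c ((q : ℕ) + 1)} =
      ((sampleMeasure X θ σ).map (dev X θ p)).real B *
        ∏ q ∈ Finset.univ.filter (fun q : Fin P => p ≤ (q : ℕ)), acceptProb X c θ σ q := by
  have hm : Measurable fun (v : {j : Fin P // (j : ℕ) < p} → ℝ) i => √(n : ℝ) * (v i - θ i) := by
    fun_prop
  have h := measureReal_inter_accept (c := c) hS hn θ hσ p (hm hB)
  rw [map_measureReal_apply (measurable_dev X θ p) hB]
  exact h

end Selector

end PostModelSelection

namespace PostModelSelection

/-! ### The limit laws -/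

section Limit

variable {P k : ℕ} {Q : Matrix (Fin P) (Fin P) ℝ} {A : Matrix (Fin k) (Fin P) ℝ}

/-- `x[p]`: the first `p` components of the vector `x`. -/
def firstEntries (x : Fin P → ℝ) (p : ℕ) : {j : Fin P // (j : ℕ) < p} → ℝ :=
  fun j => x j

/-- The limit law of `√n (θ̃(p) - θ)[p]`. -/
noncomputable def limNormal (Q : Matrix (Fin P) (Fin P) ℝ) (σ : ℝ) (ψ : Fin P → ℝ) (p : ℕ) :
    Measure ({j : Fin P // (j : ℕ) < p} → ℝ) :=
  (multivariateGaussian (WithLp.toLp 2 (firstEntries (delta Q ψ p) p))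
    (σ ^ 2 • (blockFF Q p)⁻¹)).map WithLp.ofLp

lemma limNormal_isNormal (hQ : Q.PosDef) (σ : ℝ) (ψ : Fin P → ℝ) (p : ℕ) :
    IsNormal (limNormal Q σ ψ p) (firstEntries (delta Q ψ p) p) (σ ^ 2 • (blockFF Q p)⁻¹) :=
  IsNormal.multivariateGaussian_map ((blockFF_posDef hQ p).inv.posSemidef.smul (sq_nonneg σ))

lemma Phi_isNormal (hQ : Q.PosDef) (A : Matrix (Fin k) (Fin P) ℝ) (σ : ℝ) (p : ℕ) :
    IsNormal (Phi Q A σ p) 0 (σ ^ 2 • covMat Q A p) := by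
  have h : (covMat Q A p).PosSemidef := by
    have := (blockFF_posDef hQ p).inv.posSemidef.mul_mul_conjTranspose_same (firstCols A p)
    rwa [conjTranspose_eq_transpose_of_trivial] at this
  have h1 := IsNormal.multivariateGaussian_map (m := (0 : Fin k → ℝ)) (h.smul (sq_nonneg σ))
  rwa [WithLp.toLp_zero] at h1

/-- On the last `P - p` coordinates `extendNeg` and `delta` are both `-ψ`, so their difference is
supported on the first `p` coordinates and only `A[p]` acts on it. -/
lemma mulVec_extendNeg (A : Matrix (Fin k) (Fin P) ℝ) (Q : Matrix (Fin P) (Fin P) ℝ)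
    (ψ : Fin P → ℝ) (p : ℕ) (d : {j : Fin P // (j : ℕ) < p} → ℝ) :
    A *ᵥ extendNeg ψ p d =
      firstCols A p *ᵥ (d - firstEntries (delta Q ψ p) p) + A *ᵥ delta Q ψ p := by
  rw [← sub_eq_iff_eq_add, ← mulVec_sub]
  funext i
  rw [mulVec, dotProduct, sum_eq_sum_lt_add_sum_le p]
  have h2 : ∑ j : {j : Fin P // p ≤ (j : ℕ)},
      A i j * (extendNeg ψ p d - delta Q ψ p) j = 0 := by
    refine Finset.sum_eq_zero fun j _ => ?_
    simp [extendNeg, delta, not_lt.2 j.2]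
  rw [h2, add_zero]
  refine Finset.sum_congr rfl fun j _ => ?_
  simp [firstCols, extendNeg, firstEntries, j.2]

lemma limNormal_sub_isNormal (hQ : Q.PosDef) (σ : ℝ) (ψ : Fin P → ℝ) (p : ℕ) :
    IsNormal ((limNormal Q σ ψ p).map fun d => d - firstEntries (delta Q ψ p) p) 0
      (σ ^ 2 • (blockFF Q p)⁻¹) := by
  have h := (limNormal_isNormal hQ σ ψ p).map_affine 1 (-firstEntries (delta Q ψ p) p)
  simpa [sub_eq_add_neg] using h

lemma map_firstCols_mulVec (hQ : Q.PosDef) (A : Matrix (Fin k) (Fin P) ℝ) {σ : ℝ} {p : ℕ}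
    {μ : Measure ({j : Fin P // (j : ℕ) < p} → ℝ)}
    (h : IsNormal μ 0 (σ ^ 2 • (blockFF Q p)⁻¹)) :
    μ.map (fun w => firstCols A p *ᵥ w) = Phi Q A σ p := by
  refine IsNormal.ext ?_ (Phi_isNormal hQ A σ p)
  have := h.map_mulVec (firstCols A p)
  simpa [covMat] using this

lemma limNormal_real_Iic (hQ : Q.PosDef) (A : Matrix (Fin k) (Fin P) ℝ) (σ : ℝ) (ψ : Fin P → ℝ)
    (p : ℕ) (t : Fin k → ℝ) :
    (limNormal Q σ ψ p).real {d | A *ᵥ extendNeg ψ p d ∈ Set.Iic t} =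
      (Phi Q A σ p).real (Set.Iic (t - A *ᵥ delta Q ψ p)) := by
  have h := limNormal_sub_isNormal hQ σ ψ p
  have hm : Measurable fun w : {j : Fin P // (j : ℕ) < p} → ℝ => firstCols A p *ᵥ w := by fun_prop
  rw [← map_firstCols_mulVec hQ A h, map_measureReal_apply hm measurableSet_Iic,
    map_measureReal_apply (by fun_prop) (hm measurableSet_Iic)]
  congr 1
  ext d
  simp only [Set.mem_ofPred_eq, Set.mem_preimage, Set.mem_Iic, mulVec_extendNeg A Q, le_sub_iff_add_le]

/-- Symmetry of the centered normal law. `Del` is defined with `x - a`, whereas the test statistics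
produce `x + a`. -/
lemma gaussianReal_real_abs_add (v : NNReal) (a b : ℝ) :
    (gaussianReal 0 v).real {x | |x + a| < b} = (gaussianReal 0 v).real {x | |x - a| < b} := by
  have h : (gaussianReal 0 v).map (fun x => -x) = gaussianReal 0 v := by
    simpa using gaussianReal_map_neg (μ := 0) (v := v)
  conv_lhs => rw [← h]
  rw [map_measureReal_apply (by fun_prop)
    (measurableSet_lt (by fun_prop) measurable_const)]
  congr 1
  ext x
  simp only [Set.mem_preimage, Set.mem_ofPred_eq]
  rw [← abs_neg, show -(-x + a) = x - a by ring]

lemma gaussianReal_real_le_abs_add (v : NNReal) (a b : ℝ) :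
    (gaussianReal 0 v).real {x | b ≤ |x + a|} = 1 - (gaussianReal 0 v).real {x | |x - a| < b} := by
  rw [← gaussianReal_real_abs_add, ← probReal_compl_eq_one_sub
    (measurableSet_lt (by fun_prop) measurable_const)]
  congr 1
  ext x
  simp

/-- The residual variance in the regression of the last component on `A[p]` times the vector. -/
lemma genInverse_regression (hQ : Q.PosDef) {B : Matrix (Fin k) (Fin k) ℝ} {j : Fin P}
    (hB : IsGenInverse (covMat Q A ((j : ℕ) + 1)) B) :
    firstCols A ((j : ℕ) + 1) *ᵥ ((blockFF Q ((j : ℕ) + 1))⁻¹ *ᵥ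
        (Pi.single (lastIdx j) 1 - bvec Q A B j ᵥ* firstCols A ((j : ℕ) + 1))) = 0 ∧
      (Pi.single (lastIdx j) 1 - bvec Q A B j ᵥ* firstCols A ((j : ℕ) + 1)) ⬝ᵥ
        ((blockFF Q ((j : ℕ) + 1))⁻¹ *ᵥ
        (Pi.single (lastIdx j) 1 - bvec Q A B j ᵥ* firstCols A ((j : ℕ) + 1))) =
      zeta Q A B j ^ 2 := by
  set F := firstCols A ((j : ℕ) + 1) with hF
  set K := (blockFF Q ((j : ℕ) + 1))⁻¹ with hK
  set e : {i : Fin P // (i : ℕ) < (j : ℕ) + 1} → ℝ := Pi.single (lastIdx j) 1 with he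
  have hKpd : K.PosDef := (blockFF_posDef hQ _).inv
  have hKt : Kᵀ = K := by
    have := hKpd.isHermitian.eq
    rwa [conjTranspose_eq_transpose_of_trivial] at this
  have hV : covMat Q A ((j : ℕ) + 1) = F * K * Fᵀ := rfl
  have hC : Cvec Q A j = F *ᵥ (K *ᵥ e) := rfl
  have hb : bvec Q A B j = Bᵀ *ᵥ (F *ᵥ (K *ᵥ e)) := by rw [bvec, hC, mulVec_transpose]
  set V := F * K * Fᵀ with hVdef
  have hVt : Vᵀ = V := by
    rw [hVdef, transpose_mul, transpose_mul, transpose_transpose, hKt, Matrix.mul_assoc]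
  have hBV : V * Bᵀ * V = V := by
    have h1 : V * B * V = V := by
      have := hB
      rwa [IsGenInverse, hV] at this
    have h2 := congrArg transpose h1
    rwa [transpose_mul _ V, transpose_mul V B, hVt, ← Matrix.mul_assoc] at h2
  -- The matrix `V Bᵀ` fixes `V = F K Fᵀ`. It also fixes `F`: the difference `M` satisfies `M K Mᵀ =
  -- 0`, and positive definiteness of `K` kills each row of `M`. Symmetry of `B` is not needed.
  have hM : V * Bᵀ * F - F = 0 := by
    set M := V * Bᵀ * F - F with hMdef
    have h1 : M = (V * Bᵀ - 1) * F := by rw [hMdef, Matrix.sub_mul, Matrix.one_mul]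
    have h2 : M * K * Mᵀ = 0 := by
      have : M * K * Mᵀ = (V * Bᵀ - 1) * V * (V * Bᵀ - 1)ᵀ := by
        rw [h1, transpose_mul, hVdef]
        simp only [Matrix.mul_assoc]
      rw [this, Matrix.sub_mul, hBV, Matrix.one_mul, sub_self, Matrix.zero_mul]
    ext i l
    have h3 : M.row i ⬝ᵥ K *ᵥ M.row i = 0 := by
      have h4 := congrFun (congrFun h2 i) i
      rw [Matrix.mul_assoc, Matrix.mul_apply] at h4
      simpa [dotProduct, mulVec, Matrix.mul_apply] using h4
    by_contra hne
    have hne' : M.row i ≠ 0 := fun h => hne (congrFun h l)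
    have := hKpd.dotProduct_mulVec_pos hne'
    simp only [star_trivial] at this
    exact this.ne' h3
  have hVb : V *ᵥ (Bᵀ *ᵥ (F *ᵥ (K *ᵥ e))) = F *ᵥ (K *ᵥ e) := by
    rw [mulVec_mulVec, mulVec_mulVec, sub_eq_zero.1 hM]
  have h1 : F *ᵥ (K *ᵥ (e - bvec Q A B j ᵥ* F)) = 0 := by
    have h2 : F *ᵥ (K *ᵥ (bvec Q A B j ᵥ* F)) = F *ᵥ (K *ᵥ e) := by
      rw [← mulVec_transpose, mulVec_mulVec, mulVec_mulVec, ← hVdef, hb, hVb]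
    rw [mulVec_sub, mulVec_sub, h2, sub_self]
  refine ⟨h1, ?_⟩
  have h2 : (e - bvec Q A B j ᵥ* F) ⬝ᵥ (K *ᵥ (e - bvec Q A B j ᵥ* F)) =
      xi Q j ^ 2 - bvec Q A B j ⬝ᵥ Cvec Q A j := by
    rw [sub_dotProduct, ← dotProduct_mulVec, h1, dotProduct_zero, sub_zero, mulVec_sub,
      dotProduct_sub, xi_sq hQ, hC]
    congr 1
    · simp [he, hK, Pi.single_apply, dotProduct, mulVec]
    · rw [dotProduct_mulVec, ← mulVec_transpose, hKt, dotProduct_comm, ← dotProduct_mulVec]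
  -- The quantity under the root equals a quadratic form in the positive definite `K`, so it is
  -- non-negative and the square root in `zeta` does not truncate.
  rw [h2, zeta, Real.sq_sqrt]
  rw [← h2]
  have := hKpd.posSemidef.dotProduct_mulVec_nonneg (e - bvec Q A B j ᵥ* F)
  simpa using this

end Limit

end PostModelSelection

namespace PostModelSelection

/-! ### Joint law of the limiting estimator and test statistic. -/

section LimitCdf

variable {P k : ℕ} {Q : Matrix (Fin P) (Fin P) ℝ} {A : Matrix (Fin k) (Fin P) ℝ}

/-- By `genInverse_regression` the residual of the last coordinate is uncorrelated with `A[p] w`,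
hence independent of it by joint normality. Its variance `σ²ζ²` may be zero. -/
lemma map_prod_regression (hQ : Q.PosDef) {B : Matrix (Fin k) (Fin k) ℝ} {j : Fin P}
    (hB : IsGenInverse (covMat Q A ((j : ℕ) + 1)) B) {σ : ℝ}
    {μ : Measure ({i : Fin P // (i : ℕ) < (j : ℕ) + 1} → ℝ)}
    (h : IsNormal μ 0 (σ ^ 2 • (blockFF Q ((j : ℕ) + 1))⁻¹)) :
    μ.map (fun w => (firstCols A ((j : ℕ) + 1) *ᵥ w,
        w (lastIdx j) - bvec Q A B j ⬝ᵥ firstCols A ((j : ℕ) + 1) *ᵥ w)) =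
      (Phi Q A σ ((j : ℕ) + 1)).prod (gaussianReal 0 ((σ * zeta Q A B j) ^ 2).toNNReal) := by
  obtain ⟨h1, h2⟩ := genInverse_regression hQ hB
  have := h.gaussian
  set F := firstCols A ((j : ℕ) + 1) with hF
  set r : {i : Fin P // (i : ℕ) < (j : ℕ) + 1} → ℝ :=
    Pi.single (lastIdx j) 1 - bvec Q A B j ᵥ* F with hr
  have hrw : ∀ w : {i : Fin P // (i : ℕ) < (j : ℕ) + 1} → ℝ,
      w (lastIdx j) - bvec Q A B j ⬝ᵥ F *ᵥ w = r ⬝ᵥ w := fun w => by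
    rw [hr, sub_dotProduct, single_one_dotProduct, dotProduct_mulVec]
  simp only [hrw]
  have hid : HasGaussianLaw (fun w : {i : Fin P // (i : ℕ) < (j : ℕ) + 1} → ℝ => w) μ := ⟨by
    rw [show (fun w : {i : Fin P // (i : ℕ) < (j : ℕ) + 1} → ℝ => w) = id from rfl,
      Measure.map_id]
    infer_instance⟩
  -- The scalar residual is written as a vector of length one, since the covariance criterion for
  -- independence is stated for families.
  let R : Matrix (Fin 1) {i : Fin P // (i : ℕ) < (j : ℕ) + 1} ℝ := Matrix.of fun _ => r
  have hjoint : HasGaussianLaw (fun w => (fun i => (F *ᵥ w) i, fun i => (R *ᵥ w) i)) μ :=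
    hid.map ((LinearMap.toContinuousLinearMap (mulVecLin F)).prod
      (LinearMap.toContinuousLinearMap (mulVecLin R)))
  have hind : IndepFun (fun w i => (F *ᵥ w) i) (fun w i => (R *ᵥ w) i) μ := by
    refine HasGaussianLaw.indepFun_of_covariance_eval (X := fun i w => (F *ᵥ w) i)
      (Y := fun i w => (R *ᵥ w) i) hjoint fun i l => ?_
    have := h.cov_dotProduct (F i) r
    rw [smul_mulVec, dotProduct_smul] at this
    have h3 : F i ⬝ᵥ (blockFF Q ((j : ℕ) + 1))⁻¹ *ᵥ r = 0 := congrFun h1 i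
    rw [h3, smul_zero] at this
    exact this
  have hind' : IndepFun (fun w => F *ᵥ w) (fun w => r ⬝ᵥ w) μ :=
    hind.comp (φ := fun x => x) (ψ := fun y : Fin 1 → ℝ => y 0) measurable_id
      (measurable_pi_apply 0)
  rw [(indepFun_iff_map_prod_eq_prod_map_map (by fun_prop)
    (Continuous.aemeasurable (by fun_prop))).1 hind', map_firstCols_mulVec hQ A h,
    h.map_dotProduct, dotProduct_zero, smul_mulVec, dotProduct_smul, h2, smul_eq_mul, mul_pow]

/-- With `z = A[p] w`, the centered last coordinate is `b ⬝ᵥ z` plus an independent residual. Fubini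
then integrates the rejection probability given `z` against `Phi`. -/
lemma limNormal_real_Iic_inter (hQ : Q.PosDef) {B : Matrix (Fin k) (Fin k) ℝ} {j : Fin P}
    (hB : IsGenInverse (covMat Q A ((j : ℕ) + 1)) B) (σ τ : ℝ) (ψ : Fin P → ℝ)
    (t : Fin k → ℝ) :
    (limNormal Q σ ψ ((j : ℕ) + 1)).real
        ({d | A *ᵥ extendNeg ψ ((j : ℕ) + 1) d ∈ Set.Iic t} ∩ {d | τ ≤ |d (lastIdx j) + ψ j|}) =
      ∫ z in Set.Iic (t - A *ᵥ delta Q ψ ((j : ℕ) + 1)),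
        (1 - Del (σ * zeta Q A B j)
          (delta Q ψ ((j : ℕ) + 1) j + ψ j + bvec Q A B j ⬝ᵥ z) τ)
        ∂(Phi Q A σ ((j : ℕ) + 1)) := by
  have h := limNormal_sub_isNormal hQ σ ψ ((j : ℕ) + 1)
  have := (Phi_isNormal hQ A σ ((j : ℕ) + 1)).isProbabilityMeasure
  set F := firstCols A ((j : ℕ) + 1) with hF
  set b := bvec Q A B j with hb
  set a := delta Q ψ ((j : ℕ) + 1) j + ψ j with ha
  set s := t - A *ᵥ delta Q ψ ((j : ℕ) + 1) with hs
  set G := gaussianReal 0 ((σ * zeta Q A B j) ^ 2).toNNReal with hG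
  let S : Set ((Fin k → ℝ) × ℝ) := {q | q.1 ∈ Set.Iic s ∧ τ ≤ |q.2 + (a + b ⬝ᵥ q.1)|}
  have hS : MeasurableSet S := by
    have h2 : MeasurableSet {q : (Fin k → ℝ) × ℝ | τ ≤ |q.2 + (a + b ⬝ᵥ q.1)|} :=
      measurableSet_le measurable_const (Continuous.measurable (by fun_prop))
    exact (measurable_fst measurableSet_Iic).inter h2
  have hm : Measurable fun w : {i : Fin P // (i : ℕ) < (j : ℕ) + 1} → ℝ =>
      (F *ᵥ w, w (lastIdx j) - b ⬝ᵥ F *ᵥ w) := Continuous.measurable (by fun_prop)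
  have h1 : (limNormal Q σ ψ ((j : ℕ) + 1)).real
      ({d | A *ᵥ extendNeg ψ ((j : ℕ) + 1) d ∈ Set.Iic t} ∩ {d | τ ≤ |d (lastIdx j) + ψ j|}) =
      ((Phi Q A σ ((j : ℕ) + 1)).prod G).real S := by
    rw [← map_prod_regression hQ hB h, map_measureReal_apply hm hS,
      map_measureReal_apply (by fun_prop) (hm hS)]
    congr 1
    ext d
    simp only [Set.mem_inter_iff, Set.mem_ofPred_eq, Set.mem_preimage, Set.mem_Iic,
      mulVec_extendNeg A Q, S, ← hF, hs, le_sub_iff_add_le]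
    have e : d (lastIdx j) + ψ j = (d - firstEntries (delta Q ψ ((j : ℕ) + 1)) ((j : ℕ) + 1))
        (lastIdx j) - b ⬝ᵥ F *ᵥ (d - firstEntries (delta Q ψ ((j : ℕ) + 1)) ((j : ℕ) + 1)) +
        (a + b ⬝ᵥ F *ᵥ (d - firstEntries (delta Q ψ ((j : ℕ) + 1)) ((j : ℕ) + 1))) := by
      simp only [Pi.sub_apply, firstEntries, lastIdx, ha]
      ring
    rw [e]
  rw [h1, measureReal_def, Measure.prod_apply hS, ← integral_toReal
    (measurable_measure_prodMk_left hS).aemeasurable (Eventually.of_forall fun z => measure_lt_top _ _),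
    ← integral_indicator measurableSet_Iic]
  refine integral_congr_ae (Eventually.of_forall fun z => ?_)
  by_cases hz : z ∈ Set.Iic s
  · simp only [Set.indicator_of_mem hz]
    have := gaussianReal_real_le_abs_add ((σ * zeta Q A B j) ^ 2).toNNReal (a + b ⬝ᵥ z) τ
    rw [Del, ← this]
    simp only [measureReal_def, ← hG]
    congr 2
    ext x
    simp only [S, Set.mem_preimage, Set.mem_ofPred_eq, hz, true_and]
  · simp only [Set.indicator_of_notMem hz]
    have : Prod.mk z ⁻¹' S = ∅ := by
      ext x
      simp only [S, Set.mem_preimage, Set.mem_ofPred_eq, hz, false_and, Set.mem_empty_iff_false]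
    rw [this]
    simp

lemma limNormal_map_last (hQ : Q.PosDef) (σ : ℝ) (ψ : Fin P → ℝ) (j : Fin P) :
    (limNormal Q σ ψ ((j : ℕ) + 1)).map (fun d => d (lastIdx j) -
        delta Q ψ ((j : ℕ) + 1) j) = gaussianReal 0 ((σ * xi Q j) ^ 2).toNNReal := by
  have h := (limNormal_sub_isNormal hQ σ ψ ((j : ℕ) + 1)).map_dotProduct (Pi.single (lastIdx j) 1)
  rw [Measure.map_map (Continuous.measurable (by fun_prop)) (by fun_prop)] at h
  simp only [single_one_dotProduct, mulVec_single_one] at h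
  rw [mul_pow, xi_sq hQ]
  exact h

lemma one_sub_accept (hQ : Q.PosDef) (c : ℕ → ℝ) (σ : ℝ) (ψ : Fin P → ℝ) (j : Fin P) :
    (limNormal Q σ ψ ((j : ℕ) + 1)).real
        {d | c ((j : ℕ) + 1) * σ * xi Q j ≤ |d (lastIdx j) + ψ j|} = 1 - accept Q c σ ψ j := by
  rw [accept, Del, ← gaussianReal_real_le_abs_add, ← limNormal_map_last hQ σ ψ j,
    map_measureReal_apply (by fun_prop) (measurableSet_le measurable_const (by fun_prop))]
  congr 1
  ext d
  simp only [Set.mem_preimage, Set.mem_ofPred_eq]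
  rw [show d (lastIdx j) - delta Q ψ ((j : ℕ) + 1) j + (delta Q ψ ((j : ℕ) + 1) j + ψ j) =
    d (lastIdx j) + ψ j by ring]

/-- The last coordinate has variance `σ²ξ² > 0`, hence a law without atoms, and the event fixes it
to one of two values. It is `ξ`, not the possibly vanishing `ζ`, that matters here. -/
lemma limNormal_abs_eq_null (hQ : Q.PosDef) {σ : ℝ} (hσ : 0 < σ) (ψ : Fin P → ℝ) (j : Fin P)
    (τ : ℝ) : limNormal Q σ ψ ((j : ℕ) + 1) {d | |d (lastIdx j) + ψ j| = τ} = 0 := by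
  have hv : ((σ * xi Q j) ^ 2).toNNReal ≠ 0 := by
    have := xi_pos hQ j
    rw [ne_eq, Real.toNNReal_eq_zero, not_le]
    positivity
  set a := delta Q ψ ((j : ℕ) + 1) j with ha
  have := nullSingletonClass_gaussianReal (μ := 0) hv
  have h0 : gaussianReal 0 ((σ * xi Q j) ^ 2).toNNReal ({τ - a - ψ j} ∪ {-τ - a - ψ j}) = 0 := by
    rw [measure_union_null_iff]
    exact ⟨measure_singleton _, measure_singleton _⟩
  rw [← limNormal_map_last hQ σ ψ j, Measure.map_apply (by fun_prop)
    ((measurableSet_singleton _).union (measurableSet_singleton _))] at h0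
  refine measure_mono_null (fun d hd => ?_) h0
  simp only [Set.mem_ofPred_eq] at hd
  simp only [Set.mem_preimage, Set.mem_union, Set.mem_singleton_iff]
  rcases abs_choice (d (lastIdx j) + ψ j) with h | h
  · left; linarith
  · right; linarith

end LimitCdf

end PostModelSelection

namespace PostModelSelection

/-! ### Consistency of the variance estimator -/

section SigmaHat

variable {n P : ℕ} {X : Matrix (Fin n) (Fin P) ℝ} {c : ℕ → ℝ} {O : ℕ}

/-- The projection onto the column space of `X`. -/
noncomputable def hatMat (X : Matrix (Fin n) (Fin P) ℝ) : Matrix (Fin n) (Fin n) ℝ :=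
  firstCols X P * lsMat X P

lemma mulVec_eq_firstCols_mulVec (X : Matrix (Fin n) (Fin P) ℝ) (v : Fin P → ℝ) :
    X *ᵥ v = firstCols X P *ᵥ firstEntries v P := by
  funext i
  rw [mulVec, dotProduct, sum_eq_sum_lt_add_sum_le P]
  have : ∑ j : {j : Fin P // P ≤ (j : ℕ)}, X i j * v j = 0 :=
    Finset.sum_eq_zero fun j _ => absurd j.2 (not_le.2 j.1.2)
  rw [this, add_zero]
  rfl

lemma mulVec_restrictedLS (X : Matrix (Fin n) (Fin P) ℝ) (Y : Fin n → ℝ) :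
    X *ᵥ restrictedLS X P Y = hatMat X *ᵥ Y := by
  rw [mulVec_eq_firstCols_mulVec, hatMat, ← mulVec_mulVec]
  congr 1
  funext i
  rw [firstEntries, restrictedLS_apply, dif_pos i.2]

lemma isUnit_det_firstCols (hS : (gram X).PosDef) (hn : 0 < n) (p : ℕ) :
    IsUnit ((firstCols X p)ᵀ * firstCols X p).det := by
  rw [gram_firstCols X hn]
  exact (isUnit_iff_isUnit_det _).1
    (((blockFF_posDef hS p).smul (by positivity : (0 : ℝ) < n)).isUnit)

lemma hatMat_transpose (X : Matrix (Fin n) (Fin P) ℝ) : (hatMat X)ᵀ = hatMat X := by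
  rw [hatMat, lsMat, transpose_mul, transpose_mul, transpose_transpose, transpose_nonsing_inv,
    transpose_mul, transpose_transpose, Matrix.mul_assoc]

lemma lsMat_mul_firstCols (hS : (gram X).PosDef) (hn : 0 < n) (p : ℕ) :
    lsMat X p * firstCols X p = 1 := by
  rw [lsMat, Matrix.mul_assoc, Matrix.nonsing_inv_mul _ (isUnit_det_firstCols hS hn p)]

lemma hatMat_mul_self (hS : (gram X).PosDef) (hn : 0 < n) : hatMat X * hatMat X = hatMat X := by
  rw [hatMat, Matrix.mul_assoc, ← Matrix.mul_assoc (lsMat X P), lsMat_mul_firstCols hS hn,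
    Matrix.one_mul]

lemma hatMat_trace (hS : (gram X).PosDef) (hn : 0 < n) : (hatMat X).trace = P := by
  rw [hatMat, Matrix.trace_mul_comm, lsMat_mul_firstCols hS hn, trace_one, Fintype.card_subtype]
  simp

lemma hatMat_mulVec_mulVec (hS : (gram X).PosDef) (hn : 0 < n) (θ : Fin P → ℝ) :
    hatMat X *ᵥ (X *ᵥ θ) = X *ᵥ θ := by
  rw [mulVec_eq_firstCols_mulVec X θ, hatMat, mulVec_mulVec, Matrix.mul_assoc,
    lsMat_mul_firstCols hS hn, Matrix.mul_one]

/-- Pythagoras for the orthogonal projection `hatMat X`, which fixes `X θ`. -/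
lemma residual_sq (hS : (gram X).PosDef) (hn : 0 < n) (θ : Fin P → ℝ) (Y : Fin n → ℝ) :
    (Y - X *ᵥ restrictedLS X P Y) ⬝ᵥ (Y - X *ᵥ restrictedLS X P Y) =
      (Y - X *ᵥ θ) ⬝ᵥ (Y - X *ᵥ θ) -
        (hatMat X *ᵥ (Y - X *ᵥ θ)) ⬝ᵥ (hatMat X *ᵥ (Y - X *ᵥ θ)) := by
  set R := Y - X *ᵥ θ with hR
  have h1 : Y - X *ᵥ restrictedLS X P Y = R - hatMat X *ᵥ R := by
    rw [mulVec_restrictedLS, hR, mulVec_sub, hatMat_mulVec_mulVec hS hn]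
    abel
  have h2 : R ⬝ᵥ hatMat X *ᵥ R = (hatMat X *ᵥ R) ⬝ᵥ (hatMat X *ᵥ R) := by
    conv_lhs => rw [← hatMat_mul_self hS hn, ← mulVec_mulVec, dotProduct_mulVec,
      ← mulVec_transpose, hatMat_transpose]
  rw [h1, sub_dotProduct, dotProduct_sub R R, dotProduct_sub (hatMat X *ᵥ R),
    dotProduct_comm (hatMat X *ᵥ R) R, h2]
  ring

/-- Standardizing removes `θ` and `σ` from the law, which makes the bound for the variance estimator
uniform in the parameters. -/
lemma map_standardize (X : Matrix (Fin n) (Fin P) ℝ) (θ : Fin P → ℝ) {σ : ℝ} (hσ : 0 < σ) :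
    (sampleMeasure X θ σ).map (fun Y => σ⁻¹ • (Y - X *ᵥ θ)) =
      Measure.pi fun _ : Fin n => gaussianReal 0 1 := by
  have h := (sampleMeasure_isNormal X θ σ).map_affine (σ⁻¹ • (1 : Matrix (Fin n) (Fin n) ℝ))
    (-(σ⁻¹ • X *ᵥ θ))
  have e : σ⁻¹ • (1 : Matrix (Fin n) (Fin n) ℝ) * σ ^ 2 • 1 *
      (σ⁻¹ • (1 : Matrix (Fin n) (Fin n) ℝ))ᵀ = ((1 : NNReal) : ℝ) • 1 := by
    rw [transpose_smul, transpose_one]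
    simp only [Matrix.mul_smul, Matrix.mul_one, smul_smul]
    congr 1
    simp only [NNReal.coe_one]
    field_simp
  rw [e] at h
  have h0 : (σ⁻¹ • (1 : Matrix (Fin n) (Fin n) ℝ)) *ᵥ (X *ᵥ θ) + -(σ⁻¹ • X *ᵥ θ) = 0 := by
    rw [smul_mulVec, one_mulVec, add_neg_cancel]
  rw [h0] at h
  have hfun : (fun Y : Fin n → ℝ => σ⁻¹ • (Y - X *ᵥ θ)) =
      fun Y => (σ⁻¹ • (1 : Matrix (Fin n) (Fin n) ℝ)) *ᵥ Y + -(σ⁻¹ • X *ᵥ θ) := by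
    funext Y
    rw [smul_mulVec, one_mulVec, smul_sub, sub_eq_add_neg]
  rw [hfun]
  exact h.ext (IsNormal.pi_gaussianReal 1)

lemma memLp_sq_gaussianReal : MemLp (fun x : ℝ => x ^ 2) 2 (gaussianReal 0 1) := by
  rw [memLp_two_iff_integrable_sq (Continuous.aestronglyMeasurable (by fun_prop))]
  have h := (memLp_id_gaussianReal' (μ := 0) (v := 1) 4 (by norm_num)).integrable_norm_pow
    (by norm_num)
  refine h.congr (Eventually.of_forall fun x => ?_)
  simp only [id, Real.norm_eq_abs]
  rw [← pow_mul, show 2 * 2 = 4 from rfl, Even.pow_abs (by decide)]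

lemma integral_sq_gaussianReal : ∫ x : ℝ, x ^ 2 ∂(gaussianReal 0 1) = 1 := by
  have h := variance_of_integral_eq_zero (μ := gaussianReal 0 1) (X := fun x : ℝ => x)
    aemeasurable_id integral_id_gaussianReal
  rw [variance_fun_id_gaussianReal] at h
  simpa using h.symm

/-- Chebyshev's inequality for a sum of independent squares of mean one. The variance of a single
square is kept as an unevaluated constant. -/
lemma measureReal_sum_sq_le (n : ℕ) {a : ℝ} (ha : 0 < a) :
    (Measure.pi fun _ : Fin n => gaussianReal 0 1).real {w | a ≤ |w ⬝ᵥ w - n|} ≤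
      n * Var[fun x : ℝ => x ^ 2; gaussianReal 0 1] / a ^ 2 := by
  set γ := Measure.pi fun _ : Fin n => gaussianReal 0 1 with hγ
  have hdot : (fun w : Fin n → ℝ => w ⬝ᵥ w) = ∑ i, fun w : Fin n → ℝ => (w i) ^ 2 := by
    funext w
    simp [dotProduct, sq]
  have hmp : ∀ i : Fin n, MemLp (fun w : Fin n → ℝ => (w i) ^ 2) 2 γ := fun i =>
    memLp_sq_gaussianReal.comp_measurePreserving (measurePreserving_eval _ i)
  have hvar : Var[fun w : Fin n → ℝ => w ⬝ᵥ w; γ] =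
      n * Var[fun x : ℝ => x ^ 2; gaussianReal 0 1] := by
    rw [hdot, hγ, variance_sum_pi (X := fun (_ : Fin n) (x : ℝ) => x ^ 2)
      fun i => memLp_sq_gaussianReal]
    simp
  have hmean : ∫ w, w ⬝ᵥ w ∂γ = n := by
    have : ∀ i : Fin n, ∫ w, (w i) ^ 2 ∂γ = 1 := fun i => by
      have h1 := integral_map (μ := γ) (φ := fun w : Fin n → ℝ => w i)
        (measurable_pi_apply i).aemeasurable (f := fun x : ℝ => x ^ 2)
        (Continuous.aestronglyMeasurable (by fun_prop))
      rw [← h1, ← integral_sq_gaussianReal]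
      congr 1
      exact (measurePreserving_eval (fun _ : Fin n => gaussianReal 0 1) i).map_eq
    have h2 : ∀ w : Fin n → ℝ, w ⬝ᵥ w = ∑ i, (w i) ^ 2 := fun w => by simp [dotProduct, sq]
    simp only [h2]
    rw [integral_finsetSum _ fun i _ => (hmp i).integrable (by norm_num)]
    simp [this]
  have hmem : MemLp (fun w : Fin n → ℝ => w ⬝ᵥ w) 2 γ := by
    rw [hdot]
    exact memLp_finsetSum' _ fun i _ => hmp i
  have h := meas_ge_le_variance_div_sq hmem ha
  rw [hmean, hvar] at h
  refine ENNReal.toReal_le_of_le_ofReal ?_ h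
  have := variance_nonneg (fun x : ℝ => x ^ 2) (gaussianReal 0 1)
  positivity

/-- Markov's inequality: the squared length of the projected noise has mean equal to the trace of
the projection, which is `P`. The extra `P` makes the left-hand quantity dominate the deviation from
this mean. -/
lemma measureReal_hatMat_le (hS : (gram X).PosDef) (hn : 0 < n) {a : ℝ} (ha : 0 < a) :
    (Measure.pi fun _ : Fin n => gaussianReal 0 1).real
      {w | a ≤ (hatMat X *ᵥ w) ⬝ᵥ (hatMat X *ᵥ w) + P} ≤ 2 * P / a := by
  set γ := Measure.pi fun _ : Fin n => gaussianReal 0 1 with hγ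
  have h := (IsNormal.pi_gaussianReal (ι := Fin n) 1)
  have hmem : ∀ i, MemLp (fun w => (hatMat X *ᵥ w) i) 2 γ := fun i =>
    h.memLp_dotProduct (hatMat X i)
  have hint : ∀ i, Integrable (fun w => (hatMat X *ᵥ w) i ^ 2) γ := fun i => (hmem i).integrable_sq
  have hval : ∀ i, ∫ w, (hatMat X *ᵥ w) i ^ 2 ∂γ = hatMat X i i := fun i => by
    have h1 := h.cov_dotProduct (hatMat X i) (hatMat X i)
    have h2 := h.mean_dotProduct (hatMat X i)
    rw [dotProduct_zero] at h2
    rw [covariance_self (Continuous.aemeasurable (by fun_prop)),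
      variance_of_integral_eq_zero (Continuous.aemeasurable (by fun_prop)) h2,
      NNReal.coe_one, one_smul, one_mulVec] at h1
    refine h1.trans ?_
    have h3 := congrFun (congrFun (hatMat_mul_self hS hn) i) i
    have h4 : hatMat X * hatMat X = hatMat X * (hatMat X)ᵀ := by rw [hatMat_transpose]
    rw [h4] at h3
    exact h3
  have hsum : ∀ w, (hatMat X *ᵥ w) ⬝ᵥ (hatMat X *ᵥ w) = ∑ i, (hatMat X *ᵥ w) i ^ 2 := fun w => by
    simp [dotProduct, sq]
  have hI : Integrable (fun w => (hatMat X *ᵥ w) ⬝ᵥ (hatMat X *ᵥ w) + P) γ := by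
    simp only [hsum]
    exact (integrable_finsetSum _ fun i _ => hint i).add (integrable_const _)
  have hE : ∫ w, ((hatMat X *ᵥ w) ⬝ᵥ (hatMat X *ᵥ w) + P) ∂γ = 2 * P := by
    simp only [hsum]
    rw [integral_add (integrable_finsetSum _ fun i _ => hint i) (integrable_const _),
      integral_finsetSum _ fun i _ => hint i]
    simp only [hval]
    have := hatMat_trace hS hn
    rw [Matrix.trace] at this
    simp only [diag_apply] at this
    rw [this]
    simp
    ring
  have h5 := mul_meas_ge_le_integral_of_nonneg (μ := γ)
    (f := fun w => (hatMat X *ᵥ w) ⬝ᵥ (hatMat X *ᵥ w) + P)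
    (Eventually.of_forall fun w => by
      simp only [hsum, Pi.zero_apply]
      positivity) hI a
  rw [hE] at h5
  rw [le_div_iff₀ ha, mul_comm]
  exact h5

/-- A bound, uniform in the parameters, for the probability that `σ̂²/σ²` is far from `1`. -/
lemma measureReal_sigmaHat_le (hS : (gram X).PosDef) (hn : P < n) (θ : Fin P → ℝ) {σ : ℝ}
    (hσ : 0 < σ) {ε : ℝ} (hε : 0 < ε) :
    (sampleMeasure X θ σ).real {Y | ε < |(sigmaHat X Y / σ) ^ 2 - 1|} ≤
      n * Var[fun x : ℝ => x ^ 2; gaussianReal 0 1] / (ε * (n - P) / 2) ^ 2 +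
        2 * P / (ε * (n - P) / 2) := by
  have hm : (0 : ℝ) < n - P := by
    rw [sub_pos]
    exact_mod_cast hn
  have ha : 0 < ε * (n - P) / 2 := by positivity
  -- Half of the allowed deviation goes to `w ⬝ᵥ w` and half to the projected part.
  set a := ε * (n - P) / 2 with hadef
  set γ := Measure.pi fun _ : Fin n => gaussianReal 0 1 with hγ
  have hn0 : 0 < n := by omega
  set S1 : Set (Fin n → ℝ) := {w | a ≤ |w ⬝ᵥ w - n|} with hS1
  set S2 : Set (Fin n → ℝ) := {w | a ≤ (hatMat X *ᵥ w) ⬝ᵥ (hatMat X *ᵥ w) + P} with hS2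
  have hmeas1 : MeasurableSet S1 := measurableSet_le measurable_const
    (Continuous.measurable (by fun_prop))
  have hmeas2 : MeasurableSet S2 := measurableSet_le measurable_const
    (Continuous.measurable (by fun_prop))
  have hsub : {Y | ε < |(sigmaHat X Y / σ) ^ 2 - 1|} ⊆
      (fun Y => σ⁻¹ • (Y - X *ᵥ θ)) ⁻¹' (S1 ∪ S2) := by
    intro Y hY
    simp only [Set.mem_ofPred_eq] at hY
    by_contra hcon
    simp only [Set.mem_preimage, Set.mem_union, not_or, hS1, hS2, Set.mem_ofPred_eq, not_le] at hcon
    obtain ⟨h1, h2⟩ := hcon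
    set w := σ⁻¹ • (Y - X *ᵥ θ) with hw
    have hq : 0 ≤ (hatMat X *ᵥ w) ⬝ᵥ (hatMat X *ᵥ w) := by
      simp only [dotProduct]
      exact Finset.sum_nonneg fun i _ => mul_self_nonneg _
    have hRw : Y - X *ᵥ θ = σ • w := by rw [hw, smul_smul, mul_inv_cancel₀ hσ.ne', one_smul]
    have hrss : (Y - X *ᵥ restrictedLS X P Y) ⬝ᵥ (Y - X *ᵥ restrictedLS X P Y) =
        σ ^ 2 * (w ⬝ᵥ w - (hatMat X *ᵥ w) ⬝ᵥ (hatMat X *ᵥ w)) := by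
      rw [residual_sq hS hn0 θ, hRw]
      simp only [mulVec_smul, smul_dotProduct, dotProduct_smul, smul_eq_mul]
      ring
    have hnn : 0 ≤ (Y - X *ᵥ restrictedLS X P Y) ⬝ᵥ (Y - X *ᵥ restrictedLS X P Y) := by
      rw [dotProduct]
      exact Finset.sum_nonneg fun i _ => mul_self_nonneg _
    -- Dividing by `n - P` lets the two terms be centered separately, at `n` and at `P`.
    have hsig : (sigmaHat X Y / σ) ^ 2 - 1 =
        ((w ⬝ᵥ w - n) - ((hatMat X *ᵥ w) ⬝ᵥ (hatMat X *ᵥ w) - P)) / (n - P) := by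
      rw [div_pow, sigmaHat, Real.sq_sqrt (mul_nonneg (inv_nonneg.2 hm.le) hnn), hrss]
      field_simp
      ring
    rw [hsig, abs_div, abs_of_pos hm, lt_div_iff₀ hm] at hY
    have h3 : |(w ⬝ᵥ w - n) - ((hatMat X *ᵥ w) ⬝ᵥ (hatMat X *ᵥ w) - P)| ≤
        |w ⬝ᵥ w - n| + |(hatMat X *ᵥ w) ⬝ᵥ (hatMat X *ᵥ w) - P| := abs_sub _ _
    have h4 : |(hatMat X *ᵥ w) ⬝ᵥ (hatMat X *ᵥ w) - P| ≤
        (hatMat X *ᵥ w) ⬝ᵥ (hatMat X *ᵥ w) + P := by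
      have : (0 : ℝ) ≤ P := Nat.cast_nonneg P
      exact abs_le.2 ⟨by linarith, by linarith⟩
    have h5 : ε * (n - P) = a + a := by rw [hadef]; ring
    linarith
  have hmap := map_standardize X θ hσ
  calc (sampleMeasure X θ σ).real {Y | ε < |(sigmaHat X Y / σ) ^ 2 - 1|}
      ≤ (sampleMeasure X θ σ).real ((fun Y => σ⁻¹ • (Y - X *ᵥ θ)) ⁻¹' (S1 ∪ S2)) :=
        measureReal_mono hsub
    _ = γ.real (S1 ∪ S2) := by
        rw [hγ, ← hmap, map_measureReal_apply (by fun_prop) (hmeas1.union hmeas2)]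
    _ ≤ γ.real S1 + γ.real S2 := measureReal_union_le _ _
    _ ≤ _ := add_le_add (measureReal_sum_sq_le n ha) (measureReal_hatMat_le hS hn0 ha)

end SigmaHat

end PostModelSelection

namespace PostModelSelection

/-! ### The estimated and the idealized selector agree with probability tending to one -/

section Agreement

variable {P : ℕ} {c : ℕ → ℝ} {O : ℕ}

lemma gaussianReal_real_Icc_le (m a b : ℝ) (hab : a ≤ b) :
    (gaussianReal m 1).real (Set.Icc a b) ≤ b - a := by
  have hpdf : ∀ x, gaussianPDF m 1 x ≤ 1 := fun x => by
    rw [gaussianPDF, ENNReal.ofReal_le_one, gaussianPDFReal]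
    have h1 : 1 ≤ √(2 * Real.pi * (1 : NNReal)) := by
      rw [Real.one_le_sqrt]
      have := Real.pi_gt_three
      simp only [NNReal.coe_one]
      linarith
    refine mul_le_one₀ (inv_le_one_of_one_le₀ h1) (Real.exp_pos _).le ?_
    rw [Real.exp_le_one_iff]
    have : 0 ≤ (x - m) ^ 2 / (2 * ((1 : NNReal) : ℝ)) := by positivity
    rw [neg_div]
    linarith
  refine ENNReal.toReal_le_of_le_ofReal (by linarith) ?_
  rw [gaussianReal_apply m one_ne_zero, ← Real.volume_Icc]
  calc ∫⁻ x in Set.Icc a b, gaussianPDF m 1 x ≤ ∫⁻ _ in Set.Icc a b, 1 :=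
        lintegral_mono fun x => hpdf x
    _ = volume (Set.Icc a b) := by simp

/-- Two intervals of length `2 η` around `±a`, under a density bounded by one. The bound is free of
`m`, which is essential because the means of the test statistics may diverge. -/
lemma gaussianReal_real_abs_abs_sub_le (m a : ℝ) {η : ℝ} (hη : 0 ≤ η) :
    (gaussianReal m 1).real {x | |(|x|) - a| ≤ η} ≤ 4 * η := by
  have hsub : {x : ℝ | |(|x|) - a| ≤ η} ⊆ Set.Icc (a - η) (a + η) ∪ Set.Icc (-a - η) (-a + η) := by
    intro x hx
    simp only [Set.mem_ofPred_eq, abs_le] at hx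
    simp only [Set.mem_union, Set.mem_Icc]
    rcases abs_choice x with h | h
    · left; constructor <;> linarith [hx.1, hx.2]
    · right; constructor <;> linarith [hx.1, hx.2]
  have h1 := gaussianReal_real_Icc_le m (a - η) (a + η) (by linarith)
  have h2 := gaussianReal_real_Icc_le m (-a - η) (-a + η) (by linarith)
  have h3 := (measureReal_mono (μ := gaussianReal m 1) hsub).trans (measureReal_union_le _ _)
  linarith

variable {n : ℕ} {X : Matrix (Fin n) (Fin P) ℝ}

/-- Only the unit variance is used later, so the mean is left existential. -/
lemma map_testStat (hS : (gram X).PosDef) (hn : 0 < n) (θ : Fin P → ℝ) {σ : ℝ} (hσ : 0 < σ)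
    (j : Fin P) : ∃ m : ℝ, (sampleMeasure X θ σ).map
      (fun Y => √(n : ℝ) * lastCoef X j Y / (σ * xi (gram X) j)) = gaussianReal m 1 := by
  have hξ := xi_pos hS j
  have hξ2 := xi_sq hS j
  set v := lsMat X ((j : ℕ) + 1) (lastIdx j) with hv
  have h := (sampleMeasure_isNormal X θ σ).map_dotProduct ((√(n : ℝ) / (σ * xi (gram X) j)) • v)
  have hvv : v ⬝ᵥ v = (n : ℝ)⁻¹ * xi (gram X) j ^ 2 := by
    have := congrFun (congrFun (lsMat_mul_transpose hS hn ((j : ℕ) + 1)) (lastIdx j)) (lastIdx j)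
    rw [Matrix.smul_apply, ← hξ2] at this
    exact this
  refine ⟨((√(n : ℝ) / (σ * xi (gram X) j)) • v) ⬝ᵥ X *ᵥ θ, ?_⟩
  have hvar : ((√(n : ℝ) / (σ * xi (gram X) j)) • v) ⬝ᵥ
      (σ ^ 2 • (1 : Matrix (Fin n) (Fin n) ℝ)) *ᵥ ((√(n : ℝ) / (σ * xi (gram X) j)) • v) = 1 := by
    rw [smul_mulVec, one_mulVec, dotProduct_smul, dotProduct_smul, smul_dotProduct, hvv]
    simp only [smul_eq_mul]
    have hn' : (n : ℝ) ≠ 0 := by positivity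
    have hsq : √(n : ℝ) ^ 2 = n := Real.sq_sqrt (Nat.cast_nonneg n)
    field_simp
    rw [hsq]
  rw [hvar, Real.toNNReal_one] at h
  rw [← h]
  congr 1
  funext Y
  rw [smul_dotProduct, lastCoef, smul_eq_mul]
  ring

/-- Orders below `O` are never selected and `O` passes its test for every scale, so agreement of the
tests above `O` suffices. -/
lemma selector_eq_of_forall (hO : O ≤ P) (hcO : c O = 0) {s s' : ℝ} {Y : Fin n → ℝ}
    (h : ∀ q : Fin P, O ≤ (q : ℕ) → (c ((q : ℕ) + 1) ≤ |testStat X s Y ((q : ℕ) + 1)| ↔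
      c ((q : ℕ) + 1) ≤ |testStat X s' Y ((q : ℕ) + 1)|)) :
    selector X c s Y = selector X c s' Y := by
  have key : ∀ s s' : ℝ, (∀ q : Fin P, O ≤ (q : ℕ) →
      c ((q : ℕ) + 1) ≤ |testStat X s Y ((q : ℕ) + 1)| →
      c ((q : ℕ) + 1) ≤ |testStat X s' Y ((q : ℕ) + 1)|) →
      selector X c s Y ≤ selector X c s' Y := by
    intro s s' h
    obtain ⟨h1, h2⟩ := selector_mem (X := X) hO hcO s Y
    rcases (le_selector_of_eq_zero (X := X) hO hcO s Y).eq_or_lt with h3 | h3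
    · rw [← h3]
      exact le_selector_of_eq_zero hO hcO s' Y
    · obtain ⟨q, hq⟩ : ∃ q, selector X c s Y = q + 1 := ⟨selector X c s Y - 1, by omega⟩
      rw [hq] at h1 h2 h3 ⊢
      exact le_selector h1 (h ⟨q, by omega⟩ (by simp only; omega) h2)
  exact le_antisymm (key s s' fun q hq => (h q hq).1) (key s' s fun q hq => (h q hq).2)

/-- Replacing `σ` by `σ̂` multiplies each critical value by `σ̂/σ`. A decision can change only if
this ratio is far from one or if the idealized statistic is within `c ε` of its critical value; a
union bound finishes. -/
lemma measureReal_pHat_ne_le (hS : (gram X).PosDef) (hn : P < n) (hO : O ≤ P) (hcO : c O = 0)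
    (hc : ∀ p, O < p → p ≤ P → 0 < c p) (θ : Fin P → ℝ) {σ : ℝ} (hσ : 0 < σ) {ε : ℝ} (hε : 0 < ε)
    (hε1 : ε < 1) :
    (sampleMeasure X θ σ).real {Y | pHat X c Y ≠ pHatStar X c σ Y} ≤
      (n * Var[fun x : ℝ => x ^ 2; gaussianReal 0 1] / (ε * (n - P) / 2) ^ 2 +
        2 * P / (ε * (n - P) / 2)) +
      ∑ q ∈ Finset.univ.filter (fun q : Fin P => O ≤ (q : ℕ)), 4 * (c ((q : ℕ) + 1) * ε) := by
  set T : Fin P → (Fin n → ℝ) → ℝ :=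
    fun q Y => √(n : ℝ) * lastCoef X q Y / (σ * xi (gram X) q) with hT
  set F : Finset (Fin P) := Finset.univ.filter (fun q : Fin P => O ≤ (q : ℕ)) with hF
  have hcq : ∀ q ∈ F, 0 < c ((q : ℕ) + 1) := fun q hq => by
    simp only [hF, Finset.mem_filter] at hq
    have := q.2
    exact hc _ (by omega) (by omega)
  have hsub : {Y | pHat X c Y ≠ pHatStar X c σ Y} ⊆
      {Y | ε < |(sigmaHat X Y / σ) ^ 2 - 1|} ∪
        ⋃ q ∈ F, {Y | |(|T q Y|) - c ((q : ℕ) + 1)| ≤ c ((q : ℕ) + 1) * ε} := by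
    intro Y hY
    by_contra hcon
    simp only [Set.mem_union, Set.mem_iUnion, Set.mem_ofPred_eq, not_or, not_exists, not_lt,
      not_le] at hcon
    obtain ⟨h1, h2⟩ := hcon
    refine hY (selector_eq_of_forall hO hcO fun q hq => ?_)
    have hqF : q ∈ F := by simp [hF, hq]
    have h3 := h2 q hqF
    have hcpos := hcq q hqF
    have hξ := xi_pos hS q
    have hsh : 0 ≤ sigmaHat X Y := Real.sqrt_nonneg _
    set r := sigmaHat X Y / σ with hr
    have hr0 : 0 ≤ r := by positivity
    have hr1 : |r - 1| ≤ ε := by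
      have h4 : |r ^ 2 - 1| = |r - 1| * (r + 1) := by
        rw [show r ^ 2 - 1 = (r - 1) * (r + 1) by ring, abs_mul, abs_of_pos (by linarith : 0 < r + 1)]
      rw [h4] at h1
      nlinarith [abs_nonneg (r - 1)]
    -- Here `ε < 1` enters: it gives `σ̂ > 0`, needed to clear the denominator of the test
    -- statistic.
    have hrpos : 0 < r := by linarith [(abs_le.1 hr1).1]
    have hshpos : 0 < sigmaHat X Y := by
      by_contra h
      have h0 : sigmaHat X Y = 0 := le_antisymm (not_lt.1 h) hsh
      rw [hr, h0, zero_div] at hrpos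
      exact lt_irrefl _ hrpos
    have hx : |√(n : ℝ) * lastCoef X q Y| = |T q Y| * (σ * xi (gram X) q) := by
      simp only [hT]
      rw [abs_div, abs_of_pos (mul_pos hσ hξ), div_mul_cancel₀ _ (mul_pos hσ hξ).ne']
    rw [le_abs_testStat_iff hS hshpos, le_abs_testStat_iff hS hσ, hx]
    have e1 : c ((q : ℕ) + 1) * sigmaHat X Y * xi (gram X) q =
        c ((q : ℕ) + 1) * r * (σ * xi (gram X) q) := by
      rw [hr]; field_simp
    rw [e1, mul_assoc (c ((q : ℕ) + 1)) σ, mul_le_mul_iff_left₀ (mul_pos hσ hξ),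
      mul_le_mul_iff_left₀ (mul_pos hσ hξ)]
    have h5 : |c ((q : ℕ) + 1) * r - c ((q : ℕ) + 1)| ≤ c ((q : ℕ) + 1) * ε := by
      rw [show c ((q : ℕ) + 1) * r - c ((q : ℕ) + 1) = c ((q : ℕ) + 1) * (r - 1) by ring, abs_mul,
        abs_of_pos hcpos]
      exact mul_le_mul_of_nonneg_left hr1 hcpos.le
    have h6 := abs_le.1 h5
    constructor
    · intro h7
      by_contra h8
      rw [abs_of_neg (by linarith)] at h3
      linarith [h6.1]
    · intro h7
      by_contra h8
      rw [abs_of_nonneg (by linarith)] at h3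
      linarith [h6.2]
  refine (measureReal_mono hsub).trans ((measureReal_union_le _ _).trans (add_le_add
    (measureReal_sigmaHat_le hS hn θ hσ hε) ?_))
  refine (measureReal_biUnion_finset_le _ _).trans (Finset.sum_le_sum fun q hq => ?_)
  obtain ⟨m, hm⟩ := map_testStat hS (by omega) θ hσ q
  have hTm : Measurable (T q) := ((measurable_lastCoef X q).const_mul _).div_const _
  have h9 := gaussianReal_real_abs_abs_sub_le m (c ((q : ℕ) + 1))
    (mul_pos (hcq q hq) hε).le
  rw [← hm, map_measureReal_apply hTm (measurableSet_le (by fun_prop) measurable_const)] at h9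
  exact h9

lemma tendsto_measureReal_pHat_ne {X : (n : ℕ) → Matrix (Fin n) (Fin P) ℝ}
    (hX : ∀ n, P < n → (gram (X n)).PosDef) (hO : O ≤ P) (hcO : c O = 0)
    (hc : ∀ p, O < p → p ≤ P → 0 < c p) (θ : ℕ → Fin P → ℝ) {σ : ℕ → ℝ} (hσ : ∀ n, 0 < σ n) :
    Tendsto (fun n => (sampleMeasure (X n) (θ n) (σ n)).real
      {Y | pHat (X n) c Y ≠ pHatStar (X n) c (σ n) Y}) atTop (𝓝 0) := by
  set κ := Var[fun x : ℝ => x ^ 2; gaussianReal 0 1] with hκ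
  set C := ∑ q ∈ Finset.univ.filter (fun q : Fin P => O ≤ (q : ℕ)), 4 * c ((q : ℕ) + 1) with hC
  have hC0 : 0 ≤ C := Finset.sum_nonneg fun q hq => by
    simp only [Finset.mem_filter] at hq
    have := q.2
    have := hc ((q : ℕ) + 1) (by omega) (by omega)
    positivity
  have hlim : ∀ ε : ℝ, 0 < ε → Tendsto (fun n : ℕ => (n : ℝ) * κ / (ε * (n - P) / 2) ^ 2 +
      2 * P / (ε * (n - P) / 2)) atTop (𝓝 0) := by
    intro ε hε
    have h1 : Tendsto (fun n : ℕ => (n : ℝ) - P) atTop atTop :=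
      tendsto_atTop_add_const_right _ _ tendsto_natCast_atTop_atTop
    have h2 : Tendsto (fun n : ℕ => ((n : ℝ) - P)⁻¹) atTop (𝓝 0) := h1.inv_tendsto_atTop
    -- Both terms are rewritten in `(n - P)⁻¹`, using `n / (n - P) = 1 + P / (n - P)`.
    have h3 : Tendsto (fun n : ℕ => (1 + P * ((n : ℝ) - P)⁻¹) * ((n : ℝ) - P)⁻¹ * (4 * κ / ε ^ 2) +
        4 * P / ε * ((n : ℝ) - P)⁻¹) atTop
        (𝓝 ((1 + P * 0) * 0 * (4 * κ / ε ^ 2) + 4 * P / ε * 0)) :=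
      ((((h2.const_mul _).const_add 1).mul h2).mul_const _).add (h2.const_mul _)
    rw [mul_zero, zero_mul, mul_zero, add_zero] at h3
    refine h3.congr' ?_
    filter_upwards [eventually_gt_atTop P] with n hn
    have hm : ((n : ℝ) - P) ≠ 0 := by
      have : (P : ℝ) < n := by exact_mod_cast hn
      linarith [sub_pos.2 this]
    field_simp
    ring
  rw [Metric.tendsto_atTop']
  intro δ hδ
  -- The first bound keeps `ε < 1`, the second gives `C ε < δ`; the `C + 1` covers `C = 0`.
  set ε := min (1 / 2) (δ / (2 * (C + 1))) with hεdef
  have hε : 0 < ε := by positivity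
  have hε1 : ε < 1 := lt_of_le_of_lt (min_le_left _ _) (by norm_num)
  have hCε : C * ε < δ := by
    have h1 : ε ≤ δ / (2 * (C + 1)) := min_le_right _ _
    calc C * ε ≤ C * (δ / (2 * (C + 1))) := mul_le_mul_of_nonneg_left h1 hC0
      _ < δ := by
        rw [mul_div_assoc', div_lt_iff₀ (by positivity)]
        nlinarith
  have hev := (hlim ε hε).eventually (gt_mem_nhds (sub_pos.2 hCε))
  obtain ⟨N, hN⟩ := eventually_atTop.1 (hev.and (eventually_gt_atTop P))
  refine ⟨N, fun n hn => ?_⟩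
  obtain ⟨h1, h2⟩ := hN n hn.le
  have h3 := measureReal_pHat_ne_le (hX n h2) h2 hO hcO hc (θ n) (hσ n) hε hε1
  have h4 : ∑ q ∈ Finset.univ.filter (fun q : Fin P => O ≤ (q : ℕ)),
      4 * (c ((q : ℕ) + 1) * ε) = C * ε := by
    rw [hC, Finset.sum_mul]
    exact Finset.sum_congr rfl fun q _ => by ring
  rw [h4] at h3
  rw [Real.dist_eq, sub_zero, abs_of_nonneg measureReal_nonneg]
  linarith

end Agreement

end PostModelSelection

namespace PostModelSelection

/-! ### Asymptotics under local alternatives -/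

section Order

variable {P : ℕ}

lemma order_spec (θ : Fin P → ℝ) : order θ ≤ P ∧ θ ∈ model P (order θ) := by
  have h : (sInf {p : ℕ | p ≤ P ∧ θ ∈ model P p}) ∈ {p : ℕ | p ≤ P ∧ θ ∈ model P p} :=
    Nat.sInf_mem ⟨P, le_rfl, fun j hj => absurd j.2 (not_lt.2 hj)⟩
  exact h

lemma eq_zero_of_order_le {θ : Fin P → ℝ} {i : Fin P} (h : order θ ≤ (i : ℕ)) : θ i = 0 :=
  (order_spec θ).2 i h

lemma ne_zero_of_order_eq {θ : Fin P → ℝ} {j : Fin P} (h : order θ = (j : ℕ) + 1) : θ j ≠ 0 := by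
  intro h0
  have : order θ ≤ j := Nat.sInf_le ⟨j.2.le, fun i hi => by
    rcases hi.eq_or_lt with h1 | h1
    · rwa [← Fin.ext h1]
    · exact eq_zero_of_order_le (by omega)⟩
  omega

lemma sqrt_mul_localAlt (θ γ : Fin P → ℝ) {n : ℕ} (hn : 0 < n) (i : Fin P) :
    √(n : ℝ) * localAlt θ γ n i = √(n : ℝ) * θ i + γ i := by
  have : √(n : ℝ) ≠ 0 := by positivity
  simp only [localAlt, Pi.add_apply, Pi.smul_apply, smul_eq_mul]
  field_simp

lemma sqrt_mul_localAlt_of_order_le {θ : Fin P → ℝ} (γ : Fin P → ℝ) {n : ℕ} (hn : 0 < n)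
    {i : Fin P} (h : order θ ≤ (i : ℕ)) : √(n : ℝ) * localAlt θ γ n i = γ i := by
  rw [sqrt_mul_localAlt θ γ hn, eq_zero_of_order_le h, mul_zero, zero_add]

end Order

/-- The assumptions on the designs and on the standard deviations. -/
structure LocalDesign {P : ℕ} (X : (n : ℕ) → Matrix (Fin n) (Fin P) ℝ)
    (Q : Matrix (Fin P) (Fin P) ℝ) (σn : ℕ → ℝ) (σ : ℝ) : Prop where
  gram_posDef : ∀ n, P < n → (gram (X n)).PosDef
  tendsto_gram : Tendsto (fun n => gram (X n)) atTop (𝓝 Q)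
  posDef : Q.PosDef
  sigma_pos : ∀ n, 0 < σn n
  sigma_lim_pos : 0 < σ
  tendsto_sigma : Tendsto σn atTop (𝓝 σ)

namespace LocalDesign

variable {P k O : ℕ} {X : (n : ℕ) → Matrix (Fin n) (Fin P) ℝ} {Q : Matrix (Fin P) (Fin P) ℝ}
  {σn : ℕ → ℝ} {σ : ℝ} {c : ℕ → ℝ}

/-- The law of `√n (θ̃(p) - θ⁽ⁿ⁾)[p]`. -/
noncomputable def devLaw (X : (n : ℕ) → Matrix (Fin n) (Fin P) ℝ) (θ γ : Fin P → ℝ)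
    (σn : ℕ → ℝ) (p n : ℕ) : Measure ({j : Fin P // (j : ℕ) < p} → ℝ) :=
  (sampleMeasure (X n) (localAlt θ γ n) (σn n)).map (dev (X n) (localAlt θ γ n) p)

instance (θ γ : Fin P → ℝ) (p n : ℕ) : IsProbabilityMeasure (devLaw X θ γ σn p n) :=
  Measure.isProbabilityMeasure_map (measurable_dev _ _ _).aemeasurable

lemma isProbabilityMeasure_limNormal (h : LocalDesign X Q σn σ) (γ : Fin P → ℝ) (p : ℕ) :
    IsProbabilityMeasure (limNormal Q σ γ p) :=
  (limNormal_isNormal h.posDef σ γ p).isProbabilityMeasure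

/-- Past the order of `θ` the components of `√n θ⁽ⁿ⁾` equal those of `γ` exactly for each `n`, and
`delta` sees no others. Diverging components therefore do not affect the bias. -/
lemma delta_sqrt_localAlt (S : Matrix (Fin P) (Fin P) ℝ) {θ : Fin P → ℝ} (γ : Fin P → ℝ) {n p : ℕ}
    (hn : 0 < n) (hp : order θ ≤ p) :
    delta S (√(n : ℝ) • localAlt θ γ n) p = delta S γ p :=
  delta_congr S fun _ hi => sqrt_mul_localAlt_of_order_le γ hn (hp.trans hi)

lemma tendsto_threshold (h : LocalDesign X Q σn σ) (a : ℝ) (j : Fin P) :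
    Tendsto (fun n => a * σn n * xi (gram (X n)) j) atTop (𝓝 (a * σ * xi Q j)) :=
  (h.tendsto_sigma.const_mul a).mul (tendsto_xi h.tendsto_gram h.posDef j)

lemma tendsto_tvDist_dev (h : LocalDesign X Q σn σ) {θ : Fin P → ℝ} (γ : Fin P → ℝ) {p : ℕ}
    (hp : order θ ≤ p) :
    Tendsto (fun n => tvDist (devLaw X θ γ σn p n) (limNormal Q σ γ p)) atTop (𝓝 0) := by
  refine IsNormal.tendsto_tvDist (m := fun n => firstEntries (delta (gram (X n)) γ p) p)
    (S := fun n => σn n ^ 2 • (blockFF (gram (X n)) p)⁻¹) ?_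
    (limNormal_isNormal h.posDef σ γ p)
    ((blockFF_posDef h.posDef p).inv.smul (pow_pos h.sigma_lim_pos 2)) ?_ ?_
  · filter_upwards [eventually_gt_atTop P] with n hn
    have hS := h.gram_posDef n hn
    refine ⟨?_, (blockFF_posDef hS p).inv.smul (pow_pos (h.sigma_pos n) 2)⟩
    have := dev_isNormal hS (by omega) (localAlt θ γ n) (σn n) p
    rw [delta_sqrt_localAlt _ γ (by omega) hp] at this
    exact this
  · have := tendsto_delta h.tendsto_gram h.posDef γ p
    exact tendsto_pi_nhds.2 fun i => tendsto_pi_nhds.1 this i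
  · exact (h.tendsto_sigma.pow 2).smul (tendsto_blockFF_inv h.tendsto_gram h.posDef p)

/-- The error sequence is chosen before `s`. This uniformity later becomes uniformity over all sets
`B` pulled back to coefficient space. -/
lemma exists_error_rejection (h : LocalDesign X Q σn σ) (c : ℕ → ℝ) {θ : Fin P → ℝ}
    (γ : Fin P → ℝ) {j : Fin P} (hj : order θ ≤ (j : ℕ)) :
    ∃ ε : ℕ → ℝ, Tendsto ε atTop (𝓝 0) ∧ ∀ᶠ n in atTop, ∀ s, MeasurableSet s →
      |(devLaw X θ γ σn ((j : ℕ) + 1) n).real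
          (s ∩ {d | c ((j : ℕ) + 1) * σn n * xi (gram (X n)) j ≤ |d (lastIdx j) + γ j|}) -
        (limNormal Q σ γ ((j : ℕ) + 1)).real
          (s ∩ {d | c ((j : ℕ) + 1) * σ * xi Q j ≤ |d (lastIdx j) + γ j|})| ≤ ε n := by
  have := h.isProbabilityMeasure_limNormal γ ((j : ℕ) + 1)
  exact exists_tendsto_zero_of_tvDist_threshold (Eventually.of_forall fun n => inferInstance)
    (h.tendsto_tvDist_dev γ (by omega)) (by fun_prop) (h.tendsto_threshold _ j)
    (limNormal_abs_eq_null h.posDef h.sigma_lim_pos γ j _)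

lemma acceptProb_eq (θ γ : Fin P → ℝ) (n : ℕ) (j : Fin P) :
    acceptProb (X n) c (localAlt θ γ n) (σn n) j = (devLaw X θ γ σn ((j : ℕ) + 1) n).real
      {d | |d (lastIdx j) + √(n : ℝ) * localAlt θ γ n j| <
        c ((j : ℕ) + 1) * σn n * xi (gram (X n)) j} := by
  rw [devLaw, map_measureReal_apply (measurable_dev _ _ _)
    (measurableSet_lt (by fun_prop) measurable_const), acceptProb]
  congr 1
  ext Y
  simp only [Set.mem_preimage, Set.mem_ofPred_eq, sqrt_mul_lastCoef (localAlt θ γ n)]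

lemma tendsto_acceptProb (h : LocalDesign X Q σn σ) (c : ℕ → ℝ) {θ : Fin P → ℝ}
    (γ : Fin P → ℝ) {j : Fin P} (hj : order θ ≤ (j : ℕ)) :
    Tendsto (fun n => acceptProb (X n) c (localAlt θ γ n) (σn n) j) atTop
      (𝓝 (accept Q c σ γ j)) := by
  obtain ⟨ε, hε, hev⟩ := h.exists_error_rejection c γ hj
  rw [tendsto_iff_norm_sub_tendsto_zero]
  refine squeeze_zero' (Eventually.of_forall fun n => norm_nonneg _) ?_ hε
  filter_upwards [hev, eventually_gt_atTop P] with n hn hnP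
  have h1 := hn Set.univ MeasurableSet.univ
  rw [Set.univ_inter, Set.univ_inter, one_sub_accept h.posDef] at h1
  have h2 : acceptProb (X n) c (localAlt θ γ n) (σn n) j =
      1 - (devLaw X θ γ σn ((j : ℕ) + 1) n).real
        {d | c ((j : ℕ) + 1) * σn n * xi (gram (X n)) j ≤ |d (lastIdx j) + γ j|} := by
    rw [acceptProb_eq, sqrt_mul_localAlt_of_order_le γ (by omega) hj,
      ← probReal_compl_eq_one_sub (measurableSet_le measurable_const (by fun_prop))]
    congr 1
    ext d
    simp
  rw [h2, Real.norm_eq_abs, abs_sub_comm]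
  refine le_trans (le_of_eq ?_) h1
  congr 1
  ring

/-- The last component of `θ` within its order is non-zero, so the shift `√n θ_j` diverges while the
law of the deviation converges in total variation. Each fixed deviation eventually leaves the
acceptance region. -/
lemma tendsto_acceptProb_zero (h : LocalDesign X Q σn σ) (c : ℕ → ℝ) {θ : Fin P → ℝ}
    (γ : Fin P → ℝ) {j : Fin P} (hj : order θ = (j : ℕ) + 1) :
    Tendsto (fun n => acceptProb (X n) c (localAlt θ γ n) (σn n) j) atTop (𝓝 0) := by
  have := h.isProbabilityMeasure_limNormal γ ((j : ℕ) + 1)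
  simp only [acceptProb_eq]
  refine tendsto_measureReal_zero_of_tvDist (Eventually.of_forall fun n => inferInstance)
    (h.tendsto_tvDist_dev γ hj.le) (fun n => measurableSet_lt (by fun_prop) measurable_const)
    fun d => ?_
  have hθ : 0 < |θ j| := abs_pos.2 (ne_zero_of_order_eq hj)
  have h1 : Tendsto (fun n : ℕ => √(n : ℝ) * |θ j| - |d (lastIdx j) + γ j|) atTop atTop :=
    tendsto_atTop_add_const_right _ _
      ((Real.tendsto_sqrt_atTop.comp tendsto_natCast_atTop_atTop).atTop_mul_const hθ)
  have h2 := h.tendsto_threshold (c ((j : ℕ) + 1)) j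
  filter_upwards [h1.eventually_ge_atTop (c ((j : ℕ) + 1) * σ * xi Q j + 1),
    h2.eventually (gt_mem_nhds (lt_add_one _)), eventually_gt_atTop 0] with n hn1 hn2 hn3
  simp only [not_lt]
  rw [sqrt_mul_localAlt θ γ hn3]
  have h3 : √(n : ℝ) * |θ j| = |√(n : ℝ) * θ j| := by
    rw [abs_mul, abs_of_nonneg (Real.sqrt_nonneg _)]
  have h4 : |√(n : ℝ) * θ j| ≤ |d (lastIdx j) + (√(n : ℝ) * θ j + γ j)| +
      |d (lastIdx j) + γ j| := by
    have := abs_sub (d (lastIdx j) + (√(n : ℝ) * θ j + γ j)) (d (lastIdx j) + γ j)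
    rwa [show d (lastIdx j) + (√(n : ℝ) * θ j + γ j) - (d (lastIdx j) + γ j) =
      √(n : ℝ) * θ j by ring] at this
  linarith

/-- The probability that the test for the order `p_*` accepts. -/
noncomputable def missProb (X : (n : ℕ) → Matrix (Fin n) (Fin P) ℝ) (c : ℕ → ℝ) (O : ℕ)
    (θ γ : Fin P → ℝ) (σn : ℕ → ℝ) (n : ℕ) : ℝ :=
  (sampleMeasure (X n) (localAlt θ γ n) (σn n)).real
    {Y | |testStat (X n) (σn n) Y (max (order θ) O)| < c (max (order θ) O)}

/-- If `p_* = O`, the critical value is zero and acceptance is impossible. Otherwise `p_*` is the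
order of `θ`, where the noncentrality diverges. -/
lemma tendsto_missProb (h : LocalDesign X Q σn σ) (hcO : c O = 0) (θ γ : Fin P → ℝ) :
    Tendsto (missProb X c O θ γ σn) atTop (𝓝 0) := by
  rcases le_or_gt (order θ) O with hle | hlt
  · have : missProb X c O θ γ σn = fun _ => 0 := by
      funext n
      rw [missProb, max_eq_right hle, hcO]
      have : {Y | |testStat (X n) (σn n) Y O| < 0} = ∅ := by
        ext Y
        simp
      rw [this, measureReal_empty]
    rw [this]
    exact tendsto_const_nhds
  · obtain ⟨j, hj⟩ : ∃ j : Fin P, order θ = (j : ℕ) + 1 :=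
      ⟨⟨order θ - 1, by have := (order_spec θ).1; omega⟩, by simp only; omega⟩
    refine (h.tendsto_acceptProb_zero c γ hj).congr' ?_
    filter_upwards [eventually_gt_atTop P] with n hn
    rw [missProb, max_eq_left hlt.le, hj, acceptProb]
    congr 1
    ext Y
    simp only [Set.mem_ofPred_eq, ← not_le, le_abs_testStat_iff (h.gram_posDef n hn) (h.sigma_pos n)]

/-- The probability that the order `p` is selected and `√n A (θ̃(p) - θ⁽ⁿ⁾)` is in `B`. -/
noncomputable def pieceProb (X : (n : ℕ) → Matrix (Fin n) (Fin P) ℝ) (c : ℕ → ℝ)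
    (A : Matrix (Fin k) (Fin P) ℝ) (θ γ : Fin P → ℝ) (σn : ℕ → ℝ) (p n : ℕ)
    (B : Set (Fin k → ℝ)) : ℝ :=
  (sampleMeasure (X n) (localAlt θ γ n) (σn n)).real
    {Y | scaledErr (X n) A (localAlt θ γ n) p Y ∈ B ∧ pHatStar (X n) c (σn n) Y = p}

lemma scaledErr_localAlt (A : Matrix (Fin k) (Fin P) ℝ) {θ : Fin P → ℝ} (γ : Fin P → ℝ) {n p : ℕ}
    (hn : 0 < n) (hp : order θ ≤ p) (Y : Fin n → ℝ) :
    scaledErr (X n) A (localAlt θ γ n) p Y =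
      A *ᵥ extendNeg γ p (dev (X n) (localAlt θ γ n) p Y) := by
  rw [scaledErr_eq, extendNeg_congr fun i hi =>
    (show (√(n : ℝ) • localAlt θ γ n) i = γ i from
      sqrt_mul_localAlt_of_order_le γ hn (hp.trans hi))]

lemma measurable_mulVec_extendNeg (A : Matrix (Fin k) (Fin P) ℝ) (γ : Fin P → ℝ) (p : ℕ) :
    Measurable fun d => A *ᵥ extendNeg γ p d :=
  ((show Continuous fun v : Fin P → ℝ => A *ᵥ v by fun_prop).comp
    (continuous_extendNeg γ p)).measurable

/-- Rejection at this order is a condition on the last coordinate of the same deviation vector, so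
it joins the event for the estimator, while the acceptances split off as a product. -/
lemma pieceProb_succ (h : LocalDesign X Q σn σ) (hO : O ≤ P) (hcO : c O = 0)
    (A : Matrix (Fin k) (Fin P) ℝ) {θ : Fin P → ℝ} (γ : Fin P → ℝ) {j : Fin P}
    (hj : order θ ≤ (j : ℕ)) {n : ℕ} (hn : P < n) {B : Set (Fin k → ℝ)} (hB : MeasurableSet B) :
    pieceProb X c A θ γ σn ((j : ℕ) + 1) n B =
      (devLaw X θ γ σn ((j : ℕ) + 1) n).real
          ({d | A *ᵥ extendNeg γ ((j : ℕ) + 1) d ∈ B} ∩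
            {d | c ((j : ℕ) + 1) * σn n * xi (gram (X n)) j ≤ |d (lastIdx j) + γ j|}) *
        ∏ q ∈ Finset.Ioi j, acceptProb (X n) c (localAlt θ γ n) (σn n) q := by
  have hS := h.gram_posDef n hn
  have hIoi : Finset.Ioi j = Finset.univ.filter fun q : Fin P => (j : ℕ) + 1 ≤ (q : ℕ) := by
    ext q
    simp only [Finset.mem_Ioi, Finset.mem_filter, Finset.mem_univ, true_and, Fin.lt_def]
    omega
  have hBm : MeasurableSet ({d | A *ᵥ extendNeg γ ((j : ℕ) + 1) d ∈ B} ∩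
      {d | c ((j : ℕ) + 1) * σn n * xi (gram (X n)) j ≤ |d (lastIdx j) + γ j|}) :=
    (measurable_mulVec_extendNeg A γ _ hB).inter (measurableSet_le measurable_const (by fun_prop))
  rw [hIoi]
  refine Eq.trans ?_ (measureReal_dev_accept (c := c) hS (by omega) (localAlt θ γ n)
    (h.sigma_pos n) ((j : ℕ) + 1) hBm)
  rw [pieceProb]
  congr 1
  ext Y
  have hjP := j.2
  simp only [Set.mem_ofPred_eq, Set.mem_inter_iff, pHatStar, selector_eq_iff hO hcO
    (show (j : ℕ) + 1 ≤ P by omega), scaledErr_localAlt A γ (show 0 < n by omega)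
    (show order θ ≤ (j : ℕ) + 1 by omega), le_abs_testStat_iff hS (h.sigma_pos n),
    sqrt_mul_lastCoef (localAlt θ γ n),
    sqrt_mul_localAlt_of_order_le γ (show 0 < n by omega) hj, and_assoc]

lemma abs_mul_sub_mul_le {a a' b b' : ℝ} (hb : b ∈ Set.Icc (0 : ℝ) 1)
    (ha' : a' ∈ Set.Icc (0 : ℝ) 1) : |a * b - a' * b'| ≤ |a - a'| + |b - b'| := by
  have e : a * b - a' * b' = (a - a') * b + a' * (b - b') := by ring
  rw [e]
  refine (abs_add_le _ _).trans (add_le_add ?_ ?_)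
  · rw [abs_mul, abs_of_nonneg hb.1]
    exact mul_le_of_le_one_right (abs_nonneg _) hb.2
  · rw [abs_mul, abs_of_nonneg ha'.1]
    exact mul_le_of_le_one_left (abs_nonneg _) ha'.2

lemma prod_acceptProb_mem (X : (n : ℕ) → Matrix (Fin n) (Fin P) ℝ) (c : ℕ → ℝ) (θ : Fin P → ℝ)
    (s : ℝ) (n : ℕ) (F : Finset (Fin P)) :
    ∏ q ∈ F, acceptProb (X n) c θ s q ∈ Set.Icc (0 : ℝ) 1 :=
  ⟨Finset.prod_nonneg fun _ _ => measureReal_nonneg,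
    Finset.prod_le_one (fun _ _ => measureReal_nonneg) fun _ _ => measureReal_le_one⟩

lemma tendsto_prod_acceptProb (h : LocalDesign X Q σn σ) (c : ℕ → ℝ) {θ : Fin P → ℝ}
    (γ : Fin P → ℝ) (F : Finset (Fin P)) (hF : ∀ q ∈ F, order θ ≤ (q : ℕ)) :
    Tendsto (fun n => |∏ q ∈ F, acceptProb (X n) c (localAlt θ γ n) (σn n) q -
      ∏ q ∈ F, accept Q c σ γ q|) atTop (𝓝 0) := by
  have := tendsto_finsetProd F fun q hq => h.tendsto_acceptProb c γ (hF q hq)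
  have h2 := (this.sub_const (∏ q ∈ F, accept Q c σ γ q)).abs
  simpa using h2

lemma exists_error_piece_succ (h : LocalDesign X Q σn σ) (hO : O ≤ P) (hcO : c O = 0)
    (A : Matrix (Fin k) (Fin P) ℝ) {θ : Fin P → ℝ} (γ : Fin P → ℝ) {j : Fin P}
    (hj : order θ ≤ (j : ℕ)) :
    ∃ ε : ℕ → ℝ, Tendsto ε atTop (𝓝 0) ∧ ∀ᶠ n in atTop, ∀ B, MeasurableSet B →
      |pieceProb X c A θ γ σn ((j : ℕ) + 1) n B -
        (limNormal Q σ γ ((j : ℕ) + 1)).real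
          ({d | A *ᵥ extendNeg γ ((j : ℕ) + 1) d ∈ B} ∩
            {d | c ((j : ℕ) + 1) * σ * xi Q j ≤ |d (lastIdx j) + γ j|}) *
        ∏ q ∈ Finset.Ioi j, accept Q c σ γ q| ≤ ε n := by
  have := h.isProbabilityMeasure_limNormal γ ((j : ℕ) + 1)
  obtain ⟨ε, hε, hev⟩ := h.exists_error_rejection c γ hj
  have hprod := h.tendsto_prod_acceptProb (θ := θ) c γ (Finset.Ioi j) fun q hq => by
    have := Fin.lt_def.1 (Finset.mem_Ioi.1 hq)
    omega
  refine ⟨_, by simpa using hε.add hprod, ?_⟩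
  filter_upwards [hev, eventually_gt_atTop P] with n hn hnP B hB
  rw [h.pieceProb_succ hO hcO A γ hj hnP hB]
  refine (abs_mul_sub_mul_le (prod_acceptProb_mem _ _ _ _ _ _)
    ⟨measureReal_nonneg, measureReal_le_one⟩).trans ?_
  exact add_le_add (hn _ (measurable_mulVec_extendNeg A γ _ hB)) le_rfl

/-- At `p_*` the rejection requirement is dropped at the cost of `missProb`. What remains is the
estimator's event and the acceptances above, which are independent. -/
lemma exists_error_piece_self (h : LocalDesign X Q σn σ) (hO : O ≤ P) (hcO : c O = 0)
    (A : Matrix (Fin k) (Fin P) ℝ) (θ γ : Fin P → ℝ) :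
    ∃ ε : ℕ → ℝ, Tendsto ε atTop (𝓝 0) ∧ ∀ᶠ n in atTop, ∀ B, MeasurableSet B →
      |pieceProb X c A θ γ σn (max (order θ) O) n B -
        (limNormal Q σ γ (max (order θ) O)).real
          {d | A *ᵥ extendNeg γ (max (order θ) O) d ∈ B} *
        ∏ q ∈ Finset.univ.filter (fun q : Fin P => max (order θ) O ≤ (q : ℕ)),
          accept Q c σ γ q| ≤ ε n := by
  set ps := max (order θ) O with hps
  have hpsP : ps ≤ P := max_le (order_spec θ).1 hO
  have := h.isProbabilityMeasure_limNormal γ ps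
  have hprod := h.tendsto_prod_acceptProb c γ
    (Finset.univ.filter (fun q : Fin P => ps ≤ (q : ℕ))) fun q hq =>
      (le_max_left _ _).trans (Finset.mem_filter.1 hq).2
  refine ⟨_, by simpa using ((h.tendsto_missProb hcO θ γ).add
    (h.tendsto_tvDist_dev γ (le_max_left (order θ) O))).add hprod, ?_⟩
  filter_upwards [eventually_gt_atTop P] with n hnP B hB
  have hS := h.gram_posDef n hnP
  have hBm := measurable_mulVec_extendNeg A γ ps hB
  have h1 := measureReal_dev_accept (c := c) hS (by omega) (localAlt θ γ n) (h.sigma_pos n) ps hBm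
  set μ := sampleMeasure (X n) (localAlt θ γ n) (σn n) with hμ
  set E := {Y | dev (X n) (localAlt θ γ n) ps Y ∈ (fun d => A *ᵥ extendNeg γ ps d) ⁻¹' B ∧
    ∀ q : Fin P, ps ≤ (q : ℕ) →
      |testStat (X n) (σn n) Y ((q : ℕ) + 1)| < c ((q : ℕ) + 1)} with hE
  have h2 : |pieceProb X c A θ γ σn ps n B - μ.real E| ≤ missProb X c O θ γ σn n := by
    have hiff : ∀ Y, (scaledErr (X n) A (localAlt θ γ n) ps Y ∈ B ∧
        pHatStar (X n) c (σn n) Y = ps) ↔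
        Y ∈ E ∧ c ps ≤ |testStat (X n) (σn n) Y ps| := by
      intro Y
      rw [pHatStar, selector_eq_iff hO hcO hpsP, scaledErr_localAlt A γ (show 0 < n by omega)
        (le_max_left _ _)]
      simp only [hE, Set.mem_ofPred_eq, Set.mem_preimage, hps]
      tauto
    have hle : pieceProb X c A θ γ σn ps n B ≤ μ.real E :=
      measureReal_mono fun Y hY => ((hiff Y).1 hY).1
    have hge : μ.real E ≤ pieceProb X c A θ γ σn ps n B + missProb X c O θ γ σn n := by
      refine (measureReal_mono (fun Y hY => ?_)).trans (measureReal_union_le _ _)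
      by_cases hc : c ps ≤ |testStat (X n) (σn n) Y ps|
      · exact Or.inl ((hiff Y).2 ⟨hY, hc⟩)
      · exact Or.inr (not_le.1 hc)
    rw [abs_of_nonpos (by linarith)]
    linarith
  have h3 := abs_sub_le_tvDist (devLaw X θ γ σn ps n) (limNormal Q σ γ ps) hBm
  have h4 := abs_mul_sub_mul_le (a := (devLaw X θ γ σn ps n).real
      ((fun d => A *ᵥ extendNeg γ ps d) ⁻¹' B)) (b' := ∏ q ∈ Finset.univ.filter
        (fun q : Fin P => ps ≤ (q : ℕ)), accept Q c σ γ q)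
    (prod_acceptProb_mem X c (localAlt θ γ n) (σn n) n
      (Finset.univ.filter (fun q : Fin P => ps ≤ (q : ℕ))))
    (show (limNormal Q σ γ ps).real ((fun d => A *ᵥ extendNeg γ ps d) ⁻¹' B) ∈ Set.Icc (0 : ℝ) 1
      from ⟨measureReal_nonneg, measureReal_le_one⟩)
  have h5 : μ.real E = (devLaw X θ γ σn ps n).real ((fun d => A *ᵥ extendNeg γ ps d) ⁻¹' B) *
      ∏ q ∈ Finset.univ.filter (fun q : Fin P => ps ≤ (q : ℕ)),
        acceptProb (X n) c (localAlt θ γ n) (σn n) q := h1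
  rw [← h5] at h4
  refine (abs_sub_le _ (μ.real E) _).trans ?_
  have h6 := h4.trans (add_le_add_left h3 _)
  rw [add_assoc]
  exact add_le_add h2 h6

/-- The selector takes the largest rejecting order, so a choice below `p_*` forces acceptance at
`p_*`. -/
lemma pieceProb_le_missProb (hO : O ≤ P) (A : Matrix (Fin k) (Fin P) ℝ)
    (θ γ : Fin P → ℝ) {p : ℕ} (hp : p < max (order θ) O) (n : ℕ) (B : Set (Fin k → ℝ)) :
    pieceProb X c A θ γ σn p n B ≤ missProb X c O θ γ σn n := by
  refine measureReal_mono fun Y hY => ?_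
  by_contra hcon
  have h1 : p = pHatStar (X n) c (σn n) Y := hY.2.symm
  have h2 := le_selector (X := X n) (max_le (order_spec θ).1 hO) (not_lt.1 hcon)
  rw [pHatStar] at h1
  omega

end LocalDesign

end PostModelSelection

namespace PostModelSelection

/-! ### The limit measure and the main result -/

section LimitMeasure

variable {P k : ℕ} {Q : Matrix (Fin P) (Fin P) ℝ}

/-- The limit law of `√n A (θ̃ - θ⁽ⁿ⁾)`. -/
noncomputable def limMeasure (Q : Matrix (Fin P) (Fin P) ℝ) (A : Matrix (Fin k) (Fin P) ℝ)
    (c : ℕ → ℝ) (σ : ℝ) (ψ : Fin P → ℝ) (ps : ℕ) : Measure (Fin k → ℝ) :=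
  ENNReal.ofReal (∏ q ∈ Finset.univ.filter (fun q : Fin P => ps ≤ (q : ℕ)), accept Q c σ ψ q) •
      (limNormal Q σ ψ ps).map (fun d => A *ᵥ extendNeg ψ ps d) +
    ∑ j ∈ Finset.univ.filter (fun j : Fin P => ps ≤ (j : ℕ)),
      ENNReal.ofReal (∏ q ∈ Finset.Ioi j, accept Q c σ ψ q) •
        ((limNormal Q σ ψ ((j : ℕ) + 1)).restrict
          {d | c ((j : ℕ) + 1) * σ * xi Q j ≤ |d (lastIdx j) + ψ j|}).map
          (fun d => A *ᵥ extendNeg ψ ((j : ℕ) + 1) d)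

lemma accept_nonneg (c : ℕ → ℝ) (σ : ℝ) (ψ : Fin P → ℝ) (j : Fin P) : 0 ≤ accept Q c σ ψ j :=
  measureReal_nonneg

lemma limMeasure_isFiniteMeasure (hQ : Q.PosDef) (A : Matrix (Fin k) (Fin P) ℝ)
    (c : ℕ → ℝ) (σ : ℝ) (ψ : Fin P → ℝ) (ps : ℕ) :
    IsFiniteMeasure (limMeasure Q A c σ ψ ps) := by
  have (p : ℕ) : IsProbabilityMeasure (limNormal Q σ ψ p) :=
    (limNormal_isNormal hQ σ ψ p).isProbabilityMeasure
  constructor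
  rw [limMeasure, Measure.add_apply, Measure.finsetSum_apply]
  simp only [Measure.smul_apply, smul_eq_mul]
  exact ENNReal.add_lt_top.2 ⟨ENNReal.mul_lt_top ENNReal.ofReal_lt_top (measure_lt_top _ _),
    ENNReal.sum_lt_top.2 fun j _ => ENNReal.mul_lt_top ENNReal.ofReal_lt_top (measure_lt_top _ _)⟩

lemma limMeasure_real (hQ : Q.PosDef) (A : Matrix (Fin k) (Fin P) ℝ)
    (c : ℕ → ℝ) (σ : ℝ) (ψ : Fin P → ℝ) (ps : ℕ) {B : Set (Fin k → ℝ)} (hB : MeasurableSet B) :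
    (limMeasure Q A c σ ψ ps).real B =
      (limNormal Q σ ψ ps).real {d | A *ᵥ extendNeg ψ ps d ∈ B} *
        ∏ q ∈ Finset.univ.filter (fun q : Fin P => ps ≤ (q : ℕ)), accept Q c σ ψ q +
      ∑ j ∈ Finset.univ.filter (fun j : Fin P => ps ≤ (j : ℕ)),
        (limNormal Q σ ψ ((j : ℕ) + 1)).real
          ({d | A *ᵥ extendNeg ψ ((j : ℕ) + 1) d ∈ B} ∩
            {d | c ((j : ℕ) + 1) * σ * xi Q j ≤ |d (lastIdx j) + ψ j|}) *
        ∏ q ∈ Finset.Ioi j, accept Q c σ ψ q := by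
  have (p : ℕ) : IsProbabilityMeasure (limNormal Q σ ψ p) :=
    (limNormal_isNormal hQ σ ψ p).isProbabilityMeasure
  have hm (p : ℕ) : Measurable fun d => A *ᵥ extendNeg ψ p d :=
    LocalDesign.measurable_mulVec_extendNeg A ψ p
  have hprod (F : Finset (Fin P)) : 0 ≤ ∏ q ∈ F, accept Q c σ ψ q :=
    Finset.prod_nonneg fun q _ => accept_nonneg c σ ψ q
  rw [limMeasure, Measure.real, Measure.add_apply, Measure.finsetSum_apply]
  simp only [Measure.smul_apply, smul_eq_mul]
  rw [ENNReal.toReal_add (ENNReal.mul_ne_top ENNReal.ofReal_ne_top (measure_ne_top _ _))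
    (ENNReal.sum_ne_top.2 fun j _ => ENNReal.mul_ne_top ENNReal.ofReal_ne_top
      (measure_ne_top _ _)), ENNReal.toReal_sum fun j _ =>
      ENNReal.mul_ne_top ENNReal.ofReal_ne_top (measure_ne_top _ _)]
  simp only [ENNReal.toReal_mul, ENNReal.toReal_ofReal (hprod _), Measure.map_apply (hm _) hB,
    Measure.restrict_apply (hm _ hB), mul_comm (∏ q ∈ _, accept Q c σ ψ q)]
  rfl

lemma limMeasure_real_Iic (hQ : Q.PosDef) (A : Matrix (Fin k) (Fin P) ℝ)
    {B : Fin P → Matrix (Fin k) (Fin k) ℝ}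
    (hB : ∀ j : Fin P, IsGenInverse (covMat Q A ((j : ℕ) + 1)) (B j))
    (c : ℕ → ℝ) (σ : ℝ) (ψ : Fin P → ℝ) (ps : ℕ) (t : Fin k → ℝ) :
    (limMeasure Q A c σ ψ ps).real (Set.Iic t) = limitCdf Q A B c σ ψ ps t := by
  rw [limMeasure_real hQ A c σ ψ ps measurableSet_Iic, limitCdf, limNormal_real_Iic hQ]
  simp only [limNormal_real_Iic_inter hQ (hB _)]

end LimitMeasure

/-! ### Sums over model orders and uniform errors of finite sums. -/

section Sums

lemma sum_range_eq_add_sum_fin {P ps : ℕ} (h : ps ≤ P) (f : ℕ → ℝ) :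
    ∑ p ∈ Finset.range (P + 1), f p = ∑ p ∈ Finset.range ps, f p +
      (f ps + ∑ j ∈ Finset.univ.filter (fun j : Fin P => ps ≤ (j : ℕ)), f ((j : ℕ) + 1)) := by
  rw [← Finset.sum_range_add_sum_Ico f (show ps ≤ P + 1 by omega),
    Finset.sum_eq_sum_Ico_succ_bot (show ps < P + 1 by omega)]
  congr 2
  symm
  refine Finset.sum_nbij (fun j : Fin P => (j : ℕ) + 1) ?_ ?_ ?_ fun _ _ => rfl
  · intro j hj
    have := (Finset.mem_filter.1 hj).2
    simp only [Finset.mem_Ico]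
    omega
  · intro i _ j _ hij
    exact Fin.ext (by simpa using hij)
  · intro p hp
    simp only [Finset.coe_Ico, Set.mem_Ico] at hp
    refine ⟨⟨p - 1, by omega⟩, ?_, ?_⟩
    · simp only [Finset.coe_filter, Finset.mem_univ, true_and, Set.mem_ofPred_eq]
      omega
    · simp only
      omega

lemma exists_error_sum {ι β : Type*} (F : Finset ι) (S : Set β) {f : ι → ℕ → β → ℝ}
    {g : ι → β → ℝ}
    (h : ∀ i ∈ F, ∃ ε : ℕ → ℝ, Tendsto ε atTop (𝓝 0) ∧ ∀ᶠ n in atTop, ∀ b ∈ S,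
      |f i n b - g i b| ≤ ε n) :
    ∃ ε : ℕ → ℝ, Tendsto ε atTop (𝓝 0) ∧ ∀ᶠ n in atTop, ∀ b ∈ S,
      |∑ i ∈ F, f i n b - ∑ i ∈ F, g i b| ≤ ε n := by
  choose! ε hε hev using h
  refine ⟨fun n => ∑ i ∈ F, ε i n, by simpa using tendsto_finsetSum F hε, ?_⟩
  filter_upwards [(eventually_all_finset F).2 hev] with n hn b hb
  rw [← Finset.sum_sub_distrib]
  exact (Finset.abs_sum_le_sum_abs _ _).trans (Finset.sum_le_sum fun i hi => hn i hi b hb)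

end Sums

namespace LocalDesign

variable {P k O : ℕ} {X : (n : ℕ) → Matrix (Fin n) (Fin P) ℝ} {Q : Matrix (Fin P) (Fin P) ℝ}
  {σn : ℕ → ℝ} {σ : ℝ} {c : ℕ → ℝ}

lemma exists_error_lawGStar (h : LocalDesign X Q σn σ) (hO : O ≤ P) (hcO : c O = 0)
    (A : Matrix (Fin k) (Fin P) ℝ) (θ γ : Fin P → ℝ) :
    ∃ ε : ℕ → ℝ, Tendsto ε atTop (𝓝 0) ∧ ∀ᶠ n in atTop, ∀ B, MeasurableSet B →
      |(lawGStar (X n) c A (localAlt θ γ n) (σn n)).real B -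
        (limMeasure Q A c σ γ (max (order θ) O)).real B| ≤ ε n := by
  set ps := max (order θ) O with hps
  have hpsP : ps ≤ P := max_le (order_spec θ).1 hO
  obtain ⟨ε₁, hε₁, hev₁⟩ := h.exists_error_piece_self hO hcO A θ γ
  obtain ⟨ε₂, hε₂, hev₂⟩ := exists_error_sum
    (Finset.univ.filter (fun j : Fin P => ps ≤ (j : ℕ))) {B : Set (Fin k → ℝ) | MeasurableSet B}
    fun j hj => h.exists_error_piece_succ (θ := θ) hO hcO A γ
      ((le_max_left _ _).trans (Finset.mem_filter.1 hj).2)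
  -- Each of the `ps` orders below `p_*` contributes at most `missProb`; the other two errors belong
  -- to `p_*` itself and to the larger orders.
  refine ⟨fun n => ps * missProb X c O θ γ σn n + (ε₁ n + ε₂ n), ?_, ?_⟩
  · simpa using ((h.tendsto_missProb hcO θ γ).const_mul (ps : ℝ)).add (hε₁.add hε₂)
  filter_upwards [hev₁, hev₂] with n hn₁ hn₂ B hB
  have e : (lawGStar (X n) c A (localAlt θ γ n) (σn n)).real B =
      ∑ p ∈ Finset.range (P + 1), pieceProb X c A θ γ σn p n B :=
    lawGStar_real_eq_sum hO hcO A _ _ hB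
  rw [e, sum_range_eq_add_sum_fin hpsP, limMeasure_real h.posDef A c σ γ ps hB, add_sub_assoc,
    add_sub_add_comm]
  refine (abs_add_le _ _).trans (add_le_add ?_ ((abs_add_le _ _).trans
    (add_le_add (hn₁ B hB) (hn₂ B hB))))
  have hnonneg : 0 ≤ ∑ p ∈ Finset.range ps, pieceProb X c A θ γ σn p n B :=
    Finset.sum_nonneg fun p _ => measureReal_nonneg
  rw [abs_of_nonneg hnonneg]
  refine (Finset.sum_le_card_nsmul _ _ (missProb X c O θ γ σn n) fun p hp =>
    pieceProb_le_missProb hO A θ γ (Finset.mem_range.1 hp) n B).trans (le_of_eq ?_)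
  rw [Finset.card_range, nsmul_eq_mul]

/-- The total mass is a limit of masses equal to one, which avoids telescoping the products of
acceptance probabilities. -/
lemma isProbabilityMeasure_limMeasure (h : LocalDesign X Q σn σ) (hO : O ≤ P) (hcO : c O = 0)
    (A : Matrix (Fin k) (Fin P) ℝ) (θ γ : Fin P → ℝ) :
    IsProbabilityMeasure (limMeasure Q A c σ γ (max (order θ) O)) := by
  obtain ⟨ε, hε, hev⟩ := h.exists_error_lawGStar hO hcO A θ γ
  have := limMeasure_isFiniteMeasure h.posDef A c σ γ (max (order θ) O)
  have h1 : |1 - (limMeasure Q A c σ γ (max (order θ) O)).real Set.univ| ≤ 0 := by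
    refine ge_of_tendsto hε ?_
    filter_upwards [hev] with n hn
    simpa using hn Set.univ MeasurableSet.univ
  have h2 : (limMeasure Q A c σ γ (max (order θ) O)).real Set.univ = 1 := by
    have := abs_nonpos_iff.1 h1
    linarith
  exact ⟨by rwa [Measure.real, ENNReal.toReal_eq_one_iff] at h2⟩

lemma tendstoTV_lawGStar (h : LocalDesign X Q σn σ) (hO : O ≤ P) (hcO : c O = 0)
    (A : Matrix (Fin k) (Fin P) ℝ) {B : Fin P → Matrix (Fin k) (Fin k) ℝ}
    (hB : ∀ j : Fin P, IsGenInverse (covMat Q A ((j : ℕ) + 1)) (B j)) (θ γ : Fin P → ℝ) :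
    TendstoTV (fun n => lawGStar (X n) c A (localAlt θ γ n) (σn n))
      (limitCdf Q A B c σ γ (max (order θ) O)) := by
  obtain ⟨ε, hε, hev⟩ := h.exists_error_lawGStar hO hcO A θ γ
  refine ⟨_, h.isProbabilityMeasure_limMeasure hO hcO A θ γ,
    limMeasure_real_Iic h.posDef A hB c σ γ _, ?_⟩
  refine squeeze_zero' (Eventually.of_forall fun n => tvDist_nonneg _ _) ?_ hε
  filter_upwards [hev] with n hn
  exact tvDist_le hn

end LocalDesign

lemma abs_measureReal_sub_le {α : Type*} [MeasurableSpace α] (μ : Measure α) [IsFiniteMeasure μ]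
    {s t D : Set α} (h : ∀ x, x ∉ D → (x ∈ s ↔ x ∈ t)) : |μ.real s - μ.real t| ≤ μ.real D := by
  have key : ∀ s t : Set α, (∀ x, x ∉ D → (x ∈ s ↔ x ∈ t)) → μ.real s ≤ μ.real t + μ.real D := by
    intro s t h
    refine (measureReal_mono fun x hx => ?_).trans (measureReal_union_le _ _)
    by_cases hD : x ∈ D
    · exact Or.inr hD
    · exact Or.inl ((h x hD).1 hx)
  have h1 := key s t h
  have h2 := key t s fun x hx => (h x hx).symm
  rw [abs_le]
  constructor <;> linarith

/-- Coupling inequality: both estimators are functions of the same sample and coincide wherever the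
selected orders do. -/
lemma abs_lawG_sub_lawGStar_le {n P k : ℕ} (X : Matrix (Fin n) (Fin P) ℝ) (c : ℕ → ℝ)
    (A : Matrix (Fin k) (Fin P) ℝ) (θ : Fin P → ℝ) (σ : ℝ) {B : Set (Fin k → ℝ)}
    (hB : MeasurableSet B) : |(lawG X c A θ σ).real B - (lawGStar X c A θ σ).real B| ≤
      (sampleMeasure X θ σ).real {Y | pHat X c Y ≠ pHatStar X c σ Y} := by
  rw [lawG_real A θ σ hB, lawGStar_real A θ σ hB]
  refine abs_measureReal_sub_le _ fun Y hY => ?_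
  have : pHat X c Y = pHatStar X c σ Y := not_not.1 hY
  simp only [Set.mem_ofPred_eq, this]

lemma abs_selProb_sub_selProbStar_le {n P : ℕ} (X : Matrix (Fin n) (Fin P) ℝ) (c : ℕ → ℝ)
    (θ : Fin P → ℝ) (σ : ℝ) (p : ℕ) : |selProb X c θ σ p - selProbStar X c θ σ p| ≤
      (sampleMeasure X θ σ).real {Y | pHat X c Y ≠ pHatStar X c σ Y} := by
  refine abs_measureReal_sub_le _ fun Y hY => ?_
  have : pHat X c Y = pHatStar X c σ Y := not_not.1 hY
  simp only [Set.mem_ofPred_eq, this]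

lemma tendsto_of_abs_sub_le {f g ε : ℕ → ℝ} {a : ℝ} (hf : Tendsto f atTop (𝓝 a))
    (hε : Tendsto ε atTop (𝓝 0)) (h : ∀ᶠ n in atTop, |g n - f n| ≤ ε n) :
    Tendsto g atTop (𝓝 a) := by
  have h1 : Tendsto (fun n => g n - f n) atTop (𝓝 0) :=
    squeeze_zero_norm' h hε
  simpa using h1.add hf

namespace LocalDesign

variable {P k O : ℕ} {X : (n : ℕ) → Matrix (Fin n) (Fin P) ℝ} {Q : Matrix (Fin P) (Fin P) ℝ}
  {σn : ℕ → ℝ} {σ : ℝ} {c : ℕ → ℝ}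

lemma tendstoTV_lawG (h : LocalDesign X Q σn σ) (hO : O ≤ P) (hcO : c O = 0)
    (hc : ∀ p, O < p → p ≤ P → 0 < c p)
    (A : Matrix (Fin k) (Fin P) ℝ) {B : Fin P → Matrix (Fin k) (Fin k) ℝ}
    (hB : ∀ j : Fin P, IsGenInverse (covMat Q A ((j : ℕ) + 1)) (B j)) (θ γ : Fin P → ℝ) :
    TendstoTV (fun n => lawG (X n) c A (localAlt θ γ n) (σn n))
      (limitCdf Q A B c σ γ (max (order θ) O)) := by
  obtain ⟨ν, hν, hcdf, hlim⟩ := h.tendstoTV_lawGStar hO hcO A hB θ γ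
  refine ⟨ν, hν, hcdf, ?_⟩
  have hne := tendsto_measureReal_pHat_ne h.gram_posDef hO hcO hc (localAlt θ γ) h.sigma_pos
  refine squeeze_zero (fun n => tvDist_nonneg _ _) (fun n => tvDist_le fun s hs => ?_)
    (by simpa using hne.add hlim)
  exact (abs_sub_le _ _ _).trans (add_le_add (abs_lawG_sub_lawGStar_le _ _ _ _ _ hs)
    (abs_sub_le_tvDist _ _ hs))

/-- With no restriction on the estimator, here through an empty matrix and the whole space, the
results for pieces yield the selection probabilities at once. -/
lemma selProbStar_eq_pieceProb (c : ℕ → ℝ) (θ γ : Fin P → ℝ) (p n : ℕ) :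
    selProbStar (X n) c (localAlt θ γ n) (σn n) p =
      pieceProb X c (0 : Matrix (Fin 0) (Fin P) ℝ) θ γ σn p n Set.univ := by
  simp [selProbStar, pieceProb]

lemma tendstoSel_selProbStar (h : LocalDesign X Q σn σ) (hO : O ≤ P) (hcO : c O = 0)
    (θ γ : Fin P → ℝ) :
    TendstoSel (fun n p => selProbStar (X n) c (localAlt θ γ n) (σn n) p) O Q c σ γ
      (max (order θ) O) := by
  simp only [TendstoSel, selProbStar_eq_pieceProb]
  refine ⟨fun j hj => ?_, ?_, fun p _ hp => ?_⟩
  · obtain ⟨ε, hε, hev⟩ := h.exists_error_piece_succ hO hcO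
      (0 : Matrix (Fin 0) (Fin P) ℝ) γ ((le_max_left _ _).trans hj)
    refine tendsto_of_abs_sub_le tendsto_const_nhds hε ?_
    filter_upwards [hev] with n hn
    have := hn Set.univ MeasurableSet.univ
    rwa [← one_sub_accept h.posDef, ← Set.univ_inter {d | _ ≤ _}]
  · obtain ⟨ε, hε, hev⟩ := h.exists_error_piece_self hO hcO (0 : Matrix (Fin 0) (Fin P) ℝ) θ γ
    have := h.isProbabilityMeasure_limNormal γ (max (order θ) O)
    refine tendsto_of_abs_sub_le tendsto_const_nhds hε ?_
    filter_upwards [hev] with n hn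
    simpa using hn Set.univ MeasurableSet.univ
  · exact squeeze_zero (fun n => measureReal_nonneg)
      (fun n => pieceProb_le_missProb hO _ θ γ hp n _) (h.tendsto_missProb hcO θ γ)

lemma tendstoSel_selProb (h : LocalDesign X Q σn σ) (hO : O ≤ P) (hcO : c O = 0)
    (hc : ∀ p, O < p → p ≤ P → 0 < c p) (θ γ : Fin P → ℝ) :
    TendstoSel (fun n p => selProb (X n) c (localAlt θ γ n) (σn n) p) O Q c σ γ
      (max (order θ) O) := by
  have hne := tendsto_measureReal_pHat_ne h.gram_posDef hO hcO hc (localAlt θ γ) h.sigma_pos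
  obtain ⟨h1, h2, h3⟩ := h.tendstoSel_selProbStar hO hcO θ γ
  have key {p : ℕ} {a : ℝ}
      (hp : Tendsto (fun n => selProbStar (X n) c (localAlt θ γ n) (σn n) p) atTop (𝓝 a)) :
      Tendsto (fun n => selProb (X n) c (localAlt θ γ n) (σn n) p) atTop (𝓝 a) :=
    tendsto_of_abs_sub_le hp hne
      (Eventually.of_forall fun n => abs_selProb_sub_selProbStar_le _ _ _ _ _)
  exact ⟨fun j hj => key (h1 j hj), key h2, fun p hp hp' => key (h3 p hp hp')⟩

lemma integral_restrictedLS (hS : (gram (X n)).PosDef) (hn : 0 < n) (θ : Fin P → ℝ) (s : ℝ)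
    (p : ℕ) (i : Fin P) : (∫ Y, restrictedLS (X n) p Y ∂(sampleMeasure (X n) θ s)) i =
      θ i + delta (gram (X n)) θ p i := by
  have hN := sampleMeasure_isNormal (X n) θ s
  rw [eval_integral]
  · simp only [restrictedLS_apply]
    split_ifs with hi
    · simp only [mulVec]
      rw [hN.mean_dotProduct]
      exact lsMat_mulVec_mulVec hS hn θ p ⟨i, hi⟩
    · simp [delta, hi]
  · intro i
    simp only [restrictedLS_apply]
    split_ifs with hi
    · exact (hN.memLp_dotProduct _).integrable (by norm_num)
    · exact integrable_zero _ _ _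

lemma smul_delta (S : Matrix (Fin P) (Fin P) ℝ) (a : ℝ) (ψ : Fin P → ℝ) (p : ℕ) :
    delta S (a • ψ) p = a • delta S ψ p := by
  funext i
  have h : lastEntries (a • ψ) p = a • lastEntries ψ p := rfl
  simp only [delta, Pi.smul_apply, smul_eq_mul, h, mulVec_smul]
  split_ifs <;> simp

lemma tendsto_scaledBias (h : LocalDesign X Q σn σ) {θ : Fin P → ℝ} (γ : Fin P → ℝ) {p : ℕ}
    (hp : order θ ≤ p) :
    Tendsto (fun n => scaledBias (X n) (localAlt θ γ n) (σn n) p) atTop (𝓝 (delta Q γ p)) := by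
  refine (tendsto_delta h.tendsto_gram h.posDef γ p).congr' ?_
  filter_upwards [eventually_gt_atTop P] with n hn
  rw [← delta_sqrt_localAlt (gram (X n)) γ (show 0 < n by omega) hp, smul_delta, scaledBias]
  congr 1
  funext i
  rw [Pi.sub_apply, integral_restrictedLS (h.gram_posDef n hn) (by omega), add_sub_cancel_left]

/-- Symmetry and non-negativity of the quadratic form pass to the limit; non-singularity then
upgrades semidefinite to definite. -/
lemma posDef_of_tendsto_gram (hX : ∀ n, P < n → (X n).rank = P)
    (hQ : Tendsto (fun n => gram (X n)) atTop (𝓝 Q)) (hdet : IsUnit Q.det) : Q.PosDef := by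
  have hS : ∀ᶠ n in atTop, (gram (X n)).PosDef := by
    filter_upwards [eventually_gt_atTop P] with n hn
    exact PostModelSelection.gram_posDef (hX n hn) (by omega)
  have h1 : Q.PosSemidef := by
    refine .of_dotProduct_mulVec_nonneg ?_ fun x => ?_
    · have hc : Tendsto (fun n => (gram (X n))ᴴ) atTop (𝓝 Qᴴ) :=
        (Continuous.tendsto (by fun_prop : Continuous fun M : Matrix (Fin P) (Fin P) ℝ => Mᴴ)
          Q).comp hQ
      refine tendsto_nhds_unique_of_eventuallyEq hc hQ ?_
      filter_upwards [hS] with n hn using hn.isHermitian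
    · have hc : Tendsto (fun n => star x ⬝ᵥ (gram (X n) *ᵥ x)) atTop (𝓝 (star x ⬝ᵥ (Q *ᵥ x))) :=
        (Continuous.tendsto (by fun_prop :
          Continuous fun M : Matrix (Fin P) (Fin P) ℝ => star x ⬝ᵥ (M *ᵥ x)) Q).comp hQ
      refine ge_of_tendsto hc ?_
      filter_upwards [hS] with n hn using hn.posSemidef.dotProduct_mulVec_nonneg x
  exact h1.posDef_iff_isUnit.2 ((isUnit_iff_isUnit_det _).2 hdet)

end LocalDesign

/-! ### The limit of the scaled parameter, and specialisation to a fixed parameter. -/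

section ScaledParameter

variable {P : ℕ}

/-- The limit of `√n θ⁽ⁿ⁾`. -/
noncomputable def limParam (θ γ : Fin P → ℝ) (i : Fin P) : EReal :=
  if θ i = 0 then (γ i : EReal) else if 0 < θ i then ⊤ else ⊥

lemma tendsto_sqrt_mul_localAlt (θ γ : Fin P → ℝ) :
    Tendsto (fun (n : ℕ) (i : Fin P) => ((√(n : ℝ) * localAlt θ γ n i : ℝ) : EReal))
      atTop (𝓝 (limParam θ γ)) := by
  refine tendsto_pi_nhds.2 fun i => ?_
  have hsqrt : Tendsto (fun n : ℕ => √(n : ℝ)) atTop atTop :=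
    Real.tendsto_sqrt_atTop.comp tendsto_natCast_atTop_atTop
  have e : (fun n : ℕ => ((√(n : ℝ) * θ i + γ i : ℝ) : EReal)) =ᶠ[atTop]
      fun n : ℕ => ((√(n : ℝ) * localAlt θ γ n i : ℝ) : EReal) := by
    filter_upwards [eventually_gt_atTop 0] with n hn
    rw [sqrt_mul_localAlt θ γ hn]
  refine Tendsto.congr' e ?_
  unfold limParam
  split_ifs with h0 hpos
  · simp [h0]
  · rw [EReal.tendsto_coe_nhds_top_iff]
    exact tendsto_atTop_add_const_right _ _ (hsqrt.atTop_mul_const hpos)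
  · rw [EReal.tendsto_coe_nhds_bot_iff]
    exact tendsto_atBot_add_const_right _ _
      (hsqrt.atTop_mul_const_of_neg (lt_of_le_of_ne (not_lt.1 hpos) h0))

lemma limParam_eq_top_or_bot_iff (θ γ : Fin P → ℝ) (i : Fin P) :
    limParam θ γ i = ⊤ ∨ limParam θ γ i = ⊥ ↔ θ i ≠ 0 := by
  unfold limParam
  split_ifs with h0 hpos <;> simp [h0]

/-- The infinite components of the limit are exactly those where `θ` is non-zero, and the last of
these sits at the order of `θ`; `O` takes over when the order does not exceed it. -/
lemma pStar_limParam (O : ℕ) (θ γ : Fin P → ℝ) :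
    pStar O (limParam θ γ) = max (order θ) O := by
  simp only [pStar, limParam_eq_top_or_bot_iff]
  apply le_antisymm
  · refine max_le (le_max_right _ _) (Finset.sup_le fun j hj => ?_)
    have hj := (Finset.mem_filter.1 hj).2.2
    refine le_max_of_le_left ?_
    by_contra hlt
    exact hj (eq_zero_of_order_le (by omega))
  · refine max_le ?_ (le_max_left _ _)
    rcases le_or_gt (order θ) O with h | h
    · exact le_max_of_le_left h
    · refine le_max_of_le_right ?_
      have hP := (order_spec θ).1
      -- Orders count from one and indices from zero. The subtraction is harmless because the order
      -- exceeds `O` and so is positive.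
      set j : Fin P := ⟨order θ - 1, by omega⟩ with hj
      have hj1 : order θ = (j : ℕ) + 1 := by simp only [hj]; omega
      rw [hj1]
      exact Finset.le_sup (f := fun j : Fin P => (j : ℕ) + 1)
        (Finset.mem_filter.2 ⟨Finset.mem_univ _, by omega, ne_zero_of_order_eq hj1⟩)

lemma limParam_of_order_le {θ : Fin P → ℝ} (γ : Fin P → ℝ) {i : Fin P} (h : order θ ≤ (i : ℕ)) :
    limParam θ γ i = γ i := by
  rw [limParam, if_pos (eq_zero_of_order_le h)]

lemma localAlt_zero (θ : Fin P → ℝ) (n : ℕ) : localAlt θ 0 n = θ := by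
  simp [localAlt]

lemma delta_zero (Q : Matrix (Fin P) (Fin P) ℝ) (p : ℕ) : delta Q 0 p = 0 := by
  simpa using LocalDesign.smul_delta Q 0 0 p

lemma accept_zero (Q : Matrix (Fin P) (Fin P) ℝ) (c : ℕ → ℝ) (σ : ℝ) (j : Fin P) :
    accept Q c σ 0 j = acceptFixed Q c σ j := by
  simp [accept, acceptFixed, delta_zero]

lemma limitCdf_zero {k : ℕ} (Q : Matrix (Fin P) (Fin P) ℝ) (A : Matrix (Fin k) (Fin P) ℝ)
    (B : Fin P → Matrix (Fin k) (Fin k) ℝ) (c : ℕ → ℝ) (σ : ℝ) (ps : ℕ) :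
    limitCdf Q A B c σ 0 ps = limitCdfFixed Q A B c σ ps := by
  funext t
  simp [limitCdf, limitCdfFixed, delta_zero, accept_zero]

lemma tendstoSel_zero_iff (π : ℕ → ℕ → ℝ) (O : ℕ) (Q : Matrix (Fin P) (Fin P) ℝ) (c : ℕ → ℝ)
    (σ : ℝ) (ps : ℕ) : TendstoSel π O Q c σ 0 ps ↔ TendstoSelFixed π O Q c σ ps := by
  simp only [TendstoSel, TendstoSelFixed, accept_zero]

end ScaledParameter

end PostModelSelection

theorem corollary5p6
    (P k O : ℕ) (hO : O < P) (hk : 1 ≤ k)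
    (X : (n : ℕ) → Matrix (Fin n) (Fin P) ℝ) (hX : ∀ n, P < n → (X n).rank = P)
    (Q : Matrix (Fin P) (Fin P) ℝ)
    (hQ : Tendsto (fun n : ℕ => (n : ℝ)⁻¹ • ((X n)ᵀ * X n)) atTop (𝓝 Q)) (hQdet : IsUnit Q.det)
    (A : Matrix (Fin k) (Fin P) ℝ) (hA : A.rank = k)
    (c : ℕ → ℝ) (hcO : c O = 0) (hc : ∀ p, O < p → p ≤ P → 0 < c p)
    (B : Fin P → Matrix (Fin k) (Fin k) ℝ)
    (hB : ∀ j : Fin P, IsGenInverse (covMat Q A ((j : ℕ) + 1)) (B j))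
    (θ : Fin P → ℝ) :
    (∀ (γ : Fin P → ℝ) (σn : ℕ → ℝ) (σ : ℝ), (∀ n, 0 < σn n) → 0 < σ →
      Tendsto σn atTop (𝓝 σ) →
      ∃ ψ : Fin P → EReal,
        Tendsto (fun (n : ℕ) (i : Fin P) => ((√(n : ℝ) * localAlt θ γ n i : ℝ) : EReal))
          atTop (𝓝 ψ) ∧
        pStar O ψ = max (order θ) O ∧
        (∀ i : Fin P, pStar O ψ ≤ (i : ℕ) → ψ i = (γ i : EReal)) ∧
        (∀ p : ℕ, pStar O ψ ≤ p → p ≤ P →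
          Tendsto (fun n => scaledBias (X n) (localAlt θ γ n) (σn n) p) atTop
            (𝓝 (delta Q γ p))) ∧
        TendstoTV (fun n => lawGStar (X n) c A (localAlt θ γ n) (σn n))
          (limitCdf Q A B c σ γ (pStar O ψ)) ∧
        TendstoTV (fun n => lawG (X n) c A (localAlt θ γ n) (σn n))
          (limitCdf Q A B c σ γ (pStar O ψ)) ∧
        TendstoSel (fun n p => selProb (X n) c (localAlt θ γ n) (σn n) p) O Q c σ γ
          (pStar O ψ) ∧
        TendstoSel (fun n p => selProbStar (X n) c (localAlt θ γ n) (σn n) p) O Q c σ γ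
          (pStar O ψ)) ∧
    (∀ σ : ℝ, 0 < σ →
      TendstoTV (fun n => lawGStar (X n) c A θ σ) (limitCdfFixed Q A B c σ (max (order θ) O)) ∧
      TendstoTV (fun n => lawG (X n) c A θ σ) (limitCdfFixed Q A B c σ (max (order θ) O)) ∧
      TendstoSelFixed (fun n p => selProb (X n) c θ σ p) O Q c σ (max (order θ) O) ∧
      TendstoSelFixed (fun n p => selProbStar (X n) c θ σ p) O Q c σ (max (order θ) O)) := by
  have hpd := LocalDesign.posDef_of_tendsto_gram hX hQ hQdet
  have hdesign (σn : ℕ → ℝ) (σ : ℝ) (hσn : ∀ n, 0 < σn n) (hσ : 0 < σ)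
      (hlim : Tendsto σn atTop (𝓝 σ)) : LocalDesign X Q σn σ :=
    ⟨fun n hn => gram_posDef (hX n hn) (by omega), hQ, hpd, hσn, hσ, hlim⟩
  refine ⟨fun γ σn σ hσn hσ hlim => ?_, fun σ hσ => ?_⟩
  · have h := hdesign σn σ hσn hσ hlim
    refine ⟨limParam θ γ, tendsto_sqrt_mul_localAlt θ γ, pStar_limParam O θ γ, ?_⟩
    rw [pStar_limParam]
    exact ⟨fun i hi => limParam_of_order_le γ ((le_max_left _ _).trans hi),
      fun p hp _ => h.tendsto_scaledBias γ ((le_max_left _ _).trans hp),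
      h.tendstoTV_lawGStar hO.le hcO A hB θ γ, h.tendstoTV_lawG hO.le hcO hc A hB θ γ,
      h.tendstoSel_selProb hO.le hcO hc θ γ, h.tendstoSel_selProbStar hO.le hcO θ γ⟩
  -- A fixed parameter is the local alternative with `γ = 0` and a constant standard deviation, for
  -- which all bias terms vanish.
  · have h := hdesign (fun _ => σ) σ (fun _ => hσ) hσ tendsto_const_nhds
    have h1 := h.tendstoTV_lawGStar hO.le hcO A hB θ 0
    have h2 := h.tendstoTV_lawG hO.le hcO hc A hB θ 0
    have h3 := h.tendstoSel_selProb hO.le hcO hc θ 0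
    have h4 := h.tendstoSel_selProbStar hO.le hcO θ 0
    simp only [localAlt_zero, limitCdf_zero, tendstoSel_zero_iff] at h1 h2 h3 h4
    exact ⟨h1, h2, h3, h4⟩
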